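/- **Setting.** Let $\mathcal H_1$ be a finite-dimensional complex Hilbert space and let $Z:\mathcal H_1\to\mathscr B(\mathscr K)$ be a CAR field acting irreducibly on a finite-dimensional Hilbert space $\mathscr K\neq 0$: $Z$ is conjugate linear, $Z(\psi)Z^*(\phi)+Z^*(\phi)Z(\psi)=\langle\psi,\phi\rangle\mathbb 1$ and $Z(\psi)Z(\phi)+Z(\phi)Z(\psi)=0$, so that the CAR algebra is $\mathscr A=\mathscr B(\mathscr K)$. Let $\tau$ be the normalized trace; density matrices are taken with respect to $\tau$, and $\Phi^\dagger$ is the adjoint of $\Phi:\mathscr A\to\mathscr A$ for $\langle X,Y\rangle=\tau(X^*Y)$. For $X=\sum_j|\psi_j\rangle\langle\phi_j|$ on $\mathcal H_1$ put $\widehat X=\sum_jZ^*(\psi_j)Z(\phi_j)$. Let $\mathcal N=\widehat{\mathbb 1}$ be the number operator, $W=e^{i\pi\mathcal N}$ the parity operator, and $\mathscr G=\{\mathcal N\}'$ the Araki–Wyss algebra. The symbol of a density matrix $\rho$ is the operator $Q$ with $\langle\phi,Q\psi\rangle=\tau(Z^*(\psi)Z(\phi)\rho)$. $\mathfrak S_{GIG}$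 is the set of gauge invariant Gaussian density matrices, i.e. those with $\tau(Z^*(\psi_1)\cdots Z^*(\psi_m)Z(\phi_n)\cdots Z(\phi_1)\rho)=\delta_{mn}\det(\langle\phi_j,Q\psi_k\rangle)$, where $Q$ is the symbol of $\rho$; for $0\le Q=\sum_j\mu_j|\psi_j\rangle\langle\psi_j|\le\mathbb 1$ (with $\{\psi_j\}$ orthonormal) let $\rho_Q=\prod_j\big(2(1-\mu_j)Z(\psi_j)Z^*(\psi_j)+2\mu_jZ^*(\psi_j)Z(\psi_j)\big)$ be the one with symbol $Q$. The symbol map of $\Phi$ sends $Q$ to the symbol of $\Phi(\rho_Q)$. A GIG quantum operation is a completely positive trace preserving map on $\mathscr A$ that commutes with $\rho\mapsto e^{-is\mathcal N}\rho e^{is\mathcal N}$ for all $s\in\mathbb R$ (gauge covariance) and maps $\mathfrak S_{GIG}$ into itself; a GIG quantum semigroup is a family $\{P_t\}_{t\ge0}$ of such operations, continuous in $t$, with $P_0=\mathbb 1$ and $P_{s+t}=P_sP_t$. For a contraction $S$ on $\mathcal H_1$ and $0\le R\le\mathbb 1-SS^*$ (a compatible pair) let $\Phi_{S,R}$ be the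 Evans–Hugenholtz–Kadison operation: on $\mathscr K\otimes\mathscr K$ consider the CAR field $Z(\psi\oplus\eta)=Z(\psi)\otimes W+\mathbb 1\otimes Z(\eta)$ over $\mathcal H_1\oplus\mathcal H_1$, let $T_{S,R}=((\mathbb 1-SS^*)^+)^{1/2}R((\mathbb 1-SS^*)^+)^{1/2}$ (Moore–Penrose inverse), let $\mathcal U$ be a unitary on $\mathscr K\otimes\mathscr K$ with $\mathcal U Z(\xi)\,\mathcal U^*=Z(U_S\xi)$, where $$U_S=\begin{pmatrix}-(\mathbb 1-SS^*)^{1/2}&S\\ S^*&(\mathbb 1-S^*S)^{1/2}\end{pmatrix},$$ and put $\Phi_{S,R}(\rho)=\mathbb E(\mathcal U^*\rho_{T_{S,R}}\rho\,\mathcal U)$, where $\rho_{T_{S,R}}$ is placed in the subalgebra generated by $Z(\mathcal H_1\oplus0)$, $\rho$ in the one generated by $Z(0\oplus\mathcal H_1)$, and $\mathbb E$ is the tracial conditional expectation onto the former subalgebra, which is identified with $\mathscr A$ through $Z(\psi\oplus0)\leftrightarrow Z(\psi)$. **Statement.** Let $G$ be the generator of a contraction semigroup on $\mathcal H_1$ and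 let $A$ be an operator with $0\le A\le -G-G^*$. Put $2H=-G-G^*$, $K=\frac1{2i}(G-G^*)$, $R_t=\int_0^te^{sG}Ae^{sG^*}\,ds$ and $T=\lim_{\epsilon\downarrow0}(2H+\epsilon\mathbb 1)^{-1/2}A(2H+\epsilon\mathbb 1)^{-1/2}$. Let $\{\eta_j\}$ be any orthonormal basis of $\mathcal H_1$ with $T\eta_j=\lambda_j\eta_j$, let $\phi_j=(2H)^{1/2}\eta_j$, and let $$\begin{aligned}\mathscr L^\dagger_{G,A}(X)=&\sum_j(1-\lambda_j)\big(Z^*(\phi_j)WXWZ(\phi_j)-\tfrac12Z^*(\phi_j)Z(\phi_j)X-\tfrac12XZ^*(\phi_j)Z(\phi_j)\big)\\&+\sum_j\lambda_j\big(Z(\phi_j)WXWZ^*(\phi_j)-\tfrac12Z(\phi_j)Z^*(\phi_j)X-\tfrac12XZ(\phi_j)Z^*(\phi_j)\big)-i[\widehat K,X].\end{aligned}$$ Let $\mathscr L_{G,A}$ be the adjoint of $\mathscr L^\dagger_{G,A}$. Then for every $t\ge 0$ the pair $(e^{tG},R_t)$ is compatible, $\mathscr L^\dagger_{G,A}=\lim_{t\downarrow0}\frac1t\big(\Phi^\dagger_{e^{tG},R_t}-\mathbb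 1\big)$, and: 1. $\{e^{t\mathscr L_{G,A}}\}_{t\ge0}$ is a GIG quantum semigroup on $\mathscr A$; 2. it extends the Araki–Wyss semigroup $\{\Phi_{e^{tG},R_t}|_{\mathscr G}\}_{t\ge0}$: for all $t\ge0$, $e^{t\mathscr L_{G,A}}$ maps $\mathscr G$ into itself and agrees there with $\Phi_{e^{tG},R_t}$; 3. the symbol map of $e^{t\mathscr L_{G,A}}$ is $Q\mapsto R_t+e^{tG}Qe^{tG^*}$ on $\{0\le Q\le\mathbb 1\}$, for all $t\ge0$; 4. for all $t\ge0$, $e^{t\mathscr L_{G,A}}=\lim_{n\to\infty}\big(\Phi_{e^{(t/n)G},R_{t/n}}\big)^n$. -/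

import Mathlib

open scoped TensorProduct InnerProductSpace Topology

noncomputable section

namespace CAR

/-! ## Operators on a finite-dimensional Hilbert space and the normalized trace -/

section Trace

variable {K : Type*} [NormedAddCommGroup K] [InnerProductSpace ℂ K]
variable {K' : Type*} [NormedAddCommGroup K'] [InnerProductSpace ℂ K']

/-- The algebra `𝓑(𝒦)` of bounded operators on `𝒦`. -/
abbrev Op (K : Type*) [NormedAddCommGroup K] [InnerProductSpace ℂ K] : Type _ := K →L[ℂ] K

/-- Super-operators: (bounded) linear maps from `𝓑(𝒦)` to itself, with the operator norm. -/
abbrev SuperOp (K : Type*) [NormedAddCommGroup K] [InnerProductSpace ℂ K] : Type _ :=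
  Op K →L[ℂ] Op K

/-- The normalized trace `τ(X) = (dim 𝒦)⁻¹ Tr X`. -/
def tau : Op K →ₗ[ℂ] ℂ where
  toFun X := (Module.finrank ℂ K : ℂ)⁻¹ * LinearMap.trace ℂ K (X : K →ₗ[ℂ] K)
  map_add' X Y := by simp [mul_add]
  map_smul' c X := by simp; ring

/-- The matrix unit `|e_i⟩⟨e_j|` of the standard orthonormal basis `e` of `𝒦`. -/
def matUnit [FiniteDimensional ℂ K] (i j : Fin (Module.finrank ℂ K)) : Op K :=
  InnerProductSpace.rankOne ℂ (stdOrthonormalBasis ℂ K i) (stdOrthonormalBasis ℂ K j)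

/-- The adjoint `Φ†` of a linear map `Φ : 𝓑(𝒦) → 𝓑(𝒦')` with respect to the inner products
`⟨X, Y⟩ = τ(X* Y)` of the two normalized traces, written out in the basis of matrix units; its
defining property is the lemma `tau_star_traceAdjoint_mul` below. -/
def traceAdjoint [FiniteDimensional ℂ K] [FiniteDimensional ℂ K'] [CompleteSpace K']
    (Φ : Op K →ₗ[ℂ] Op K') : Op K' →ₗ[ℂ] Op K where
  toFun X := ∑ i, ∑ j, ((Module.finrank ℂ K : ℂ) * tau (star (Φ (matUnit i j)) * X)) • matUnit i j
  map_add' X Y := by simp [mul_add, add_smul, Finset.sum_add_distrib]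
  map_smul' c X := by
    simp only [mul_smul_comm, map_smul, smul_eq_mul, Finset.smul_sum, smul_smul, RingHom.id_apply]
    refine Finset.sum_congr rfl fun i _ => Finset.sum_congr rfl fun j _ => ?_
    congr 1
    ring

lemma tau_star [FiniteDimensional ℂ K] [CompleteSpace K] (X : Op K) :
    tau (star X) = star (tau X) := by
  simp only [tau, LinearMap.coe_mk, AddHom.coe_mk, star_mul']
  rw [LinearMap.trace_eq_sum_inner _ (stdOrthonormalBasis ℂ K),
    LinearMap.trace_eq_sum_inner _ (stdOrthonormalBasis ℂ K)]
  simp [ContinuousLinearMap.star_eq_adjoint, ContinuousLinearMap.adjoint_inner_right]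

lemma eq_sum_matUnit [FiniteDimensional ℂ K] (Y : Op K) :
    Y = ∑ i, ∑ j, ⟪stdOrthonormalBasis ℂ K i, Y (stdOrthonormalBasis ℂ K j)⟫_ℂ • matUnit i j := by
  ext x
  simp only [matUnit, sum_apply, smul_apply,
    InnerProductSpace.rankOne_apply, smul_smul]
  conv_lhs => rw [← (stdOrthonormalBasis ℂ K).sum_repr' x, map_sum]
  rw [Finset.sum_comm]
  refine Finset.sum_congr rfl fun j _ => ?_
  rw [map_smul]
  conv_lhs => rw [← (stdOrthonormalBasis ℂ K).sum_repr' (Y _), Finset.smul_sum]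
  refine Finset.sum_congr rfl fun i _ => ?_
  rw [smul_smul, mul_comm]

lemma tau_star_matUnit_mul [FiniteDimensional ℂ K] [CompleteSpace K]
    (i j : Fin (Module.finrank ℂ K)) (Y : Op K) :
    (Module.finrank ℂ K : ℂ) * tau (star (matUnit i j) * Y) =
      ⟪stdOrthonormalBasis ℂ K i, Y (stdOrthonormalBasis ℂ K j)⟫_ℂ := by
  have hd : (Module.finrank ℂ K : ℂ) ≠ 0 := by
    have := i.pos
    exact_mod_cast this.ne'
  simp only [tau, LinearMap.coe_mk, AddHom.coe_mk]
  rw [mul_inv_cancel_left₀ hd, LinearMap.trace_eq_sum_inner _ (stdOrthonormalBasis ℂ K)]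
  simp [ContinuousLinearMap.star_eq_adjoint, matUnit, InnerProductSpace.rankOne_apply,
    inner_smul_right, orthonormal_iff_ite.mp (stdOrthonormalBasis ℂ K).orthonormal]

/-- `⟨Φ†(X), Y⟩ = ⟨X, Φ(Y)⟩` for the inner products `⟨X, Y⟩ = τ(X* Y)`. -/
lemma tau_star_traceAdjoint_mul [FiniteDimensional ℂ K] [FiniteDimensional ℂ K'] [CompleteSpace K]
    [CompleteSpace K'] (Φ : Op K →ₗ[ℂ] Op K') (X : Op K') (Y : Op K) :
    tau (star (traceAdjoint Φ X) * Y) = tau (star X * Φ Y) := by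
  conv_rhs => rw [eq_sum_matUnit Y]
  simp only [traceAdjoint, LinearMap.coe_mk, AddHom.coe_mk, star_sum, star_smul, Finset.sum_mul,
    map_sum, smul_mul_assoc, map_smul, Finset.mul_sum, mul_smul_comm, smul_eq_mul]
  refine Finset.sum_congr rfl fun i _ => Finset.sum_congr rfl fun j _ => ?_
  rw [← tau_star_matUnit_mul, star_mul', ← tau_star]
  simp
  ring

/-- The adjoint `Φ†` of a super-operator with respect to `⟨X, Y⟩ = τ(X* Y)`. -/
def dagger [FiniteDimensional ℂ K] [CompleteSpace K] (Φ : SuperOp K) : SuperOp K :=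
  LinearMap.toContinuousLinearMap (traceAdjoint Φ.toLinearMap)

/-- A quantum operation: a completely positive, trace preserving linear map. -/
structure IsQuantumOperation [CompleteSpace K] (Φ : SuperOp K) : Prop where
  completelyPositive :
    ∃ F : CompletelyPositiveMap (Op K) (Op K), ∀ X, F.toLinearMap X = Φ X
  tracePreserving : ∀ X, tau (Φ X) = tau X

/-- A density matrix with respect to the normalized trace; it represents the state
`A ↦ τ(A ρ)`. -/
structure IsDensity [CompleteSpace K] (ρ : Op K) : Prop where
  nonneg : 0 ≤ ρ
  tau_eq_one : tau ρ = 1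

end Trace

/-! ## CAR fields, second quantization, gauge group, gauge invariant Gaussian states -/

section Field

variable {H : Type*} [NormedAddCommGroup H] [InnerProductSpace ℂ H]
variable {K : Type*} [NormedAddCommGroup K] [InnerProductSpace ℂ K] [CompleteSpace K]

/-- The canonical anticommutation relations for a conjugate linear map `Z : ℋ₁ → 𝓑(𝒦)`
(the relation for `Z*(ψ), Z*(φ)` is the adjoint of `anticomm`). -/
structure IsCARField (Z : H →ₗ⋆[ℂ] Op K) : Prop where
  anticomm_star : ∀ ψ φ, Z ψ * star (Z φ) + star (Z φ) * Z ψ = ⟪ψ, φ⟫_ℂ • (1 : Op K)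
  anticomm : ∀ ψ φ, Z ψ * Z φ + Z φ * Z ψ = 0

/-- `Z` acts irreducibly on `𝒦 ≠ 0`: no non-trivial subspace of `𝒦` is invariant under all `Z(ψ)`
and `Z*(ψ)`. -/
structure IsIrreducible (Z : H →ₗ⋆[ℂ] Op K) : Prop where
  nontrivial : Nontrivial K
  eq_bot_or_eq_top : ∀ V : Submodule ℂ K,
    (∀ ψ, ∀ v ∈ V, Z ψ v ∈ V ∧ star (Z ψ) v ∈ V) → V = ⊥ ∨ V = ⊤

variable [FiniteDimensional ℂ H]

/-- `X̂ = ∑_j Z*(X e_j) Z(e_j)`, i.e. `∑_j Z*(ψ_j) Z(φ_j)` for `X = ∑_j |ψ_j⟩⟨φ_j|`. -/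
def hat (Z : H →ₗ⋆[ℂ] Op K) (X : Op H) : Op K :=
  ∑ j, star (Z (X (stdOrthonormalBasis ℂ H j))) * Z (stdOrthonormalBasis ℂ H j)

/-- The number operator `𝒩 = ∑_j Z*(e_j) Z(e_j)`. -/
def number (Z : H →ₗ⋆[ℂ] Op K) : Op K := hat Z 1

/-- The parity operator `W = e^{iπ𝒩} = (-1)^𝒩`, implementing the principal automorphism. -/
def parity (Z : H →ₗ⋆[ℂ] Op K) : Op K :=
  NormedSpace.exp ((Real.pi * Complex.I : ℂ) • number Z)

/-- The dual `ρ ↦ e^{-it𝒩} ρ e^{it𝒩}`, on density matrices, of the gauge automorphism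
`α_{G,t}(A) = e^{it𝒩} A e^{-it𝒩}`. -/
def gaugeDual (Z : H →ₗ⋆[ℂ] Op K) (t : ℝ) : SuperOp K :=
  ContinuousLinearMap.mulLeftRight ℂ (Op K)
    (NormedSpace.exp ((-(t * Complex.I) : ℂ) • number Z))
    (NormedSpace.exp ((t * Complex.I : ℂ) • number Z))

/-- Gauge covariance of a super-operator. -/
def IsGaugeCovariant (Z : H →ₗ⋆[ℂ] Op K) (Φ : SuperOp K) : Prop :=
  ∀ t : ℝ, gaugeDual Z t ∘L Φ = Φ ∘L gaugeDual Z t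

/-- The Araki–Wyss algebra: the commutant of the number operator. -/
def arakiWyss (Z : H →ₗ⋆[ℂ] Op K) : Subalgebra ℂ (Op K) :=
  Subalgebra.centralizer ℂ {number Z}


/-- `Q` is the symbol of the state with density matrix `ρ`:
`⟨φ, Q ψ⟩ = ρ(Z*(ψ) Z(φ))` for all `φ, ψ`. -/
def IsSymbol (Z : H →ₗ⋆[ℂ] Op K) (ρ : Op K) (Q : Op H) : Prop :=
  ∀ φ ψ : H, ⟪φ, Q ψ⟫_ℂ = tau (star (Z ψ) * Z φ * ρ)

/-- `ρ` is the density matrix of a gauge invariant Gaussian state: all its moments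
`ρ(Z*(ψ_1) ⋯ Z*(ψ_m) Z(φ_n) ⋯ Z(φ_1))` are determined by its symbol `Q` through determinants. -/
structure IsGIG (Z : H →ₗ⋆[ℂ] Op K) (ρ : Op K) : Prop where
  density : IsDensity ρ
  moments : ∃ Q : Op H, IsSymbol Z ρ Q ∧
    (∀ (m n : ℕ) (ψ : Fin m → H) (φ : Fin n → H), m ≠ n →
      tau ((List.ofFn fun i => star (Z (ψ i))).prod *
        (List.ofFn fun i => Z (φ i)).reverse.prod * ρ) = 0) ∧
    (∀ (n : ℕ) (ψ φ : Fin n → H),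
      tau ((List.ofFn fun i => star (Z (ψ i))).prod *
        (List.ofFn fun i => Z (φ i)).reverse.prod * ρ) =
          (Matrix.of fun j k => ⟪φ j, Q (ψ k)⟫_ℂ).det)

/-- A gauge invariant Gaussian quantum operation: gauge covariant and mapping the set of gauge
invariant Gaussian states into itself. -/
structure IsGIGOperation (Z : H →ₗ⋆[ℂ] Op K) (Φ : SuperOp K) : Prop where
  operation : IsQuantumOperation Φ
  covariant : IsGaugeCovariant Z Φ
  mapsTo : ∀ ρ, IsGIG Z ρ → IsGIG Z (Φ ρ)

/-- A (continuous) semigroup `{P_t}_{t ≥ 0}` of gauge invariant Gaussian quantum operations. -/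
structure IsGIGSemigroup (Z : H →ₗ⋆[ℂ] Op K) (P : ℝ → SuperOp K) : Prop where
  zero : P 0 = 1
  add : ∀ s t, 0 ≤ s → 0 ≤ t → P (s + t) = P s * P t
  continuous : ContinuousOn P (Set.Ici 0)
  operation : ∀ t, 0 ≤ t → IsGIGOperation Z (P t)

/-- The density matrix `ρ_Q = ∏_j (2 (1 - μ_j) Z(ψ_j) Z*(ψ_j) + 2 μ_j Z*(ψ_j) Z(ψ_j))` of the gauge
invariant Gaussian state with symbol `Q = ∑_j μ_j |ψ_j⟩⟨ψ_j|` (self-adjoint, used for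
`0 ≤ Q ≤ 1`; set to `0` if `Q` is not self-adjoint). The factors commute. -/
def gaussian (Z : H →ₗ⋆[ℂ] Op K) (Q : Op H) : Op K :=
  open Classical in
  if hQ : (Q : H →ₗ[ℂ] H).IsSymmetric then
    (List.ofFn fun j : Fin (Module.finrank ℂ H) =>
      (2 * (1 - hQ.eigenvalues rfl j) : ℂ) •
        (Z (hQ.eigenvectorBasis rfl j) * star (Z (hQ.eigenvectorBasis rfl j))) +
      (2 * hQ.eigenvalues rfl j : ℂ) •
        (star (Z (hQ.eigenvectorBasis rfl j)) * Z (hQ.eigenvectorBasis rfl j))).prod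
  else 0

end Field

/-! ## The Evans–Hugenholtz–Kadison construction -/

section EHK

variable {H : Type*} [NormedAddCommGroup H] [InnerProductSpace ℂ H]
  [CompleteSpace H]
variable {K : Type*} [NormedAddCommGroup K] [InnerProductSpace ℂ K]

/-- The square root of a positive operator. -/
def sqrtOp (X : Op H) : Op H := cfc Real.sqrt X

/-- For a positive operator `X`, the square root `(X⁺)^{1/2}` of its Moore–Penrose inverse (in Lean
`0⁻¹ = 0`); this is `X^{-1/2}` if `X` is invertible. -/
def invSqrtOp (X : Op H) : Op H := cfc (fun x : ℝ => (Real.sqrt x)⁻¹) X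

/-- Compatible pairs `(S, R)`: `S` is a contraction and `0 ≤ R ≤ 1 - S S*`. -/
structure IsCompatible (S R : Op H) : Prop where
  contraction : ‖S‖ ≤ 1
  nonneg : 0 ≤ R
  le : R ≤ 1 - S * star S

/-- The operator `T = ((1 - S S*)⁺)^{1/2} R ((1 - S S*)⁺)^{1/2}`, for which
`R = (1 - S S*)^{1/2} T (1 - S S*)^{1/2}` and `ker (1 - S S*) ⊆ ker T`. -/
def ancilla (S R : Op H) : Op H :=
  invSqrtOp (1 - S * star S) * R * invSqrtOp (1 - S * star S)

/-- The block operator `[a, b; c, d]` on `ℋ₁ ⊕ ℋ₁`. -/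
def block (a b c d : Op H) : Op (WithLp 2 (H × H)) :=
  (WithLp.prodContinuousLinearEquiv 2 ℂ H H).symm.toContinuousLinearMap ∘L
    ((a ∘L ContinuousLinearMap.fst ℂ H H + b ∘L ContinuousLinearMap.snd ℂ H H).prod
      (c ∘L ContinuousLinearMap.fst ℂ H H + d ∘L ContinuousLinearMap.snd ℂ H H)) ∘L
    (WithLp.prodContinuousLinearEquiv 2 ℂ H H).toContinuousLinearMap

/-- The unitary dilation `U_S = [-(1 - S S*)^{1/2}, S; S*, (1 - S* S)^{1/2}]`. -/
def dilation (S : Op H) : Op (WithLp 2 (H × H)) :=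
  block (-sqrtOp (1 - S * star S)) S (star S) (sqrtOp (1 - star S * S))

instance instCompleteSpaceTensor [FiniteDimensional ℂ K] : CompleteSpace (K ⊗[ℂ] K) := FiniteDimensional.complete ℂ _

variable [FiniteDimensional ℂ H] [CompleteSpace K]

/-- The CAR field `Z(ψ ⊕ η) = Z(ψ) ⊗ W + 1 ⊗ Z(η)` over `ℋ₁ ⊕ ℋ₁` acting on `𝒦 ⊗ 𝒦`. -/
def double (Z : H →ₗ⋆[ℂ] Op K) : WithLp 2 (H × H) →ₗ⋆[ℂ] Op (K ⊗[ℂ] K) where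
  toFun ξ := TensorProduct.mapL (Z ξ.fst) (parity Z) + TensorProduct.mapL 1 (Z ξ.snd)
  map_add' ξ ζ := by
    simp only [WithLp.add_fst, WithLp.add_snd, map_add, TensorProduct.mapL_add_left,
      TensorProduct.mapL_add_right]
    abel
  map_smul' c ξ := by
    simp only [WithLp.smul_fst, WithLp.smul_snd, LinearMap.map_smulₛₗ,
      TensorProduct.mapL_smul_left, TensorProduct.mapL_smul_right, smul_add]

/-- The linear map `X ↦ X ⊗ Y`. -/
def tensorRight (Y : Op K) : Op K →ₗ[ℂ] Op (K ⊗[ℂ] K) where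
  toFun X := TensorProduct.mapL X Y
  map_add' _ _ := TensorProduct.mapL_add_left _ _ _
  map_smul' _ _ := TensorProduct.mapL_smul_left _ _ _

/-- The principal automorphism `X ↦ W X W`. -/
def principal (Z : H →ₗ⋆[ℂ] Op K) : Op K →ₗ[ℂ] Op K :=
  (ContinuousLinearMap.mulLeftRight ℂ (Op K) (parity Z) (parity Z)).toLinearMap

/-- The embedding of `𝓑(𝒦)` onto the subalgebra `𝒜_{ℋ₁ ⊕ 0}` generated by the operators
`Z(ψ ⊕ 0) = Z(ψ) ⊗ W`, namely the `*`-homomorphism with `Z(ψ) ↦ Z(ψ ⊕ 0)`: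
`X ↦ X₀ ⊗ 1 + X₁ ⊗ W` with `X₀ = (X + W X W) / 2` the even part of `X` and `X₁ = (X - W X W) / 2`
its odd part. -/
def embedFst (Z : H →ₗ⋆[ℂ] Op K) : Op K →ₗ[ℂ] Op (K ⊗[ℂ] K) :=
  tensorRight 1 ∘ₗ ((1 / 2 : ℂ) • (LinearMap.id + principal Z)) +
    tensorRight (parity Z) ∘ₗ ((1 / 2 : ℂ) • (LinearMap.id - principal Z))

/-- The embedding of `𝓑(𝒦)` onto the subalgebra `𝒜_{0 ⊕ ℋ₁}` generated by the operators
`Z(0 ⊕ ψ) = 1 ⊗ Z(ψ)`, namely the `*`-homomorphism `X ↦ 1 ⊗ X`. -/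
def embedSnd : Op K →ₗ[ℂ] Op (K ⊗[ℂ] K) where
  toFun X := TensorProduct.mapL 1 X
  map_add' _ _ := TensorProduct.mapL_add_right _ _ _
  map_smul' _ _ := TensorProduct.mapL_smul_right _ _ _

variable [FiniteDimensional ℂ K]

/-- A unitary `𝒰_U` on `𝒦` implementing the automorphism `α_U(Z(ψ)) = Z(U ψ)`, that is,
`𝒰_U Z(ψ) 𝒰_U* = Z(U ψ)`. For an irreducible CAR field `Z` and unitary `U` it exists and is
unique up to a phase, so that `α_U(X) = 𝒰_U X 𝒰_U*` does not depend on the choice. -/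
def implementer {H K : Type*} [NormedAddCommGroup H] [InnerProductSpace ℂ H]
    [NormedAddCommGroup K] [InnerProductSpace ℂ K] [CompleteSpace K]
    (Z : H →ₗ⋆[ℂ] Op K) (U : Op H) : Op K :=
  open Classical in
  if h : ∃ V ∈ unitary (Op K), ∀ ψ, V * Z ψ * star V = Z (U ψ) then h.choose else 1

/-- The dual `ρ ↦ 𝒰_U* ρ 𝒰_U`, on density matrices, of the automorphism `α_U`. -/
def secondQuantDual {H K : Type*} [NormedAddCommGroup H] [InnerProductSpace ℂ H]
    [NormedAddCommGroup K] [InnerProductSpace ℂ K] [CompleteSpace K]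
    (Z : H →ₗ⋆[ℂ] Op K) (U : Op H) : SuperOp K :=
  ContinuousLinearMap.mulLeftRight ℂ (Op K) (star (implementer Z U)) (implementer Z U)

/-- The Evans–Hugenholtz–Kadison operation `Φ_{S,R}(ρ) = 𝔼(α̂_{U_S}(ρ_T ρ))`. Here `ρ` is placed
in `𝒜_{0 ⊕ ℋ₁}`, `ρ_T` in `𝒜_{ℋ₁ ⊕ 0}` with `T = ancilla S R`, and `𝔼` is the tracial conditional expectation
onto `𝒜_{ℋ₁ ⊕ 0}` (the orthogonal projection for `⟨X, Y⟩ = τ(X* Y)`), followed by the identification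
of `𝒜_{ℋ₁ ⊕ 0}` with `𝓑(𝒦)`: as `embedFst` preserves `τ(X* Y)`, that composition is the adjoint of
`embedFst`. -/
def ehk (Z : H →ₗ⋆[ℂ] Op K) (S R : Op H) : SuperOp K :=
  LinearMap.toContinuousLinearMap
    (traceAdjoint (embedFst Z) ∘ₗ
      (secondQuantDual (double Z) (dilation S)).toLinearMap ∘ₗ
      LinearMap.mulLeft ℂ (embedFst Z (gaussian Z (ancilla S R))) ∘ₗ embedSnd)

end EHK

/-! ## The semigroup data `(G, A)` and the Lindblad generator -/

section Generator

variable {H : Type*} [NormedAddCommGroup H] [InnerProductSpace ℂ H] [CompleteSpace H]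

/-- `G` generates a contraction semigroup. -/
def IsContractionGenerator (G : Op H) : Prop :=
  ∀ t : ℝ, 0 ≤ t → ‖NormedSpace.exp ((t : ℂ) • G)‖ ≤ 1

/-- `R_t = ∫₀ᵗ e^{sG} A e^{sG*} ds`. -/
def integralR (G A : Op H) (t : ℝ) : Op H :=
  ∫ s in (0 : ℝ)..t,
    NormedSpace.exp ((s : ℂ) • G) * A * NormedSpace.exp ((s : ℂ) • star G)

/-- `K = (G - G*) / (2i)`. -/
def hamiltonian (G : Op H) : Op H := (1 / (2 * Complex.I) : ℂ) • (G - star G)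

/-- `T = lim_{ε ↓ 0} (2H + ε)^{-1/2} A (2H + ε)^{-1/2}` with `2H = -G - G*`. -/
def mixing (G A : Op H) : Op H :=
  Filter.limUnder (𝓝[>] (0 : ℝ)) fun ε : ℝ =>
    invSqrtOp (-G - star G + (ε : ℂ) • 1) * A * invSqrtOp (-G - star G + (ε : ℂ) • 1)

variable [FiniteDimensional ℂ H]
variable {K : Type*} [NormedAddCommGroup K] [InnerProductSpace ℂ K] [CompleteSpace K]

/-- The Lindblad generator (in the Heisenberg picture)
`X ↦ B* W X W B - ½ B* B X - ½ X B* B`. -/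
def lindbladTerm (W B : Op K) : SuperOp K :=
  ContinuousLinearMap.mulLeftRight ℂ (Op K) (star B * W) (W * B)
    - (1 / 2 : ℂ) • ContinuousLinearMap.mulLeftRight ℂ (Op K) (star B * B) 1
    - (1 / 2 : ℂ) • ContinuousLinearMap.mulLeftRight ℂ (Op K) 1 (star B * B)

/-- The Lindblad generator
`L†(X) = ∑_j (1 - λ_j) (Z*(φ_j) W X W Z(φ_j) - ½ Z*(φ_j) Z(φ_j) X - ½ X Z*(φ_j) Z(φ_j))`
`+ ∑_j λ_j (Z(φ_j) W X W Z*(φ_j) - ½ Z(φ_j) Z*(φ_j) X - ½ X Z(φ_j) Z*(φ_j)) - i [K̂, X]`,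
where `φ_j = (2H)^{1/2} η_j`, `2H = -G - G*` and `K = (G - G*) / (2i)`. -/
def lindbladGenerator (Z : H →ₗ⋆[ℂ] Op K) (G : Op H)
    (η : OrthonormalBasis (Fin (Module.finrank ℂ H)) ℂ H)
    (lam : Fin (Module.finrank ℂ H) → ℝ) : SuperOp K :=
  (∑ j, ((1 - lam j : ℝ) : ℂ) • lindbladTerm (parity Z) (Z (sqrtOp (-G - star G) (η j))))
    + (∑ j, (lam j : ℂ) • lindbladTerm (parity Z) (star (Z (sqrtOp (-G - star G) (η j)))))
    - Complex.I • (ContinuousLinearMap.mulLeftRight ℂ (Op K) (hat Z (hamiltonian G)) 1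
        - ContinuousLinearMap.mulLeftRight ℂ (Op K) 1 (hat Z (hamiltonian G)))

end Generator

end CAR

end

noncomputable section

namespace CAR

set_option linter.unusedSectionVars false

/-! ### Exponentials in a complex Banach algebra. -/

section ExpTools

variable {𝔸 : Type*} [NormedRing 𝔸] [NormedAlgebra ℂ 𝔸] [CompleteSpace 𝔸]

/-! The proof rests on the antiderivations ∂_χ (`contract`), graded commutators with Z*(χ): they
send Z(φ) to ⟨φ, χ⟩ and kill Z*(φ). A unital, *-preserving super-operator Ψ is quasi-free with data
(S, R) when Ψ(Z*(ψ) X) = Z*(S*ψ) Ψ(X) + Ψ(∂_{Rψ} X). This relation strips creation operators one at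
a time, and irreducibility makes the normally ordered monomials span 𝓑(𝒦), so the data determine Ψ
(`IsQuasiFree.eq`).

Two maps turn out to be quasi-free with the same data (e^{tG}, R_t). One is the dual
Evans–Hugenholtz–Kadison operation: the dilation splits Z*(ψ) into a system part, which gives S*ψ,
and an ancilla part, which the exchange relation of ρ_T turns into the contraction with Rψ
(`isQuasiFree_dagger_ehk`). The other is the exponential of the Lindblad generator L†. It satisfies
L†∂_χ = ∂_χL† − ∂_{Gχ} and L†(Z*(ψ)X) = Z*(ψ)L†(X) + Z*(G*ψ)X + ∂_{Aψ}X, and integrating these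
linear differential equations produces e^{tG} and R_t (`lindbladGenerator_contract`,
`lindbladGenerator_creation_mul`, `isQuasiFree_exp`).

Hence Φ_{e^{tG},R_t} is the exponential of the adjoint generator on the whole of 𝓑(𝒦), not only on
the Araki–Wyss algebra (`ehk_exp`). The limit at t = 0 is then the derivative of an exponential, the
extension property reduces to gauge covariance, and the product formula concerns a sequence that is
constant from n = 1 on.

For the Gaussian claims, the determinant formula for moments is the iterated exchange relation
τ(Z*(ψ)Xρ) = τ(∂_{Qψ}X ρ), by Laplace expansion (`HasExchange.moments`, `IsGIG.hasExchange`). The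
semigroup transports this relation with Q ↦ R_t + e^{tG}Qe^{tG*} (`HasExchange.map`). Complete
positivity comes from writing the exponential as a limit of powers of maps in Kraus form, and gauge
covariance from the cancellation of phases in each Lindblad term. -/

lemma exp_add_commute {x y : 𝔸} (h : Commute x y) :
    NormedSpace.exp (x + y) = NormedSpace.exp x * NormedSpace.exp y := by
  let := NormedAlgebra.restrictScalars ℚ ℂ 𝔸
  exact NormedSpace.exp_add_of_commute h

lemma exp_neg_mul_exp (x : 𝔸) : NormedSpace.exp (-x) * NormedSpace.exp x = 1 := by
  rw [← exp_add_commute (Commute.refl x).neg_left, neg_add_cancel, NormedSpace.exp_zero]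

lemma exp_mul_exp_neg (x : 𝔸) : NormedSpace.exp x * NormedSpace.exp (-x) = 1 := by
  rw [← exp_add_commute (Commute.refl x).neg_right, add_neg_cancel, NormedSpace.exp_zero]

lemma exp_smul_one_complex (c : ℂ) : NormedSpace.exp (c • (1 : 𝔸)) = Complex.exp c • 1 := by
  have := NormedSpace.algebraMap_exp_comm (𝕂 := ℂ) (𝔸 := 𝔸) c
  rw [Algebra.algebraMap_eq_smul_one, Algebra.algebraMap_eq_smul_one] at this
  rw [← this, Complex.exp_eq_exp_ℂ]

/-- The hypothesis says that x intertwines a + c·1 with a; the exponential preserves intertwining,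
and the central summand contributes the factor e^c. -/
lemma exp_mul_eq_smul_mul_exp {a x : 𝔸} {c : ℂ} (h : a * x = x * a + c • x) :
    NormedSpace.exp a * x = Complex.exp c • (x * NormedSpace.exp a) := by
  let := NormedAlgebra.restrictScalars ℚ ℂ 𝔸
  have hs : SemiconjBy x (a + c • 1) a := by
    simp [SemiconjBy, h, mul_add]
  have h1 := hs.exp_right
  rw [exp_add_commute (by simp [Commute, SemiconjBy]), exp_smul_one_complex] at h1
  simpa [SemiconjBy] using h1.symm

/-- Split 1 = p + (1 - p): multiplication by c • p acts as c on the first summand and as 0 on the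
second. -/
lemma exp_smul_of_idempotent {p : 𝔸} (hp : p * p = p) (c : ℂ) :
    NormedSpace.exp (c • p) = 1 + (Complex.exp c - 1) • p := by
  have h1 : NormedSpace.exp (c • p) * p = Complex.exp c • p := by
    have hs : SemiconjBy p (c • 1) (c • p) := by simp [SemiconjBy, hp]
    let := NormedAlgebra.restrictScalars ℚ ℂ 𝔸
    have := hs.exp_right
    rw [exp_smul_one_complex] at this
    simpa [SemiconjBy] using this.symm
  have h2 : NormedSpace.exp (c • p) * (1 - p) = 1 - p := by
    have hs : SemiconjBy (1 - p) ((0 : ℂ) • 1) (c • p) := by simp [SemiconjBy, hp, mul_sub]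
    let := NormedAlgebra.restrictScalars ℚ ℂ 𝔸
    have := hs.exp_right
    rw [exp_smul_one_complex] at this
    simpa [SemiconjBy] using this.symm
  calc NormedSpace.exp (c • p) = NormedSpace.exp (c • p) * p + NormedSpace.exp (c • p) * (1 - p) := by
        rw [← mul_add]; simp
    _ = _ := by rw [h1, h2, sub_smul, one_smul]; abel

lemma exp_sum_eq_one {ι : Type*} (s : Finset ι) (f : ι → 𝔸)
    (h : ∀ i ∈ s, NormedSpace.exp (f i) = 1)
    (hc : ∀ i ∈ s, ∀ j ∈ s, i ≠ j → Commute (f i) (f j)) :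
    NormedSpace.exp (∑ i ∈ s, f i) = 1 := by
  classical
  induction s using Finset.induction_on with
  | empty => simp
  | insert a s ha ih =>
    rw [Finset.sum_insert ha, exp_add_commute, h a (by simp), ih, one_mul]
    · exact fun i hi => h i (by simp [hi])
    · exact fun i hi j hj => hc i (by simp [hi]) j (by simp [hj])
    · refine Commute.sum_right _ _ _ fun i hi => hc a (by simp) i (by simp [hi]) ?_
      rintro rfl
      exact ha hi

end ExpTools

/-! ### Canonical anticommutation relations, second quantization and parity. -/

section Field

variable {H : Type*} [NormedAddCommGroup H] [InnerProductSpace ℂ H]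
variable {K : Type*} [NormedAddCommGroup K] [InnerProductSpace ℂ K] [CompleteSpace K]
variable {Z : H →ₗ⋆[ℂ] Op K}

namespace IsCARField

lemma mul_star_eq (hZ : IsCARField Z) (ψ φ : H) :
    Z ψ * star (Z φ) = ⟪ψ, φ⟫_ℂ • (1 : Op K) - star (Z φ) * Z ψ :=
  eq_sub_of_add_eq (hZ.anticomm_star ψ φ)

lemma mul_eq_neg (hZ : IsCARField Z) (ψ φ : H) : Z ψ * Z φ = -(Z φ * Z ψ) :=
  eq_neg_of_add_eq_zero_left (hZ.anticomm ψ φ)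

lemma star_mul_star_eq_neg (hZ : IsCARField Z) (ψ φ : H) :
    star (Z ψ) * star (Z φ) = -(star (Z φ) * star (Z ψ)) := by
  rw [← star_mul, hZ.mul_eq_neg, star_neg, star_mul]

lemma mul_self (hZ : IsCARField Z) (ψ : H) : Z ψ * Z ψ = 0 := by
  have := hZ.anticomm ψ ψ
  rwa [← two_smul ℂ, smul_eq_zero_iff_right two_ne_zero] at this

lemma star_mul_star_self (hZ : IsCARField Z) (ψ : H) : star (Z ψ) * star (Z ψ) = 0 := by
  rw [← star_mul, hZ.mul_self, star_zero]

end IsCARField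

variable (Z) in
/-- The creation operators `Z*(ψ)` as a linear map. -/
def creation : H →ₗ[ℂ] Op K where
  toFun ψ := star (Z ψ)
  map_add' _ _ := by simp
  map_smul' c ψ := by simp [LinearMap.map_smulₛₗ]

@[simp] lemma creation_apply (ψ : H) : creation Z ψ = star (Z ψ) := rfl

variable [FiniteDimensional ℂ H]

lemma star_hat [CompleteSpace H] (X : Op H) : star (hat Z X) = hat Z (star X) := by
  have h : ∀ j, Z (X (stdOrthonormalBasis ℂ H j)) =
      ∑ i, ⟪X (stdOrthonormalBasis ℂ H j), stdOrthonormalBasis ℂ H i⟫_ℂ •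
        Z (stdOrthonormalBasis ℂ H i) := by
    intro j
    conv_lhs => rw [← (stdOrthonormalBasis ℂ H).sum_repr' (X (stdOrthonormalBasis ℂ H j))]
    simp [LinearMap.map_smulₛₗ]
  have h' : ∀ i, star (Z (star X (stdOrthonormalBasis ℂ H i))) =
      ∑ j, ⟪X (stdOrthonormalBasis ℂ H j), stdOrthonormalBasis ℂ H i⟫_ℂ •
        star (Z (stdOrthonormalBasis ℂ H j)) := by
    intro i
    conv_lhs => rw [← (stdOrthonormalBasis ℂ H).sum_repr' (star X (stdOrthonormalBasis ℂ H i))]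
    simp [LinearMap.map_smulₛₗ, ContinuousLinearMap.star_eq_adjoint,
      ContinuousLinearMap.adjoint_inner_right]
  unfold hat
  simp only [star_sum, star_mul, star_star]
  simp_rw [h', h, Finset.mul_sum, Finset.sum_mul]
  rw [Finset.sum_comm]
  simp

/-- Moving Z*(χ) to the left past Z(e_j) leaves ⟨e_j, χ⟩ Z*(X e_j), and these terms resum to Z*(Xχ).
-/
lemma hat_mul_creation (hZ : IsCARField Z) (X : Op H) (χ : H) :
    hat Z X * star (Z χ) = star (Z χ) * hat Z X + star (Z (X χ)) := by
  have h : star (Z (X χ)) = ∑ j, ⟪stdOrthonormalBasis ℂ H j, χ⟫_ℂ •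
      star (Z (X (stdOrthonormalBasis ℂ H j))) := by
    conv_lhs => rw [← (stdOrthonormalBasis ℂ H).sum_repr' χ]
    simp [LinearMap.map_smulₛₗ]
  rw [h]
  unfold hat
  rw [Finset.sum_mul, Finset.mul_sum, ← Finset.sum_add_distrib]
  refine Finset.sum_congr rfl fun j _ => ?_
  rw [mul_assoc, hZ.mul_star_eq, mul_sub, ← mul_assoc, hZ.star_mul_star_eq_neg]
  simp only [mul_smul_comm, mul_one, neg_mul, mul_assoc]
  abel

lemma exp_hat_mul_creation (hZ : IsCARField Z) {X : Op H} {χ : H} {c : ℂ} (h : X χ = c • χ)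
    (a : ℂ) : NormedSpace.exp (a • hat Z X) * star (Z χ) =
      Complex.exp (a * c) • (star (Z χ) * NormedSpace.exp (a • hat Z X)) := by
  apply exp_mul_eq_smul_mul_exp
  rw [smul_mul_assoc, hat_mul_creation hZ, h, smul_add, mul_smul_comm]
  simp [LinearMap.map_smulₛₗ, smul_smul]

lemma star_number [CompleteSpace H] : star (number Z) = number Z := by
  rw [number, star_hat, star_one]

lemma star_exp_smul_number [CompleteSpace H] (a : ℂ) :
    star (NormedSpace.exp (a • number Z)) = NormedSpace.exp (star a • number Z) := by
  rw [NormedSpace.star_exp, star_smul, star_number]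

lemma exp_number_mul_creation (hZ : IsCARField Z) (χ : H) (a : ℂ) :
    NormedSpace.exp (a • number Z) * star (Z χ) =
      Complex.exp a • (star (Z χ) * NormedSpace.exp (a • number Z)) := by
  have h := exp_hat_mul_creation hZ (X := 1) (χ := χ) (c := 1) (by simp) a
  rwa [mul_one] at h

lemma exp_number_mul (hZ : IsCARField Z) [CompleteSpace H] (χ : H) (a : ℂ) :
    NormedSpace.exp (a • number Z) * Z χ =
      Complex.exp (-a) • (Z χ * NormedSpace.exp (a • number Z)) := by
  have h := congrArg star (exp_number_mul_creation hZ χ (star a))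
  simp only [star_mul, star_smul, star_star, star_exp_smul_number] at h
  rw [h, smul_smul]
  have : Complex.exp (-a) * star (Complex.exp (star a)) = 1 := by
    rw [Complex.star_def, ← Complex.exp_conj, Complex.conj_conj,
      ← Complex.exp_add, neg_add_cancel, Complex.exp_zero]
  rw [this, one_smul]

lemma parity_mul_creation (hZ : IsCARField Z) (χ : H) :
    parity Z * star (Z χ) = -(star (Z χ) * parity Z) := by
  rw [parity, exp_number_mul_creation hZ, Complex.exp_pi_mul_I, neg_one_smul]

lemma parity_mul (hZ : IsCARField Z) [CompleteSpace H] (χ : H) :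
    parity Z * Z χ = -(Z χ * parity Z) := by
  rw [parity, exp_number_mul hZ, Complex.exp_neg, Complex.exp_pi_mul_I]
  simp

/-- Orthogonal modes anticommute, so passing the two factors of the occupation number costs two
signs. -/
lemma commute_number_modes (hZ : IsCARField Z) {ψ φ : H} (h : ⟪ψ, φ⟫_ℂ = 0) :
    Commute (star (Z ψ) * Z ψ) (Z φ) ∧ Commute (star (Z ψ) * Z ψ) (star (Z φ)) := by
  have h' : ⟪φ, ψ⟫_ℂ = 0 := by rw [← inner_conj_symm, h, map_zero]
  have e1 := hZ.anticomm_star ψ φ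
  have e2 := hZ.anticomm_star φ ψ
  rw [h, zero_smul] at e1
  rw [h', zero_smul] at e2
  have e1 := eq_neg_of_add_eq_zero_left e1
  have e2 := eq_neg_of_add_eq_zero_left e2
  constructor
  · rw [Commute, SemiconjBy, mul_assoc, hZ.mul_eq_neg ψ φ, mul_neg, ← mul_assoc, ← mul_assoc, e2,
      neg_mul]
  · rw [Commute, SemiconjBy, mul_assoc, e1, mul_neg, ← mul_assoc, ← mul_assoc,
      hZ.star_mul_star_eq_neg φ ψ, neg_mul]

lemma number_mode_idempotent (hZ : IsCARField Z) {ψ : H} (h : ⟪ψ, ψ⟫_ℂ = 1) :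
    (star (Z ψ) * Z ψ) * (star (Z ψ) * Z ψ) = star (Z ψ) * Z ψ := by
  have e := hZ.mul_star_eq ψ ψ
  rw [mul_assoc, ← mul_assoc (Z ψ), e, h, sub_mul, mul_assoc (star (Z ψ)), hZ.mul_self]
  simp

/-- The square is the exponential of 2πi times a sum of commuting idempotents, one for each mode. -/
lemma parity_mul_self (hZ : IsCARField Z) : parity Z * parity Z = 1 := by
  rw [parity, ← exp_add_commute (Commute.refl _), number, hat, ← add_smul, Finset.smul_sum]
  set b := stdOrthonormalBasis ℂ H
  refine exp_sum_eq_one _ _ (fun i _ => ?_) fun i _ j _ hij => ?_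
  · change NormedSpace.exp (_ • (star (Z (b i)) * Z (b i))) = 1
    rw [exp_smul_of_idempotent (number_mode_idempotent hZ (by simp [b]))]
    have : Complex.exp (Real.pi * Complex.I + Real.pi * Complex.I) = 1 := by
      rw [Complex.exp_add, Complex.exp_pi_mul_I]; norm_num
    rw [this]; simp
  · have h : ⟪b i, b j⟫_ℂ = 0 := b.orthonormal.2 hij
    have := commute_number_modes hZ h
    exact ((this.2.mul_right this.1).smul_left _).smul_right _

/-- The number operator is self-adjoint, so W is unitary; with W² = 1 its adjoint is W itself. -/
lemma star_parity [CompleteSpace H] (hZ : IsCARField Z) : star (parity Z) = parity Z := by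
  have h1 : star (parity Z) * parity Z = 1 := by
    rw [parity, star_exp_smul_number]
    have : star ((Real.pi : ℂ) * Complex.I) = -(Real.pi * Complex.I) := by simp
    rw [this, neg_smul, exp_neg_mul_exp]
  calc star (parity Z) = star (parity Z) * (parity Z * parity Z) := by
        rw [parity_mul_self hZ, mul_one]
    _ = parity Z := by rw [← mul_assoc, h1, one_mul]

end Field

/-! ### Duality for the normalized trace. -/

section Trace

variable {K : Type*} [NormedAddCommGroup K] [InnerProductSpace ℂ K]
variable {K' : Type*} [NormedAddCommGroup K'] [InnerProductSpace ℂ K']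

lemma tau_mul_comm (X Y : Op K) : tau (X * Y) = tau (Y * X) := by
  simp only [tau, LinearMap.coe_mk, AddHom.coe_mk]
  congr 1
  exact LinearMap.trace_mul_comm ℂ (X : K →ₗ[ℂ] K) (Y : K →ₗ[ℂ] K)

variable [FiniteDimensional ℂ K] [FiniteDimensional ℂ K'] [CompleteSpace K] [CompleteSpace K']

lemma tau_one [Nontrivial K] : tau (1 : Op K) = 1 := by
  simp only [tau, LinearMap.coe_mk, AddHom.coe_mk]
  have : ((1 : Op K) : K →ₗ[ℂ] K) = 1 := rfl
  rw [this, LinearMap.trace_one, inv_mul_cancel₀]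
  exact_mod_cast (Module.finrank_pos (R := ℂ) (M := K)).ne'

lemma ext_tau_mul {X Y : Op K} (h : ∀ V, tau (V * X) = tau (V * Y)) : X = Y := by
  rw [eq_sum_matUnit X, eq_sum_matUnit Y]
  simp_rw [← tau_star_matUnit_mul, h]

lemma ext_mul_tau {X Y : Op K} (h : ∀ V, tau (X * V) = tau (Y * V)) : X = Y :=
  ext_tau_mul fun V => by rw [tau_mul_comm, h, tau_mul_comm]

lemma tau_star_mul_traceAdjoint (Φ : Op K →ₗ[ℂ] Op K') (X : Op K') (Y : Op K) :
    tau (star Y * traceAdjoint Φ X) = tau (star (Φ Y) * X) := by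
  have h := congrArg star (tau_star_traceAdjoint_mul Φ X Y)
  rwa [← tau_star, ← tau_star, star_mul, star_mul, star_star, star_star] at h

lemma tau_star_dagger_mul (Φ : SuperOp K) (X Y : Op K) :
    tau (star (dagger Φ X) * Y) = tau (star X * Φ Y) :=
  tau_star_traceAdjoint_mul _ X Y

/-- Uniqueness of the adjoint, by faithfulness of the trace pairing. The algebraic rules for
`dagger` all come from here, without the matrix units of its definition. -/
lemma eq_dagger {Φ Ψ : SuperOp K}
    (h : ∀ X Y, tau (star (Ψ X) * Y) = tau (star X * Φ Y)) : Ψ = dagger Φ := by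
  ext1 X
  refine star_injective (ext_mul_tau fun V => ?_)
  rw [h, tau_star_dagger_mul]

lemma dagger_dagger (Φ : SuperOp K) : dagger (dagger Φ) = Φ := by
  refine (eq_dagger fun X Y => ?_).symm
  have h := congrArg star (tau_star_dagger_mul Φ Y X)
  rw [← tau_star, ← tau_star, star_mul, star_mul, star_star, star_star] at h
  exact h.symm

lemma dagger_mul (Φ Ψ : SuperOp K) : dagger (Φ * Ψ) = dagger Ψ * dagger Φ := by
  refine (eq_dagger fun X Y => ?_).symm
  simp only [mul_apply_eq_comp, tau_star_dagger_mul]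

lemma dagger_one : dagger (1 : SuperOp K) = 1 :=
  (eq_dagger (Φ := (1 : SuperOp K)) fun X Y => by rw [one_apply_eq_self, one_apply_eq_self]).symm

lemma dagger_add (Φ Ψ : SuperOp K) : dagger (Φ + Ψ) = dagger Φ + dagger Ψ := by
  refine (eq_dagger fun X Y => ?_).symm
  simp only [add_apply, star_add, add_mul, mul_add, map_add, tau_star_dagger_mul]

lemma dagger_smul (c : ℂ) (Φ : SuperOp K) : dagger (c • Φ) = star c • dagger Φ := by
  refine (eq_dagger fun X Y => ?_).symm
  simp only [smul_apply, star_smul, smul_mul_assoc, mul_smul_comm, map_smul, tau_star_dagger_mul,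
    star_star]

lemma dagger_mulLeftRight (A B : Op K) :
    dagger (ContinuousLinearMap.mulLeftRight ℂ (Op K) A B) =
      ContinuousLinearMap.mulLeftRight ℂ (Op K) (star A) (star B) := by
  refine (eq_dagger fun X Y => ?_).symm
  simp only [ContinuousLinearMap.mulLeftRight_apply, star_mul, star_star]
  rw [mul_assoc, tau_mul_comm]
  simp only [mul_assoc]

/-- `Φ ↦ Φ†` as a real-linear map. -/
def daggerₗ : SuperOp K →ₗ[ℝ] SuperOp K where
  toFun := dagger
  map_add' := dagger_add
  map_smul' c Φ := by
    have e : ∀ Ψ : SuperOp K, (c : ℂ) • Ψ = c • Ψ := fun Ψ => by ext; simp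
    have h := dagger_smul (c : ℂ) Φ
    rwa [e, Complex.star_def, Complex.conj_ofReal, e] at h

lemma dagger_sub (Φ Ψ : SuperOp K) : dagger (Φ - Ψ) = dagger Φ - dagger Ψ :=
  map_sub daggerₗ Φ Ψ

lemma dagger_sum {ι : Type*} (s : Finset ι) (f : ι → SuperOp K) :
    dagger (∑ i ∈ s, f i) = ∑ i ∈ s, dagger (f i) :=
  map_sum daggerₗ f s

lemma dagger_pow (Φ : SuperOp K) (n : ℕ) : dagger (Φ ^ n) = dagger Φ ^ n := by
  induction n with
  | zero => simp [dagger_one]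
  | succ n ih => rw [pow_succ, dagger_mul, ih, pow_succ']

lemma continuous_dagger : Continuous (dagger (K := K)) :=
  LinearMap.continuous_of_finiteDimensional (E := SuperOp K) (F' := SuperOp K) daggerₗ

/-- The adjoint is continuous, real linear and compatible with powers, hence acts term by term on
the exponential series, whose coefficients are real. -/
lemma dagger_exp (Φ : SuperOp K) :
    dagger (NormedSpace.exp Φ) = NormedSpace.exp (dagger Φ) := by
  have h1 := NormedSpace.exp_series_hasSum_exp' (𝕂 := ℂ) Φ
  have h2 := NormedSpace.exp_series_hasSum_exp' (𝕂 := ℂ) (dagger Φ)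
  have h3 := h1.map (daggerₗ (K := K)).toAddMonoidHom continuous_dagger
  refine h3.unique ?_
  have h : ((daggerₗ (K := K)).toAddMonoidHom ∘ fun n : ℕ => ((n.factorial : ℂ)⁻¹) • Φ ^ n) =
      fun n : ℕ => ((n.factorial : ℂ)⁻¹) • dagger Φ ^ n := by
    funext n
    have := dagger_smul ((n.factorial : ℂ)⁻¹) (Φ ^ n)
    rw [dagger_pow] at this
    change dagger _ = _
    simpa using this
  rw [h]
  exact h2

end Trace

/-! ## Graded commutators -/

section Graded

variable {K : Type*} [NormedAddCommGroup K] [InnerProductSpace ℂ K]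

/-- The graded commutator `X ↦ B X - W X W B` with an odd operator `B`, where `X ↦ W X W` is the
grading. -/
def gradedComm (W B : Op K) : SuperOp K :=
  ContinuousLinearMap.mulLeftRight ℂ (Op K) B 1 - ContinuousLinearMap.mulLeftRight ℂ (Op K) W (W * B)

variable {W A B X Y : Op K}

lemma gradedComm_apply : gradedComm W B X = B * X - W * X * W * B := by
  simp [gradedComm, mul_assoc]

lemma gradedComm_mul (hW : W * W = 1) :
    gradedComm W B (X * Y) = gradedComm W B X * Y + W * X * W * gradedComm W B Y := by
  simp only [gradedComm_apply, sub_mul, mul_sub, mul_assoc]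
  rw [← mul_assoc W W (Y * _), hW, one_mul]
  abel

lemma grading_mul (hW : W * W = 1) : W * (X * Y) * W = (W * X * W) * (W * Y * W) := by
  simp only [mul_assoc]
  rw [← mul_assoc W W, hW, one_mul]

lemma grading_grading (hW : W * W = 1) : W * (W * X * W) * W = X := by
  simp only [← mul_assoc, hW, one_mul]
  rw [mul_assoc, hW, mul_one]

lemma grading_odd (hW : W * W = 1) (hB : W * B = -(B * W)) : W * B * W = -B := by
  rw [hB, neg_mul, mul_assoc, hW, mul_one]

lemma grading_gradedComm (hW : W * W = 1) (hB : W * B = -(B * W)) :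
    W * gradedComm W B X * W = -gradedComm W B (W * X * W) := by
  rw [gradedComm_apply, gradedComm_apply, mul_sub, sub_mul, grading_mul hW, grading_mul hW,
    grading_odd hW hB, grading_grading hW]
  noncomm_ring

lemma gradedComm_odd (hW : W * W = 1) (hA : W * A = -(A * W)) :
    gradedComm W B A = B * A + A * B := by
  rw [gradedComm_apply, grading_odd hW hA]; simp

lemma gradedComm_odd_mul (hW : W * W = 1) (hA : W * A = -(A * W)) :
    gradedComm W B (A * X) = (B * A + A * B) * X - A * gradedComm W B X := by
  rw [gradedComm_mul hW, gradedComm_odd hW hA, grading_odd hW hA]; noncomm_ring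

lemma gradedComm_mul_odd (hW : W * W = 1) (hA : W * A = -(A * W)) :
    gradedComm W B (X * A) = gradedComm W B X * A + W * X * W * (B * A + A * B) := by
  rw [gradedComm_mul hW, gradedComm_odd hW hA]

/-- Graded Jacobi identity: the anticommutator of two odd operators is even and enters through an
ordinary commutator. For field operators it is a scalar, so their graded commutators anticommute. -/
lemma gradedComm_gradedComm (hW : W * W = 1) (hA : W * A = -(A * W)) (hB : W * B = -(B * W)) :
    gradedComm W A (gradedComm W B X) = -gradedComm W B (gradedComm W A X) +
      ((A * B + B * A) * X - X * (A * B + B * A)) := by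
  simp only [gradedComm_apply (B := A), gradedComm_apply (B := B) (X := _ - _), grading_gradedComm hW hB]
  simp only [gradedComm_apply, mul_sub, sub_mul, grading_grading hW, grading_mul hW,
    grading_odd hW hA]
  noncomm_ring

end Graded

/-! ### Contractions as antiderivations. -/

section Field

variable {H : Type*} [NormedAddCommGroup H] [InnerProductSpace ℂ H]
  [FiniteDimensional ℂ H] [CompleteSpace H]
variable {K : Type*} [NormedAddCommGroup K] [InnerProductSpace ℂ K] [CompleteSpace K]
variable {Z : H →ₗ⋆[ℂ] Op K}

variable (Z) in
/-- The graded commutator with the creation operator `Z*(χ)`, the antiderivation with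
`Z(φ) ↦ ⟨φ, χ⟩` and `Z*(φ) ↦ 0`. -/
def contract : H →ₗ[ℂ] SuperOp K where
  toFun χ := gradedComm (parity Z) (creation Z χ)
  map_add' χ ξ := by
    ext1 X; simp only [gradedComm_apply, map_add, add_apply]; noncomm_ring
  map_smul' c χ := by
    ext1 X
    simp only [gradedComm_apply, map_smul, smul_apply, smul_mul_assoc, mul_smul_comm, smul_sub,
      RingHom.id_apply]

lemma contract_eq (χ : H) : contract Z χ = gradedComm (parity Z) (star (Z χ)) := rfl

lemma contract_creation_mul (hZ : IsCARField Z) (χ ψ : H) (X : Op K) :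
    contract Z χ (star (Z ψ) * X) = -(star (Z ψ) * contract Z χ X) := by
  rw [contract_eq, gradedComm_odd_mul (parity_mul_self hZ) (parity_mul_creation hZ ψ),
    hZ.star_mul_star_eq_neg χ ψ]
  simp

lemma contract_mul_field (hZ : IsCARField Z) (χ φ : H) (X : Op K) :
    contract Z χ (X * Z φ) = contract Z χ X * Z φ + ⟪φ, χ⟫_ℂ • (parity Z * X * parity Z) := by
  rw [contract_eq, gradedComm_mul_odd (parity_mul_self hZ) (parity_mul hZ φ),
    add_comm (star (Z χ) * _), hZ.anticomm_star]
  simp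

lemma contract_one (hZ : IsCARField Z) (χ : H) : contract Z χ 1 = 0 := by
  rw [contract_eq, gradedComm_apply, mul_one, mul_one, parity_mul_self hZ, one_mul, sub_self]

/-! ## Normally ordered monomials -/

variable (Z) in
/-- `Z*(ψ_1) ⋯ Z*(ψ_m)`. -/
def creators {m : ℕ} (ψ : Fin m → H) : Op K := (List.ofFn fun i => star (Z (ψ i))).prod

variable (Z) in
/-- `Z(φ_n) ⋯ Z(φ_1)`. -/
def annihilators {n : ℕ} (φ : Fin n → H) : Op K := (List.ofFn fun i => Z (φ i)).reverse.prod

lemma creators_zero (ψ : Fin 0 → H) : creators Z ψ = 1 := by simp [creators]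

lemma annihilators_zero (φ : Fin 0 → H) : annihilators Z φ = 1 := by simp [annihilators]

lemma creators_succ {m : ℕ} (ψ : Fin (m + 1) → H) :
    creators Z ψ = star (Z (ψ 0)) * creators Z (fun i => ψ i.succ) := by
  simp [creators, List.ofFn_succ]

lemma annihilators_succ {n : ℕ} (φ : Fin (n + 1) → H) :
    annihilators Z φ = annihilators Z (fun i => φ i.succ) * Z (φ 0) := by
  simp [annihilators, List.ofFn_succ]

lemma star_creators {m : ℕ} (ψ : Fin m → H) : star (creators Z ψ) = annihilators Z ψ := by
  induction m with
  | zero => simp [creators_zero, annihilators_zero]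
  | succ m ih => rw [creators_succ, annihilators_succ, star_mul, ih, star_star]

lemma grading_annihilators (hZ : IsCARField Z) {n : ℕ} (φ : Fin n → H) :
    parity Z * annihilators Z φ * parity Z = (-1 : ℂ) ^ n • annihilators Z φ := by
  induction n with
  | zero => simp [annihilators_zero, parity_mul_self hZ]
  | succ n ih =>
    rw [annihilators_succ, grading_mul (parity_mul_self hZ), ih,
      grading_odd (parity_mul_self hZ) (parity_mul hZ _), pow_succ]
    simp

lemma contract_creators_mul (hZ : IsCARField Z) {m : ℕ} (ψ : Fin m → H) (χ : H) (X : Op K) :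
    contract Z χ (creators Z ψ * X) = (-1 : ℂ) ^ m • (creators Z ψ * contract Z χ X) := by
  induction m with
  | zero => simp [creators_zero]
  | succ m ih =>
    rw [creators_succ, mul_assoc, contract_creation_mul hZ, ih, pow_succ]
    simp [mul_assoc]

/-- The product is in reversed order, so n - i factors stand to the left of Z(φ_i). Each contributes
a sign to the graded Leibniz rule, and (-1)^(n-i) = (-1)^(n+i). -/
lemma contract_annihilators (hZ : IsCARField Z) {n : ℕ} (φ : Fin (n + 1) → H) (χ : H) :
    contract Z χ (annihilators Z φ) =
      ∑ i : Fin (n + 1), ((-1 : ℂ) ^ (n + (i : ℕ)) * ⟪φ i, χ⟫_ℂ) • annihilators Z (fun k => φ (i.succAbove k)) := by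
  induction n with
  | zero =>
    rw [annihilators_succ, contract_mul_field hZ]
    simp [annihilators_zero, contract_one hZ, parity_mul_self hZ]
  | succ n ih =>
    rw [annihilators_succ, contract_mul_field hZ, ih, add_comm, grading_annihilators hZ,
      Finset.sum_mul]
    conv_rhs => rw [Fin.sum_univ_succ]
    congr 1
    · simp [smul_smul, mul_comm]
    · refine Finset.sum_congr rfl fun i _ => ?_
      rw [annihilators_succ]
      simp only [Fin.succ_succAbove_succ, Fin.succ_succAbove_zero, smul_mul_assoc, Fin.val_succ]
      congr 2
      ring

/-- The sum has the shape of a Laplace expansion along one column: for m = n the sign reduces to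
(-1)^i. This is how determinants enter. -/
lemma contract_monomial (hZ : IsCARField Z) {m n : ℕ} (ψ : Fin m → H) (φ : Fin (n + 1) → H)
    (χ : H) : contract Z χ (creators Z ψ * annihilators Z φ) =
      ∑ i : Fin (n + 1), ((-1 : ℂ) ^ (m + n + (i : ℕ)) * ⟪φ i, χ⟫_ℂ) •
        (creators Z ψ * annihilators Z (fun k => φ (i.succAbove k))) := by
  rw [contract_creators_mul hZ, contract_annihilators hZ, Finset.mul_sum, Finset.smul_sum]
  refine Finset.sum_congr rfl fun i _ => ?_
  rw [mul_smul_comm, smul_smul]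
  congr 1
  ring

lemma contract_creators (hZ : IsCARField Z) {m : ℕ} (ψ : Fin m → H) (χ : H) :
    contract Z χ (creators Z ψ) = 0 := by
  have := contract_creators_mul hZ ψ χ 1
  simpa [contract_one hZ] using this

variable (Z) in
/-- The span of the normally ordered monomials. -/
def monomialSpan : Submodule ℂ (Op K) :=
  Submodule.span ℂ {X | ∃ (m n : ℕ) (ψ : Fin m → H) (φ : Fin n → H),
    X = creators Z ψ * annihilators Z φ}

lemma monomial_mem {m n : ℕ} (ψ : Fin m → H) (φ : Fin n → H) :
    creators Z ψ * annihilators Z φ ∈ monomialSpan Z :=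
  Submodule.subset_span ⟨m, n, ψ, φ, rfl⟩

lemma creators_mul_creation (hZ : IsCARField Z) {m : ℕ} (ψ : Fin m → H) (χ : H) :
    creators Z ψ * star (Z χ) = (-1 : ℂ) ^ m • (star (Z χ) * creators Z ψ) := by
  induction m with
  | zero => simp [creators_zero]
  | succ m ih =>
    rw [creators_succ, mul_assoc, ih, mul_smul_comm, ← mul_assoc, hZ.star_mul_star_eq_neg, pow_succ]
    simp [mul_assoc]

lemma mul_field_mem (χ : H) {X : Op K} (hX : X ∈ monomialSpan Z) : X * Z χ ∈ monomialSpan Z := by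
  induction hX using Submodule.span_induction with
  | mem X hX =>
    obtain ⟨m, n, ψ, φ, rfl⟩ := hX
    have := monomial_mem (Z := Z) ψ (Fin.cons χ φ : Fin (n + 1) → H)
    rw [annihilators_succ] at this
    simpa [mul_assoc] using this
  | zero => simp
  | add X Y _ _ hX hY => rw [add_mul]; exact add_mem hX hY
  | smul c X _ hX => rw [smul_mul_assoc]; exact Submodule.smul_mem _ _ hX

/-- Normal ordering: Z*(χ) moves through all annihilation operators at once. This gives a sign and a
contraction term with one annihilation operator fewer. -/
lemma mul_creation_mem (hZ : IsCARField Z) (χ : H) {X : Op K} (hX : X ∈ monomialSpan Z) :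
    X * star (Z χ) ∈ monomialSpan Z := by
  induction hX using Submodule.span_induction with
  | mem X hX =>
    obtain ⟨m, n, ψ, φ, rfl⟩ := hX
    have h1 : annihilators Z φ * star (Z χ) =
        (-1 : ℂ) ^ n • (star (Z χ) * annihilators Z φ - contract Z χ (annihilators Z φ)) := by
      rw [contract_eq, gradedComm_apply, grading_annihilators hZ, sub_sub_cancel, smul_mul_assoc,
        smul_smul, ← mul_pow]
      simp
    have h2 : creators Z ψ * contract Z χ (annihilators Z φ) ∈ monomialSpan Z := by
      cases n with
      | zero => simp [annihilators_zero, contract_one hZ]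
      | succ n =>
        rw [contract_annihilators hZ, Finset.mul_sum]
        refine sum_mem fun i _ => ?_
        rw [mul_smul_comm]
        exact Submodule.smul_mem _ _ (monomial_mem _ _)
    have h3 : creators Z ψ * (star (Z χ) * annihilators Z φ) ∈ monomialSpan Z := by
      have := monomial_mem (Z := Z) (Fin.cons χ ψ : Fin (m + 1) → H) φ
      rw [creators_succ] at this
      simp only [Fin.cons_zero, Fin.cons_succ] at this
      rw [← mul_assoc, creators_mul_creation hZ, smul_mul_assoc]
      exact Submodule.smul_mem _ _ this
    rw [mul_assoc, h1, mul_smul_comm, mul_sub]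
    exact Submodule.smul_mem _ _ (sub_mem h3 h2)
  | zero => simp
  | add X Y _ _ hX hY => rw [add_mul]; exact add_mem hX hY
  | smul c X _ hX => rw [smul_mul_assoc]; exact Submodule.smul_mem _ _ hX

variable (Z) in
/-- The algebra generated by the field operators. -/
def fieldAlgebra : Subalgebra ℂ (Op K) :=
  Algebra.adjoin ℂ (Set.range Z ∪ Set.range fun ψ => star (Z ψ))

lemma field_mem (ψ : H) : Z ψ ∈ fieldAlgebra Z := Algebra.subset_adjoin (Or.inl ⟨ψ, rfl⟩)

lemma creation_mem (ψ : H) : star (Z ψ) ∈ fieldAlgebra Z :=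
  Algebra.subset_adjoin (Or.inr ⟨ψ, rfl⟩)

/-- The span contains 1 and is stable under right multiplication by the generators, hence by the
algebra they generate. -/
lemma fieldAlgebra_le_monomialSpan (hZ : IsCARField Z) {X : Op K} (hX : X ∈ fieldAlgebra Z) :
    X ∈ monomialSpan Z := by
  have h : ∀ Y ∈ monomialSpan Z, Y * X ∈ monomialSpan Z := by
    induction hX using Algebra.adjoin_induction with
    | mem X hX =>
      rcases hX with ⟨χ, rfl⟩ | ⟨χ, rfl⟩
      · exact fun Y hY => mul_field_mem χ hY
      · exact fun Y hY => mul_creation_mem hZ χ hY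
    | algebraMap c =>
      intro Y hY
      rw [Algebra.algebraMap_eq_smul_one, mul_smul_comm, mul_one]
      exact Submodule.smul_mem _ _ hY
    | add X X' _ _ h h' => intro Y hY; rw [mul_add]; exact add_mem (h Y hY) (h' Y hY)
    | mul X X' _ _ h h' => intro Y hY; rw [← mul_assoc]; exact h' _ (h Y hY)
  have h1 := monomial_mem (Z := Z) (Fin.elim0 : Fin 0 → H) (Fin.elim0 : Fin 0 → H)
  rw [creators_zero, annihilators_zero, one_mul] at h1
  simpa using h 1 h1

end Field

/-! ### Irreducibility: the field operators generate all of 𝓑(𝒦). -/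

section Irreducible

variable {H : Type*} [NormedAddCommGroup H] [InnerProductSpace ℂ H]
  [FiniteDimensional ℂ H] [CompleteSpace H]
variable {K : Type*} [NormedAddCommGroup K] [InnerProductSpace ℂ K] [CompleteSpace K]
  [FiniteDimensional ℂ K]
variable {Z : H →ₗ⋆[ℂ] Op K}

instance instIsScalarTowerFieldAlgebra : IsScalarTower ℂ (fieldAlgebra Z) K :=
  ⟨fun _ _ _ => rfl⟩

lemma isSimpleModule_fieldAlgebra (hirr : IsIrreducible Z) : IsSimpleModule (fieldAlgebra Z) K := by
  have := hirr.nontrivial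
  refine @IsSimpleModule.mk _ _ _ _ _ (@IsSimpleOrder.mk _ _ _ ?_ ?_)
  · exact inferInstance
  · intro V
    let V' : Submodule ℂ K := V.restrictScalars ℂ
    have h := hirr.eq_bot_or_eq_top V' fun ψ v hv =>
      ⟨V.smul_mem (⟨Z ψ, field_mem ψ⟩ : fieldAlgebra Z) hv,
        V.smul_mem (⟨star (Z ψ), creation_mem ψ⟩ : fieldAlgebra Z) hv⟩
    simpa [V'] using h

/-- The field operators of an irreducible CAR field generate all operators. -/
lemma fieldAlgebra_eq_top (hirr : IsIrreducible Z) : fieldAlgebra Z = ⊤ := by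
  have := hirr.nontrivial
  have := isSimpleModule_fieldAlgebra hirr
  refine Algebra.eq_top_iff.mpr fun Y => ?_
  -- Schur's lemma: an eigenspace of f is nonzero and invariant under the field operators, hence is
  -- everything.
  have hschur : ∀ f : Module.End (fieldAlgebra Z) K, ∃ c : ℂ, ∀ v, f v = c • v := by
    intro f
    let f' : K →ₗ[ℂ] K := f.restrictScalars ℂ
    obtain ⟨c, hc⟩ := Module.End.exists_eigenvalue f'
    obtain ⟨v, hv⟩ := hc.exists_hasEigenvector
    refine ⟨c, ?_⟩
    have h := hirr.eq_bot_or_eq_top (Module.End.eigenspace f' c) fun ψ w hw => by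
      simp only [Module.End.mem_eigenspace_iff] at hw ⊢
      constructor
      · have := f.map_smul (⟨Z ψ, field_mem ψ⟩ : fieldAlgebra Z) w
        change f (Z ψ w) = Z ψ (f w) at this
        change f (Z ψ w) = _
        rw [this]
        change f w = _ at hw
        rw [hw, map_smul]
      · have := f.map_smul (⟨star (Z ψ), creation_mem ψ⟩ : fieldAlgebra Z) w
        change f (star (Z ψ) w) = star (Z ψ) (f w) at this
        change f (star (Z ψ) w) = _
        rw [this]
        change f w = _ at hw
        rw [hw, map_smul]
    rcases h with h | h
    · exact absurd h hc
    · intro w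
      have hw : w ∈ Module.End.eigenspace f' c := h ▸ Submodule.mem_top
      exact Module.End.mem_eigenspace_iff.mp hw
  -- As the commutant consists of scalars, Y is linear over it. Jacobson density then gives an
  -- element of the field algebra that agrees with Y on a basis.
  let F : Module.End (Module.End (fieldAlgebra Z) K) K :=
    { toFun := Y
      map_add' := map_add Y
      map_smul' := fun f v => by
        obtain ⟨c, hc⟩ := hschur f
        simp [hc] }
  classical
  obtain ⟨r, hr⟩ := jacobson_density F
    (Finset.univ.image (stdOrthonormalBasis ℂ K))
  have hY : Y = (r : Op K) := by
    apply ContinuousLinearMap.coe_injective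
    refine (stdOrthonormalBasis ℂ K).toBasis.ext fun i => ?_
    exact hr (stdOrthonormalBasis ℂ K i) (by simp)
  rw [hY]
  exact r.2

lemma mem_monomialSpan (hZ : IsCARField Z) (hirr : IsIrreducible Z) (X : Op K) :
    X ∈ monomialSpan Z :=
  fieldAlgebra_le_monomialSpan hZ (fieldAlgebra_eq_top hirr ▸ Algebra.mem_top)

/-! ## Quasi-free maps -/

variable (Z) in
/-- The quasi-free maps `Ψ` in the Heisenberg picture with one-particle data `(S, R)`. -/
structure IsQuasiFree (Ψ : SuperOp K) (S R : Op H) : Prop where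
  map_one : Ψ 1 = 1
  map_star : ∀ X, Ψ (star X) = star (Ψ X)
  map_creation_mul : ∀ ψ X, Ψ (star (Z ψ) * X) =
    star (Z (star S ψ)) * Ψ X + Ψ (contract Z (R ψ) X)

namespace IsQuasiFree

lemma map_creators {Ψ : SuperOp K} {S R : Op H} (hΨ : IsQuasiFree Z Ψ S R)
    (hZ : IsCARField Z) {m : ℕ} (ψ : Fin m → H) :
    Ψ (creators Z ψ) = creators Z (fun i => star S (ψ i)) := by
  induction m with
  | zero => simp [creators_zero, hΨ.map_one]
  | succ m ih =>
    rw [creators_succ, hΨ.map_creation_mul, ih, contract_creators hZ, map_zero, add_zero,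
      creators_succ (fun i => star S (ψ i))]

lemma map_annihilators {Ψ : SuperOp K} {S R : Op H} (hΨ : IsQuasiFree Z Ψ S R)
    (hZ : IsCARField Z) {m : ℕ} (ψ : Fin m → H) :
    Ψ (annihilators Z ψ) = annihilators Z (fun i => star S (ψ i)) := by
  rw [← star_creators, hΨ.map_star, hΨ.map_creators hZ, star_creators]

/-- The quasi-free relation removes the leftmost creation operator. Its contraction term has the
remaining creation operators and one annihilation operator fewer, so the induction must hold for
every n. The base case comes from *-preservation. -/
lemma map_monomial_eq {Ψ Ψ' : SuperOp K} {S R : Op H} (hΨ : IsQuasiFree Z Ψ S R)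
    (hΨ' : IsQuasiFree Z Ψ' S R) (hZ : IsCARField Z) {m n : ℕ} (ψ : Fin m → H) (φ : Fin n → H) :
    Ψ (creators Z ψ * annihilators Z φ) = Ψ' (creators Z ψ * annihilators Z φ) := by
  induction m generalizing n with
  | zero => rw [creators_zero, one_mul, hΨ.map_annihilators hZ, hΨ'.map_annihilators hZ]
  | succ m ih =>
    rw [creators_succ, mul_assoc, hΨ.map_creation_mul, hΨ'.map_creation_mul, ih]
    congr 1
    cases n with
    | zero => simp [annihilators_zero, contract_creators hZ]
    | succ n => simp only [contract_monomial hZ, map_sum, map_smul, ih]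

/-- A quasi-free map is determined by its one-particle data. -/
lemma eq {Ψ Ψ' : SuperOp K} {S R : Op H} (hΨ : IsQuasiFree Z Ψ S R)
    (hΨ' : IsQuasiFree Z Ψ' S R) (hZ : IsCARField Z) (hirr : IsIrreducible Z) : Ψ = Ψ' := by
  ext1 X
  induction mem_monomialSpan hZ hirr X using Submodule.span_induction with
  | mem X hX =>
    obtain ⟨m, n, ψ, φ, rfl⟩ := hX
    exact hΨ.map_monomial_eq hΨ' hZ ψ φ
  | zero => simp
  | add X Y _ _ hX hY => rw [map_add, map_add, hX, hY]
  | smul c X _ hX => rw [map_smul, map_smul, hX]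

end IsQuasiFree

/-! ## Gauge invariant Gaussian functionals -/

variable (Z) in
/-- The exchange relation that characterizes the gauge invariant Gaussian functional
`X ↦ τ(X ρ)` with symbol `Q`. -/
def HasExchange (ρ : Op K) (Q : Op H) : Prop :=
  ∀ ψ X, tau (star (Z ψ) * X * ρ) = tau (contract Z (Q ψ) X * ρ)

lemma contract_field (hZ : IsCARField Z) (χ φ : H) : contract Z χ (Z φ) = ⟪φ, χ⟫_ℂ • 1 := by
  have := contract_mul_field hZ χ φ 1
  simpa [contract_one hZ, parity_mul_self hZ] using this

lemma HasExchange.isSymbol {ρ : Op K} {Q : Op H} (h : HasExchange Z ρ Q) (hZ : IsCARField Z)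
    (hρ : tau ρ = 1) : IsSymbol Z ρ Q := by
  intro φ ψ
  rw [h, contract_field hZ, smul_mul_assoc, one_mul, map_smul, hρ, smul_eq_mul, mul_one]

lemma tau_creators_mul {ρ : Op K} {Q : Op H} (h : HasExchange Z ρ Q) (hZ : IsCARField Z)
    {m : ℕ} (ψ : Fin (m + 1) → H) : tau (creators Z ψ * ρ) = 0 := by
  rw [creators_succ, h, contract_creators hZ]; simp

lemma tau_annihilators_mul {ρ : Op K} {Q : Op H} (h : HasExchange Z ρ Q) (hZ : IsCARField Z)
    (hρ : star ρ = ρ) {m : ℕ} (ψ : Fin (m + 1) → H) : tau (annihilators Z ψ * ρ) = 0 := by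
  have h1 := congrArg star (tau_creators_mul h hZ ψ)
  rwa [← tau_star, star_mul, hρ, star_creators, tau_mul_comm, star_zero] at h1

/-- One exchange removes the first creation operator together with one annihilation operator, which
is Laplace expansion along the first column. Unequal numbers of the two kinds lead to monomials of a
single kind, whose expectations vanish. -/
lemma HasExchange.moments {ρ : Op K} {Q : Op H} (h : HasExchange Z ρ Q) (hZ : IsCARField Z)
    (hρ : star ρ = ρ) (hρ1 : tau ρ = 1) {m : ℕ} :
    (∀ (n : ℕ) (ψ : Fin m → H) (φ : Fin n → H), m ≠ n →
      tau (creators Z ψ * annihilators Z φ * ρ) = 0) ∧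
    (∀ (ψ φ : Fin m → H), tau (creators Z ψ * annihilators Z φ * ρ) =
      (Matrix.of fun j k => ⟪φ j, Q (ψ k)⟫_ℂ).det) := by
  induction m with
  | zero =>
    refine ⟨fun n ψ φ hn => ?_, fun ψ φ => ?_⟩
    · obtain ⟨n, rfl⟩ := Nat.exists_eq_succ_of_ne_zero hn.symm
      rw [creators_zero, one_mul, tau_annihilators_mul h hZ hρ]
    · simp [creators_zero, annihilators_zero, hρ1]
  | succ m ih =>
    have key : ∀ (n : ℕ) (ψ : Fin (m + 1) → H) (φ : Fin (n + 1) → H),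
        tau (creators Z ψ * annihilators Z φ * ρ) =
          ∑ i : Fin (n + 1), ((-1 : ℂ) ^ (m + n + (i : ℕ)) * ⟪φ i, Q (ψ 0)⟫_ℂ) *
            tau (creators Z (fun k => ψ k.succ) * annihilators Z (fun k => φ (i.succAbove k)) * ρ) := by
      intro n ψ φ
      rw [creators_succ, mul_assoc (star _), h, contract_monomial hZ, Finset.sum_mul, map_sum]
      simp
    refine ⟨fun n ψ φ hn => ?_, fun ψ φ => ?_⟩
    · cases n with
      | zero => rw [annihilators_zero, mul_one, tau_creators_mul h hZ]
      | succ n =>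
        rw [key]
        refine Finset.sum_eq_zero fun i _ => ?_
        rw [ih.1 _ _ _ (by omega), mul_zero]
    · rw [key, Matrix.det_succ_column_zero]
      refine Finset.sum_congr rfl fun i _ => ?_
      rw [ih.2, pow_add, ← two_mul, pow_mul]
      simp [Matrix.submatrix]

lemma HasExchange.isGIG {ρ : Op K} {Q : Op H} (h : HasExchange Z ρ Q) (hZ : IsCARField Z)
    (hρ : IsDensity ρ) : IsGIG Z ρ := by
  have hs : star ρ = ρ := (IsSelfAdjoint.of_nonneg hρ.nonneg)
  exact ⟨hρ, Q, h.isSymbol hZ hρ.tau_eq_one,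
    fun m n ψ φ hmn => (h.moments hZ hs hρ.tau_eq_one).1 n ψ φ hmn,
    fun n ψ φ => (h.moments hZ hs hρ.tau_eq_one).2 ψ φ⟩

/-- Laplace expansion read backwards on each monomial; irreducibility extends the relation to every
operator by linearity. -/
lemma IsGIG.hasExchange {ρ : Op K} (h : IsGIG Z ρ) (hZ : IsCARField Z) (hirr : IsIrreducible Z) :
    ∃ Q, HasExchange Z ρ Q := by
  obtain ⟨Q, -, h1, h2⟩ := h.moments
  refine ⟨Q, fun ψ X => ?_⟩
  have h1' : ∀ (m n : ℕ) (ψ : Fin m → H) (φ : Fin n → H), m ≠ n →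
      tau (creators Z ψ * annihilators Z φ * ρ) = 0 := h1
  have h2' : ∀ (n : ℕ) (ψ φ : Fin n → H), tau (creators Z ψ * annihilators Z φ * ρ) =
      (Matrix.of fun j k => ⟪φ j, Q (ψ k)⟫_ℂ).det := h2
  induction mem_monomialSpan hZ hirr X using Submodule.span_induction with
  | mem X hX =>
    obtain ⟨m, n, ψ', φ, rfl⟩ := hX
    have hc := creators_succ (Z := Z) (Fin.cons ψ ψ' : Fin (m + 1) → H)
    simp only [Fin.cons_zero, Fin.cons_succ] at hc
    rw [← mul_assoc, ← hc]
    cases n with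
    | zero =>
      rw [annihilators_zero, mul_one, mul_one, contract_creators hZ]
      have := h1' (m + 1) 0 (Fin.cons ψ ψ') Fin.elim0 (by simp)
      rw [annihilators_zero, mul_one] at this
      rw [this]; simp
    | succ n =>
      rw [contract_monomial hZ, Finset.sum_mul, map_sum]
      by_cases hmn : m = n
      · subst hmn
        rw [h2', Matrix.det_succ_column_zero]
        refine Finset.sum_congr rfl fun i _ => ?_
        rw [smul_mul_assoc, map_smul, h2', pow_add, ← two_mul, pow_mul]
        simp [Matrix.submatrix]
      · rw [h1' _ _ _ _ (by omega)]
        refine (Finset.sum_eq_zero fun i _ => ?_).symm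
        rw [smul_mul_assoc, map_smul, h1' _ _ _ _ hmn, smul_zero]
  | zero => simp
  | add X Y _ _ hX hY => simp only [mul_add, add_mul, map_add, hX, hY]
  | smul c X _ hX => simp only [mul_smul_comm, smul_mul_assoc, map_smul, hX]

end Irreducible

/-! ### Relations of the Lindblad generator with contractions and creation operators. -/

section Lindblad

variable {H : Type*} [NormedAddCommGroup H] [InnerProductSpace ℂ H]
  [FiniteDimensional ℂ H] [CompleteSpace H]
variable {K : Type*} [NormedAddCommGroup K] [InnerProductSpace ℂ K] [CompleteSpace K]
variable {Z : H →ₗ⋆[ℂ] Op K}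

lemma lindbladTerm_apply (W B X : Op K) : lindbladTerm W B X =
    star B * W * X * (W * B) - (1 / 2 : ℂ) • (star B * B * X) - (1 / 2 : ℂ) • (X * (star B * B)) := by
  simp [lindbladTerm]

lemma lindbladTerm_one {W : Op K} (hW : W * W = 1) (B : Op K) : lindbladTerm W B 1 = 0 := by
  rw [lindbladTerm_apply, mul_one, mul_one, one_mul, mul_assoc, ← mul_assoc W, hW, one_mul,
    sub_sub, ← add_smul]
  norm_num

lemma lindbladTerm_star {W : Op K} (hW : star W = W) (B X : Op K) :
    lindbladTerm W B (star X) = star (lindbladTerm W B X) := by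
  simp only [lindbladTerm_apply, star_sub, star_mul, star_smul, star_star, hW, mul_assoc]
  have : star (1 / 2 : ℂ) = 1 / 2 := by simp
  rw [this, sub_right_comm]

/-- For an odd operator the Lindblad term is a sum of graded commutators. -/
lemma two_smul_lindbladTerm {W : Op K} (hW : W * W = 1) (B X : Op K) :
    (2 : ℂ) • lindbladTerm W B X =
      gradedComm W (star B) (W * X * W) * B - star B * gradedComm W B X := by
  rw [lindbladTerm_apply, gradedComm_apply, gradedComm_apply, grading_grading hW, smul_sub,
    smul_sub, smul_smul, smul_smul, two_smul]
  norm_num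
  noncomm_ring

lemma contract_grading (hZ : IsCARField Z) (χ : H) (X : Op K) :
    contract Z χ (parity Z * X * parity Z) = -(parity Z * contract Z χ X * parity Z) := by
  rw [contract_eq, grading_gradedComm (parity_mul_self hZ) (parity_mul_creation hZ χ), neg_neg]

lemma contract_contract (hZ : IsCARField Z) (χ φ : H) (X : Op K) :
    contract Z χ (contract Z φ X) = -contract Z φ (contract Z χ X) := by
  rw [contract_eq, contract_eq, gradedComm_gradedComm (parity_mul_self hZ)
    (parity_mul_creation hZ χ) (parity_mul_creation hZ φ), hZ.star_mul_star_eq_neg χ φ]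
  simp

lemma gradedComm_field_contract (hZ : IsCARField Z) (χ φ : H) (X : Op K) :
    gradedComm (parity Z) (Z φ) (contract Z χ X) =
      -contract Z χ (gradedComm (parity Z) (Z φ) X) := by
  rw [contract_eq, gradedComm_gradedComm (parity_mul_self hZ)
    (parity_mul hZ φ) (parity_mul_creation hZ χ), hZ.anticomm_star]
  simp

lemma gradedComm_field_creation_mul (hZ : IsCARField Z) (φ ψ : H) (X : Op K) :
    gradedComm (parity Z) (Z φ) (star (Z ψ) * X) =
      ⟪φ, ψ⟫_ℂ • X - star (Z ψ) * gradedComm (parity Z) (Z φ) X := by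
  rw [gradedComm_odd_mul (parity_mul_self hZ) (parity_mul_creation hZ ψ), hZ.anticomm_star]
  simp

lemma contract_field_mul (hZ : IsCARField Z) (χ φ : H) (X : Op K) :
    contract Z χ (Z φ * X) = ⟪φ, χ⟫_ℂ • X - Z φ * contract Z χ X := by
  rw [contract_eq, gradedComm_odd_mul (parity_mul_self hZ) (parity_mul hZ φ),
    add_comm (star (Z χ) * _), hZ.anticomm_star]
  simp

lemma contract_mul_creation (hZ : IsCARField Z) (χ φ : H) (X : Op K) :
    contract Z χ (X * star (Z φ)) = contract Z χ X * star (Z φ) := by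
  rw [contract_eq, gradedComm_mul_odd (parity_mul_self hZ) (parity_mul_creation hZ φ),
    hZ.star_mul_star_eq_neg χ φ]
  simp

lemma smul_two_injective {X Y : Op K} (h : (2 : ℂ) • X = (2 : ℂ) • Y) : X = Y :=
  smul_right_injective _ (two_ne_zero : (2 : ℂ) ≠ 0) h

/-- The graded commutators that make up the Lindblad term anticommute with the contraction. The only
defect arises where the contraction meets the explicit factor Z(φ). The term with Z*(φ) has the same
defect, so in the generator the weights 1 - λ and λ add up to 1. -/
lemma lindbladTerm_field_contract (hZ : IsCARField Z) (φ χ : H) (X : Op K) :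
    lindbladTerm (parity Z) (Z φ) (contract Z χ X) =
      contract Z χ (lindbladTerm (parity Z) (Z φ) X) + (⟪φ, χ⟫_ℂ / 2) • contract Z φ X := by
  apply smul_two_injective
  rw [smul_add, ← map_smul (contract Z χ), two_smul_lindbladTerm (parity_mul_self hZ),
    two_smul_lindbladTerm (parity_mul_self hZ), gradedComm_field_contract hZ, ← contract_eq,
    map_sub, contract_creation_mul hZ, contract_mul_field hZ, contract_contract hZ χ φ,
    smul_smul]
  have : 2 * (⟪φ, χ⟫_ℂ / 2) = ⟪φ, χ⟫_ℂ := by ring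
  rw [this]
  simp only [contract_grading hZ, mul_neg, neg_mul, map_neg, neg_neg,
    grading_grading (parity_mul_self hZ), smul_neg]
  noncomm_ring

lemma lindbladTerm_creation_contract (hZ : IsCARField Z) (φ χ : H) (X : Op K) :
    lindbladTerm (parity Z) (star (Z φ)) (contract Z χ X) =
      contract Z χ (lindbladTerm (parity Z) (star (Z φ)) X) + (⟪φ, χ⟫_ℂ / 2) • contract Z φ X := by
  apply smul_two_injective
  rw [smul_add, ← map_smul (contract Z χ), two_smul_lindbladTerm (parity_mul_self hZ),
    two_smul_lindbladTerm (parity_mul_self hZ), star_star, ← contract_eq,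
    map_sub, contract_mul_creation hZ, contract_field_mul hZ, contract_contract hZ χ φ, smul_smul,
    ← neg_eq_iff_eq_neg.mpr (contract_grading hZ χ X), map_neg, gradedComm_field_contract hZ]
  have : 2 * (⟪φ, χ⟫_ℂ / 2) = ⟪φ, χ⟫_ℂ := by ring
  rw [this]
  noncomm_ring

lemma grading_creation_mul (hZ : IsCARField Z) (ψ : H) (X : Op K) :
    parity Z * (star (Z ψ) * X) * parity Z = -(star (Z ψ) * (parity Z * X * parity Z)) := by
  rw [grading_mul (parity_mul_self hZ), grading_odd (parity_mul_self hZ) (parity_mul_creation hZ ψ),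
    neg_mul]

lemma lindbladTerm_field_creation_mul (hZ : IsCARField Z) (φ ψ : H) (X : Op K) :
    lindbladTerm (parity Z) (Z φ) (star (Z ψ) * X) =
      star (Z ψ) * lindbladTerm (parity Z) (Z φ) X - (⟪φ, ψ⟫_ℂ / 2) • (star (Z φ) * X) := by
  apply smul_two_injective
  rw [smul_sub, ← mul_smul_comm, two_smul_lindbladTerm (parity_mul_self hZ),
    two_smul_lindbladTerm (parity_mul_self hZ), ← contract_eq, grading_creation_mul hZ, map_neg,
    contract_creation_mul hZ, gradedComm_field_creation_mul hZ, mul_sub, mul_sub,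
    ← mul_assoc (star (Z φ)) (star (Z ψ)), hZ.star_mul_star_eq_neg φ ψ, smul_smul]
  have : 2 * (⟪φ, ψ⟫_ℂ / 2) = ⟪φ, ψ⟫_ℂ := by ring
  rw [this, mul_smul_comm]
  noncomm_ring

/-- Compared with `lindbladTerm_field_creation_mul`, there is an extra contraction. Since it carries
the weight λ, it is the only place where A enters the generator's relations. -/
lemma lindbladTerm_creation_creation_mul (hZ : IsCARField Z) (φ ψ : H) (X : Op K) :
    lindbladTerm (parity Z) (star (Z φ)) (star (Z ψ) * X) =
      star (Z ψ) * lindbladTerm (parity Z) (star (Z φ)) X - (⟪φ, ψ⟫_ℂ / 2) • (star (Z φ) * X) +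
        ⟪φ, ψ⟫_ℂ • contract Z φ X := by
  apply smul_two_injective
  have h2 : 2 * (⟪φ, ψ⟫_ℂ / 2) = ⟪φ, ψ⟫_ℂ := by ring
  have h3 : parity Z * X * parity Z * star (Z φ) = star (Z φ) * X - contract Z φ X := by
    rw [contract_eq, gradedComm_apply, sub_sub_cancel]
  rw [smul_add, smul_sub, ← mul_smul_comm, two_smul_lindbladTerm (parity_mul_self hZ),
    two_smul_lindbladTerm (parity_mul_self hZ), star_star, ← contract_eq, grading_creation_mul hZ,
    map_neg, gradedComm_field_creation_mul hZ, contract_creation_mul hZ, mul_neg,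
    ← mul_assoc (Z φ), hZ.mul_star_eq, neg_sub, sub_mul, smul_mul_assoc, h3, smul_smul, h2,
    smul_smul, sub_mul, smul_mul_assoc, one_mul, smul_sub, mul_comm (2 : ℂ), mul_smul, two_smul,
    smul_add]
  noncomm_ring

lemma parity_mul_hat (hZ : IsCARField Z) (X : Op H) : parity Z * hat Z X = hat Z X * parity Z := by
  unfold hat
  rw [Finset.mul_sum, Finset.sum_mul]
  refine Finset.sum_congr rfl fun j _ => ?_
  rw [← mul_assoc, parity_mul_creation hZ, neg_mul, mul_assoc, parity_mul hZ, mul_assoc]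
  simp

lemma commutator_hat_contract (hZ : IsCARField Z) (Y : Op H) (χ : H) (X : Op K) :
    hat Z Y * contract Z χ X - contract Z χ X * hat Z Y =
      contract Z χ (hat Z Y * X - X * hat Z Y) + contract Z (Y χ) X := by
  have h1 := hat_mul_creation hZ Y χ
  have h2 := parity_mul_hat hZ Y
  simp only [contract_eq, gradedComm_apply, mul_sub, sub_mul]
  rw [← mul_assoc (hat Z Y) (star (Z χ)), h1]
  have e1 : hat Z Y * (parity Z * X * parity Z * star (Z χ)) =
      parity Z * (hat Z Y * X) * parity Z * star (Z χ) := by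
    simp only [← mul_assoc, h2]
  have e2 : parity Z * X * parity Z * star (Z χ) * hat Z Y =
      parity Z * (X * hat Z Y) * parity Z * star (Z χ) -
        parity Z * X * parity Z * star (Z (Y χ)) := by
    rw [mul_assoc _ (star (Z χ)), eq_sub_of_add_eq h1.symm, mul_sub, ← mul_assoc _ (hat Z Y),
      mul_assoc _ (parity Z) (hat Z Y), h2]
    simp only [← mul_assoc]
  rw [e1, e2]
  noncomm_ring

lemma commutator_hat_creation_mul (hZ : IsCARField Z) (Y : Op H) (ψ : H) (X : Op K) :
    hat Z Y * (star (Z ψ) * X) - star (Z ψ) * X * hat Z Y =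
      star (Z ψ) * (hat Z Y * X - X * hat Z Y) + star (Z (Y ψ)) * X := by
  rw [← mul_assoc, hat_mul_creation hZ]
  noncomm_ring

lemma star_hamiltonian (G : Op H) : star (hamiltonian G) = hamiltonian G := by
  rw [hamiltonian, star_smul, star_sub, star_star, ← neg_sub G (star G), smul_neg, ← neg_smul]
  congr 1
  simp

lemma I_smul_hamiltonian (G : Op H) :
    Complex.I • hamiltonian G = (1 / 2 : ℂ) • (G - star G) := by
  rw [hamiltonian, smul_smul]
  congr 1
  field_simp

variable {G A : Op H} {η : OrthonormalBasis (Fin (Module.finrank ℂ H)) ℂ H}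
  {lam : Fin (Module.finrank ℂ H) → ℝ}

lemma lindbladGenerator_apply (X : Op K) : lindbladGenerator Z G η lam X =
    (∑ j, ((1 - lam j : ℝ) : ℂ) • lindbladTerm (parity Z) (Z (sqrtOp (-G - star G) (η j))) X)
    + (∑ j, (lam j : ℂ) • lindbladTerm (parity Z) (star (Z (sqrtOp (-G - star G) (η j)))) X)
    - Complex.I • (hat Z (hamiltonian G) * X - X * hat Z (hamiltonian G)) := by
  simp [lindbladGenerator, sum_apply]

lemma lindbladGenerator_one (hZ : IsCARField Z) : lindbladGenerator Z G η lam 1 = 0 := by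
  rw [lindbladGenerator_apply]
  simp [lindbladTerm_one (parity_mul_self hZ)]

lemma lindbladGenerator_star (hZ : IsCARField Z) (X : Op K) :
    lindbladGenerator Z G η lam (star X) = star (lindbladGenerator Z G η lam X) := by
  simp only [lindbladGenerator_apply, star_sub, star_add, star_sum, star_smul,
    lindbladTerm_star (star_parity hZ), star_mul, star_hat, star_hamiltonian, Complex.star_def,
    Complex.conj_ofReal, Complex.conj_I]
  rw [neg_smul, ← smul_neg, neg_sub]

/-- The dissipative terms contribute Hχ and the Hamiltonian term -iKχ. Their sum is -Gχ because G =
-H + iK. -/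
lemma lindbladGenerator_contract (hZ : IsCARField Z)
    (hG : ∀ χ, ∑ j, ⟪sqrtOp (-G - star G) (η j), χ⟫_ℂ • sqrtOp (-G - star G) (η j) =
      (-G - star G) χ) (χ : H) (X : Op K) :
    lindbladGenerator Z G η lam (contract Z χ X) =
      contract Z χ (lindbladGenerator Z G η lam X) - contract Z (G χ) X := by
  have hK : Complex.I • contract Z (hamiltonian G χ) X =
      (1 / 2 : ℂ) • (contract Z (G χ) X - contract Z (star G χ) X) := by
    have h := congrArg (fun Y : Op H => contract Z (Y χ) X) (I_smul_hamiltonian G)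
    simpa using h
  have hS : ∑ j, ⟪sqrtOp (-G - star G) (η j), χ⟫_ℂ •
      contract Z (sqrtOp (-G - star G) (η j)) X = -contract Z (G χ) X - contract Z (star G χ) X := by
    have h := congrArg (fun ξ : H => contract Z ξ X) (hG χ)
    simpa [sum_apply] using h
  simp only [lindbladGenerator_apply, lindbladTerm_field_contract hZ,
    lindbladTerm_creation_contract hZ, commutator_hat_contract hZ, smul_add,
    Finset.sum_add_distrib, map_sub, map_add, map_sum, map_smul, hK]
  have e : (∑ j, ((1 - lam j : ℝ) : ℂ) • (⟪sqrtOp (-G - star G) (η j), χ⟫_ℂ / 2) •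
        contract Z (sqrtOp (-G - star G) (η j)) X) +
      (∑ j, (lam j : ℂ) • (⟪sqrtOp (-G - star G) (η j), χ⟫_ℂ / 2) •
        contract Z (sqrtOp (-G - star G) (η j)) X) =
      (1 / 2 : ℂ) • (-contract Z (G χ) X - contract Z (star G χ) X) := by
    rw [← hS, Finset.smul_sum, ← Finset.sum_add_distrib]
    refine Finset.sum_congr rfl fun j _ => ?_
    rw [smul_smul, smul_smul, smul_smul, ← add_smul]
    congr 1
    push_cast
    ring
  have e' := eq_sub_of_add_eq e
  rw [e']
  module

/-- Here the half-weights give -Hψ, which with the Hamiltonian term -iKψ makes G*ψ. The extra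
contractions, weighted by λ, resum to A. -/
lemma lindbladGenerator_creation_mul (hZ : IsCARField Z)
    (hG : ∀ χ, ∑ j, ⟪sqrtOp (-G - star G) (η j), χ⟫_ℂ • sqrtOp (-G - star G) (η j) =
      (-G - star G) χ)
    (hA : ∀ χ, ∑ j, ((lam j : ℂ) * ⟪sqrtOp (-G - star G) (η j), χ⟫_ℂ) •
      sqrtOp (-G - star G) (η j) = A χ) (ψ : H) (X : Op K) :
    lindbladGenerator Z G η lam (star (Z ψ) * X) =
      star (Z ψ) * lindbladGenerator Z G η lam X + star (Z (star G ψ)) * X +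
        contract Z (A ψ) X := by
  have hK : Complex.I • (star (Z (hamiltonian G ψ)) * X) =
      (1 / 2 : ℂ) • (star (Z (G ψ)) * X - star (Z (star G ψ)) * X) := by
    have h := congrArg (fun Y : Op H => creation Z (Y ψ) * X) (I_smul_hamiltonian G)
    simpa [sub_mul] using h
  have hS : ∑ j, ⟪sqrtOp (-G - star G) (η j), ψ⟫_ℂ •
      (star (Z (sqrtOp (-G - star G) (η j))) * X) =
        -(star (Z (G ψ)) * X) - star (Z (star G ψ)) * X := by
    have h := congrArg (fun ξ : H => creation Z ξ * X) (hG ψ)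
    rw [map_sum, Finset.sum_mul] at h
    simpa [sub_mul, LinearMap.map_smulₛₗ] using h
  have hS' : ∑ j, ((lam j : ℂ) * ⟪sqrtOp (-G - star G) (η j), ψ⟫_ℂ) •
      contract Z (sqrtOp (-G - star G) (η j)) X = contract Z (A ψ) X := by
    have h := congrArg (fun ξ : H => contract Z ξ X) (hA ψ)
    simpa [sum_apply] using h
  simp only [lindbladGenerator_apply, lindbladTerm_field_creation_mul hZ,
    lindbladTerm_creation_creation_mul hZ, commutator_hat_creation_mul hZ, smul_add, smul_sub,
    Finset.sum_add_distrib, Finset.sum_sub_distrib, mul_sub, mul_add, Finset.mul_sum, hK, ← hS',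
    mul_smul_comm]
  have e : (∑ j, ((1 - lam j : ℝ) : ℂ) • (⟪sqrtOp (-G - star G) (η j), ψ⟫_ℂ / 2) •
        (star (Z (sqrtOp (-G - star G) (η j))) * X)) +
      (∑ j, (lam j : ℂ) • (⟪sqrtOp (-G - star G) (η j), ψ⟫_ℂ / 2) •
        (star (Z (sqrtOp (-G - star G) (η j))) * X)) =
      (1 / 2 : ℂ) • (-(star (Z (G ψ)) * X) - star (Z (star G ψ)) * X) := by
    rw [← hS, Finset.smul_sum, ← Finset.sum_add_distrib]
    refine Finset.sum_congr rfl fun j _ => ?_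
    rw [smul_smul, smul_smul, smul_smul, ← add_smul]
    congr 1
    push_cast
    ring
  have e' := eq_sub_of_add_eq e
  rw [e']
  simp only [mul_smul]
  module

end Lindblad

/-! ### Derivatives of one-parameter exponentials. -/

section ExpCurve

variable {𝔸 : Type*} [NormedRing 𝔸] [NormedAlgebra ℂ 𝔸] [CompleteSpace 𝔸]

lemma hasDerivAt_exp_ofReal_smul (X : 𝔸) (t : ℝ) :
    HasDerivAt (fun s : ℝ => NormedSpace.exp ((s : ℂ) • X))
      (X * NormedSpace.exp ((t : ℂ) • X)) t := by
  have h := hasDerivAt_exp_smul_const' (𝕂 := ℂ) X (t : ℂ)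
  exact (h.scomp t (Complex.ofRealCLM.hasDerivAt (x := t))).congr_deriv (by simp)

lemma hasDerivAt_exp_ofReal_smul' (X : 𝔸) (t : ℝ) :
    HasDerivAt (fun s : ℝ => NormedSpace.exp ((s : ℂ) • X))
      (NormedSpace.exp ((t : ℂ) • X) * X) t := by
  have h := hasDerivAt_exp_smul_const (𝕂 := ℂ) X (t : ℂ)
  exact (h.scomp t (Complex.ofRealCLM.hasDerivAt (x := t))).congr_deriv (by simp)

lemma continuous_exp_ofReal_smul (X : 𝔸) :
    Continuous (fun s : ℝ => NormedSpace.exp ((s : ℂ) • X)) :=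
  continuous_iff_continuousAt.mpr fun t => (hasDerivAt_exp_ofReal_smul X t).continuousAt

lemma exp_ofReal_add_smul (X : 𝔸) (s t : ℝ) : NormedSpace.exp (((s + t : ℝ) : ℂ) • X) =
    NormedSpace.exp ((s : ℂ) • X) * NormedSpace.exp ((t : ℂ) • X) := by
  rw [Complex.ofReal_add, add_smul]
  exact exp_add_commute (((Commute.refl X).smul_left _).smul_right _)

lemma exp_ofReal_zero_smul (X : 𝔸) : NormedSpace.exp (((0 : ℝ) : ℂ) • X) = 1 := by
  simp

lemma exp_ofReal_smul_mul_neg (X : 𝔸) (t : ℝ) :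
    NormedSpace.exp ((t : ℂ) • X) * NormedSpace.exp (((-t : ℝ) : ℂ) • X) = 1 := by
  rw [← exp_ofReal_add_smul, add_neg_cancel, exp_ofReal_zero_smul]

lemma exp_ofReal_neg_smul_mul (X : 𝔸) (t : ℝ) :
    NormedSpace.exp (((-t : ℝ) : ℂ) • X) * NormedSpace.exp ((t : ℂ) • X) = 1 := by
  rw [← exp_ofReal_add_smul, neg_add_cancel, exp_ofReal_zero_smul]

lemma hasDerivAt_exp_ofReal_neg_smul (X : 𝔸) (t : ℝ) :
    HasDerivAt (fun s : ℝ => NormedSpace.exp (((-s : ℝ) : ℂ) • X))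
      (-(NormedSpace.exp (((-t : ℝ) : ℂ) • X) * X)) t := by
  exact ((hasDerivAt_exp_ofReal_smul' X (-t)).scomp t (hasDerivAt_neg t)).congr_deriv (by simp)

lemma eq_zero_of_hasDerivAt_zero {E : Type*} [NormedAddCommGroup E] [NormedSpace ℝ E] {f : ℝ → E}
    (h : ∀ t, HasDerivAt f 0 t) (t : ℝ) : f t = f 0 :=
  is_const_of_deriv_eq_zero (fun t => (h t).differentiableAt) (fun t => (h t).deriv) t 0

end ExpCurve

/-! ### The integral R_t and integration of the generator relations. -/

section OneParticle

variable {H : Type*} [NormedAddCommGroup H] [InnerProductSpace ℂ H] [CompleteSpace H]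

lemma star_exp_ofReal_smul (G : Op H) (t : ℝ) :
    star (NormedSpace.exp ((t : ℂ) • G)) = NormedSpace.exp ((t : ℂ) • star G) := by
  rw [NormedSpace.star_exp, star_smul, Complex.star_def, Complex.conj_ofReal]

lemma continuous_integrand (G A : Op H) : Continuous fun s : ℝ =>
    NormedSpace.exp ((s : ℂ) • G) * A * NormedSpace.exp ((s : ℂ) • star G) :=
  ((continuous_exp_ofReal_smul G).mul continuous_const).mul (continuous_exp_ofReal_smul _)

lemma integralR_zero (G A : Op H) : integralR G A 0 = 0 := by simp [integralR]

lemma hasDerivAt_integralR (G A : Op H) (t : ℝ) : HasDerivAt (integralR G A)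
    (NormedSpace.exp ((t : ℂ) • G) * A * NormedSpace.exp ((t : ℂ) • star G)) t :=
  intervalIntegral.integral_hasDerivAt_right
    ((continuous_integrand G A).intervalIntegrable _ _)
    ((continuous_integrand G A).stronglyMeasurableAtFilter _ _)
    (continuous_integrand G A).continuousAt

lemma hasDerivAt_linearMap_comp {E F : Type*} [NormedAddCommGroup E] [NormedSpace ℂ E]
    [FiniteDimensional ℂ E] [NormedAddCommGroup F] [NormedSpace ℂ F] (D : E →ₗ[ℂ] F)
    {f : ℝ → E} {f' : E} {t : ℝ} (h : HasDerivAt f f' t) :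
    HasDerivAt (fun s => D (f s)) (D f') t :=
  ((LinearMap.toContinuousLinearMap D).restrictScalars ℝ).hasFDerivAt.comp_hasDerivAt t h

lemma hasDerivAt_apply {E F : Type*} [NormedAddCommGroup E] [NormedSpace ℂ E]
    [NormedAddCommGroup F] [NormedSpace ℂ F] {f : ℝ → E →L[ℂ] F} {f' : E →L[ℂ] F} {t : ℝ}
    (h : HasDerivAt f f' t) (x : E) : HasDerivAt (fun s => f s x) (f' x) t :=
  ((ContinuousLinearMap.apply ℂ F x).restrictScalars ℝ).hasFDerivAt.comp_hasDerivAt t h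

variable {𝔸 : Type*} [NormedRing 𝔸] [NormedAlgebra ℂ 𝔸] [CompleteSpace 𝔸] [FiniteDimensional ℂ H]
  {G A : Op H} {L : 𝔸} {D M : H →ₗ[ℂ] 𝔸}

lemma mul_exp_neg_comm (L : 𝔸) (s : ℝ) : NormedSpace.exp (((-s : ℝ) : ℂ) • L) * L =
    L * NormedSpace.exp (((-s : ℝ) : ℂ) • L) :=
  (((Commute.refl L).smul_left _).exp_left).eq

/-- The curve e^{sL} D(e^{sG}χ) e^{-sL} has derivative zero: the shift by G cancels the commutator
of L with D. -/
lemma antiderivation_mul_exp (hLD : ∀ χ, L * D χ = D χ * L - D (G χ))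
    (χ : H) (t : ℝ) : D χ * NormedSpace.exp ((t : ℂ) • L) =
      NormedSpace.exp ((t : ℂ) • L) * D (NormedSpace.exp ((t : ℂ) • G) χ) := by
  have hd : ∀ s : ℝ, HasDerivAt (fun s : ℝ => NormedSpace.exp ((s : ℂ) • L) *
      D (NormedSpace.exp ((s : ℂ) • G) χ) * NormedSpace.exp (((-s : ℝ) : ℂ) • L)) 0 s := by
    intro s
    have h1 := hasDerivAt_linearMap_comp D
      (hasDerivAt_apply (hasDerivAt_exp_ofReal_smul G s) χ)
    refine (((hasDerivAt_exp_ofReal_smul' L s).fun_mul h1).fun_mul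
      (hasDerivAt_exp_ofReal_neg_smul L s)).congr_deriv ?_
    have h2 := mul_exp_neg_comm L s
    have h3 := hLD (NormedSpace.exp ((s : ℂ) • G) χ)
    rw [h2, mul_apply_eq_comp, mul_assoc _ L, h3]
    noncomm_ring
  have h := eq_zero_of_hasDerivAt_zero hd t
  simp only [neg_zero, exp_ofReal_zero_smul, one_mul, mul_one, one_apply_eq_self] at h
  rw [← h, mul_assoc, exp_ofReal_neg_smul_mul, mul_one]

/-- Variation of constants: e^{-sL} M(e^{sG*}ψ) e^{sL} + D(R_s ψ) is constant. Conjugating the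
inhomogeneous term D(A e^{sG*}ψ) by `antiderivation_mul_exp` produces e^{sG} on its left, which is
the integrand of R_s. -/
lemma exp_mul_creation_family (hLD : ∀ χ, L * D χ = D χ * L - D (G χ))
    (hLM : ∀ ψ, L * M ψ =
      M ψ * L + M (star G ψ) + D (A ψ)) (ψ : H) (t : ℝ) :
    NormedSpace.exp ((t : ℂ) • L) * M ψ =
      M (NormedSpace.exp ((t : ℂ) • star G) ψ) * NormedSpace.exp ((t : ℂ) • L) +
        NormedSpace.exp ((t : ℂ) • L) * D (integralR G A t ψ) := by
  have hd : ∀ s : ℝ, HasDerivAt (fun s : ℝ => NormedSpace.exp (((-s : ℝ) : ℂ) • L) *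
      M (NormedSpace.exp ((s : ℂ) • star G) ψ) * NormedSpace.exp ((s : ℂ) • L) +
        D (integralR G A s ψ)) 0 s := by
    intro s
    have h1 := hasDerivAt_linearMap_comp M
      (hasDerivAt_apply (hasDerivAt_exp_ofReal_smul (star G) s) ψ)
    have h2 := hasDerivAt_linearMap_comp D
      (hasDerivAt_apply (hasDerivAt_integralR G A s) ψ)
    refine ((((hasDerivAt_exp_ofReal_neg_smul L s).fun_mul h1).fun_mul
      (hasDerivAt_exp_ofReal_smul L s)).fun_add h2).congr_deriv ?_
    have h3 := hLM (NormedSpace.exp ((s : ℂ) • star G) ψ)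
    have h4 := antiderivation_mul_exp hLD (A (NormedSpace.exp ((s : ℂ) • star G) ψ)) s
    have h5 := exp_ofReal_neg_smul_mul L s
    simp only [mul_apply_eq_comp]
    have h6 : D (NormedSpace.exp ((s : ℂ) • G) (A (NormedSpace.exp ((s : ℂ) • star G) ψ))) =
        NormedSpace.exp (((-s : ℝ) : ℂ) • L) * (D (A (NormedSpace.exp ((s : ℂ) • star G) ψ))
          * NormedSpace.exp ((s : ℂ) • L)) := by
      rw [h4, ← mul_assoc, h5, one_mul]
    rw [h6, neg_mul, mul_assoc _ L, h3]
    noncomm_ring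
  have h := eq_zero_of_hasDerivAt_zero hd t
  simp only [neg_zero, exp_ofReal_zero_smul, one_mul, mul_one, one_apply_eq_self,
    integralR_zero, zero_apply, map_zero, add_zero] at h
  rw [← h, mul_add, ← mul_assoc, ← mul_assoc, exp_ofReal_smul_mul_neg, one_mul]

end OneParticle

/-! ### Exponentials as quasi-free maps and transport of the exchange relation. -/

section Semigroup

variable {H : Type*} [NormedAddCommGroup H] [InnerProductSpace ℂ H]
  [FiniteDimensional ℂ H] [CompleteSpace H]
variable {K : Type*} [NormedAddCommGroup K] [InnerProductSpace ℂ K] [CompleteSpace K]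
  [FiniteDimensional ℂ K]
variable {Z : H →ₗ⋆[ℂ] Op K}

variable (Z) in
/-- Left multiplication with creation operators. -/
def creationLeft : H →ₗ[ℂ] SuperOp K :=
  (ContinuousLinearMap.mul ℂ (Op K)).toLinearMap ∘ₗ creation Z

variable {G A : Op H} {L : SuperOp K}

/-- The set of `*`-preserving super-operators is closed under exponentials. -/
lemma exp_map_star (hL : ∀ X, L (star X) = star (L X)) (t : ℝ) (X : Op K) :
    NormedSpace.exp ((t : ℂ) • L) (star X) = star (NormedSpace.exp ((t : ℂ) • L) X) := by
  -- The curve e^{-sL}((e^{sL}X)*) is constant. The product rule is taken over ℝ, because the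
  -- parameter is real.
  have hd : ∀ s : ℝ, HasDerivAt (fun s : ℝ => NormedSpace.exp (((-s : ℝ) : ℂ) • L)
      (star (NormedSpace.exp ((s : ℂ) • L) X))) 0 s := by
    intro s
    have h1 := (hasDerivAt_apply (hasDerivAt_exp_ofReal_smul L s) X).star
    have h2 := hasDerivAt_exp_ofReal_neg_smul L s
    have h3 : HasDerivAt (fun s : ℝ => (NormedSpace.exp (((-s : ℝ) : ℂ) • L)).restrictScalars ℝ)
        ((-(NormedSpace.exp (((-s : ℝ) : ℂ) • L) * L)).restrictScalars ℝ) s :=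
      (ContinuousLinearMap.restrictScalarsL ℂ (Op K) (Op K) ℝ ℝ).hasFDerivAt.comp_hasDerivAt s h2
    refine (h3.clm_apply h1).congr_deriv ?_
    simp [mul_apply_eq_comp, hL]
  have h := eq_zero_of_hasDerivAt_zero hd t
  have h0 : NormedSpace.exp (((0 : ℝ) : ℂ) • L) = 1 := exp_ofReal_zero_smul L
  have h1 : NormedSpace.exp ((t : ℂ) • L) * NormedSpace.exp (((-t : ℝ) : ℂ) • L) = 1 :=
    exp_ofReal_smul_mul_neg L t
  rw [neg_zero, h0, one_apply_eq_self, one_apply_eq_self] at h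
  rw [← h, ← mul_apply_eq_comp, h1, one_apply_eq_self]

lemma exp_apply_one (hL : L 1 = 0) (t : ℝ) : NormedSpace.exp ((t : ℂ) • L) 1 = 1 := by
  have hd : ∀ s : ℝ, HasDerivAt (fun s : ℝ => NormedSpace.exp ((s : ℂ) • L) 1) 0 s := by
    intro s
    refine (hasDerivAt_apply (hasDerivAt_exp_ofReal_smul' L s) 1).congr_deriv ?_
    rw [mul_apply_eq_comp, hL, map_zero]
  have h := eq_zero_of_hasDerivAt_zero hd t
  have h0 : NormedSpace.exp (((0 : ℝ) : ℂ) • L) = 1 := exp_ofReal_zero_smul L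
  rwa [h0, one_apply_eq_self] at h

lemma isQuasiFree_exp (hL1 : L 1 = 0) (hLs : ∀ X, L (star X) = star (L X))
    (hLD : ∀ χ X, L (contract Z χ X) = contract Z χ (L X) - contract Z (G χ) X)
    (hLM : ∀ ψ X, L (star (Z ψ) * X) =
      star (Z ψ) * L X + star (Z (star G ψ)) * X + contract Z (A ψ) X) (t : ℝ) :
    IsQuasiFree Z (NormedSpace.exp ((t : ℂ) • L)) (NormedSpace.exp ((t : ℂ) • G))
      (integralR G A t) := by
  refine ⟨exp_apply_one hL1 t, exp_map_star hLs t, fun ψ X => ?_⟩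
  have h := exp_mul_creation_family (M := creationLeft Z) (D := contract Z) (L := L) (G := G) (A := A)
    (fun χ => ContinuousLinearMap.ext fun X => hLD χ X)
    (fun ψ => ContinuousLinearMap.ext fun X => hLM ψ X) ψ t
  rw [star_exp_ofReal_smul]
  exact congrArg (fun Φ : SuperOp K => Φ X) h

/-- The exchange relation is transported by quasi-free maps. -/
lemma HasExchange.map {Ψ : SuperOp K} {S R : Op H} (hΨ : IsQuasiFree Z Ψ S R)
    (hS : ∀ χ X, contract Z χ (Ψ X) = Ψ (contract Z (S χ) X)) {ρ : Op K} {Q : Op H}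
    (h : HasExchange Z ρ Q) : HasExchange Z (dagger Ψ ρ) (R + S * Q * star S) := by
  have hd : ∀ X, tau (X * dagger Ψ ρ) = tau (Ψ X * ρ) := by
    intro X
    have := tau_star_mul_traceAdjoint Ψ.toLinearMap ρ (star X)
    rw [star_star] at this
    rw [show dagger Ψ ρ = traceAdjoint Ψ.toLinearMap ρ from rfl, this]
    change tau (star (Ψ (star X)) * ρ) = _
    rw [hΨ.map_star, star_star]
  intro ψ X
  -- Exchange turns Z*(S*ψ) into a contraction with QS*ψ outside Ψ. Pulled inside, it becomes a
  -- contraction with SQS*ψ, which joins the one with Rψ.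
  rw [hd, hd, hΨ.map_creation_mul, add_mul, map_add, h, hS, ← map_add, ← add_mul, ← map_add,
    add_comm]
  simp

end Semigroup

/-! ### Square roots, support projections and the limit defining T. -/

section Calculus

variable {H : Type*} [NormedAddCommGroup H] [InnerProductSpace ℂ H] [CompleteSpace H]
  [FiniteDimensional ℂ H]

lemma finite_spectrum (B : Op H) : (spectrum ℝ B).Finite := by
  rw [← spectrum.preimage_algebraMap ℂ]
  refine Set.Finite.preimage (FaithfulSMul.algebraMap_injective ℝ ℂ).injOn ?_
  have h : spectrum ℂ (Module.End.toContinuousLinearMap H (B : H →ₗ[ℂ] H)) =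
      spectrum ℂ (B : H →ₗ[ℂ] H) := AlgEquiv.spectrum_eq _ _
  exact h ▸ Module.End.finite_spectrum (B : H →ₗ[ℂ] H)

/-- In finite dimension the spectrum is finite, so the calculus also admits discontinuous functions,
in particular the inverse square root with value 0 at 0. -/
lemma continuousOn_spectrum (B : Op H) (f : ℝ → ℝ) : ContinuousOn f (spectrum ℝ B) :=
  (finite_spectrum B).continuousOn f

lemma spectrum_nonneg' {B : Op H} (hB : 0 ≤ B) {x : ℝ} (hx : x ∈ spectrum ℝ B) : 0 ≤ x :=
  spectrum_nonneg_of_nonneg hB hx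

lemma star_sqrtOp (B : Op H) : star (sqrtOp B) = sqrtOp B := by
  have h : IsSelfAdjoint (sqrtOp B) := cfc_predicate (p := IsSelfAdjoint) Real.sqrt B
  exact h.star_eq

lemma star_invSqrtOp (B : Op H) : star (invSqrtOp B) = invSqrtOp B := by
  have h : IsSelfAdjoint (invSqrtOp B) :=
    cfc_predicate (p := IsSelfAdjoint) (fun x : ℝ => (Real.sqrt x)⁻¹) B
  exact h.star_eq

lemma sqrtOp_mul_self {B : Op H} (hB : 0 ≤ B) : sqrtOp B * sqrtOp B = B := by
  rw [sqrtOp, ← cfc_mul _ _ B (continuousOn_spectrum B _) (continuousOn_spectrum B _)]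
  conv_rhs => rw [← cfc_id ℝ B (IsSelfAdjoint.of_nonneg hB)]
  exact cfc_congr fun x hx => Real.mul_self_sqrt (spectrum_nonneg' hB hx)

/-- The support projection of a positive operator. -/
def support (B : Op H) : Op H := sqrtOp B * invSqrtOp B

lemma support_eq_cfc (B : Op H) :
    support B = cfc (fun x : ℝ => Real.sqrt x * (Real.sqrt x)⁻¹) B :=
  (cfc_mul _ _ B (continuousOn_spectrum B _) (continuousOn_spectrum B _)).symm

lemma support_eq' (B : Op H) : support B = invSqrtOp B * sqrtOp B := by
  rw [support, sqrtOp, invSqrtOp, ← cfc_mul _ _ B (continuousOn_spectrum B _)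
    (continuousOn_spectrum B _), ← cfc_mul _ _ B (continuousOn_spectrum B _)
    (continuousOn_spectrum B _)]
  exact cfc_congr fun x _ => mul_comm _ _

lemma star_support (B : Op H) : star (support B) = support B := by
  rw [support, star_mul, star_sqrtOp, star_invSqrtOp, ← support_eq', support]

lemma support_mul_self (B : Op H) : support B * support B = support B := by
  rw [support_eq_cfc, ← cfc_mul _ _ B (continuousOn_spectrum B _) (continuousOn_spectrum B _)]
  refine cfc_congr fun x _ => ?_
  by_cases h : Real.sqrt x = 0 <;> simp [h]

lemma mul_support {B : Op H} (hB : 0 ≤ B) : B * support B = B := by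
  rw [support_eq_cfc]
  conv_lhs => enter [1]; rw [← cfc_id ℝ B (IsSelfAdjoint.of_nonneg hB)]
  conv_rhs => rw [← cfc_id ℝ B (IsSelfAdjoint.of_nonneg hB)]
  rw [← cfc_mul _ _ B (continuousOn_spectrum B _) (continuousOn_spectrum B _)]
  refine cfc_congr fun x hx => ?_
  have hx' := spectrum_nonneg' hB hx
  rcases hx'.eq_or_lt with rfl | h
  · simp
  · simp [(Real.sqrt_pos.mpr h).ne']

lemma support_le_one (B : Op H) : support B ≤ 1 := by
  have h : (1 : Op H) - support B = star (1 - support B) * (1 - support B) := by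
    rw [star_sub, star_one, star_support, sub_mul, mul_sub, mul_sub, support_mul_self]; simp
  rw [← sub_nonneg, h]
  exact star_mul_self_nonneg _

/-- Compressing 0 ≤ A ≤ B to the kernel of B gives 0. Hence the square root of A vanishes there, and
so does A. -/
lemma mul_support_of_le {A B : Op H} (hA : 0 ≤ A) (hAB : A ≤ B) : A * support B = A := by
  have hB : 0 ≤ B := hA.trans hAB
  have h1 : star (1 - support B) * A * (1 - support B) = 0 := by
    refine le_antisymm ?_ (star_left_conjugate_nonneg hA _)
    refine (star_left_conjugate_le_conjugate hAB _).trans_eq ?_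
    rw [mul_assoc, mul_sub, mul_one, mul_support hB, sub_self, mul_zero]
  have h2 : sqrtOp A * (1 - support B) = 0 := by
    rw [← CStarRing.star_mul_self_eq_zero_iff, star_mul, star_sqrtOp, mul_assoc,
      ← mul_assoc (sqrtOp A), sqrtOp_mul_self hA, ← mul_assoc, h1]
  have h3 : A * (1 - support B) = 0 := by
    conv_lhs => rw [← sqrtOp_mul_self hA]
    rw [mul_assoc, h2, mul_zero]
  rw [mul_sub, mul_one, sub_eq_zero] at h3
  exact h3.symm

lemma support_mul_of_le {A B : Op H} (hA : 0 ≤ A) (hAB : A ≤ B) : support B * A = A := by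
  have h := congrArg star (mul_support_of_le hA hAB)
  rwa [star_mul, star_support, (IsSelfAdjoint.of_nonneg hA).star_eq] at h

lemma sqrtOp_mul_compress_mul_sqrtOp {A B : Op H} (hA : 0 ≤ A) (hAB : A ≤ B) :
    sqrtOp B * (invSqrtOp B * A * invSqrtOp B) * sqrtOp B = A := by
  have : sqrtOp B * (invSqrtOp B * A * invSqrtOp B) * sqrtOp B =
      (sqrtOp B * invSqrtOp B) * A * (invSqrtOp B * sqrtOp B) := by noncomm_ring
  rw [this, ← support_eq', ← support, support_mul_of_le hA hAB, mul_support_of_le hA hAB]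

lemma compress_nonneg {A : Op H} (hA : 0 ≤ A) (B : Op H) :
    0 ≤ invSqrtOp B * A * invSqrtOp B := by
  have := star_left_conjugate_nonneg hA (invSqrtOp B)
  rwa [star_invSqrtOp] at this

lemma compress_le_one {A B : Op H} (hA : 0 ≤ A) (hAB : A ≤ B) :
    invSqrtOp B * A * invSqrtOp B ≤ 1 := by
  have h := star_left_conjugate_le_conjugate hAB (invSqrtOp B)
  rw [star_invSqrtOp] at h
  refine h.trans ?_
  have h2 : invSqrtOp B * B * invSqrtOp B = support B * support B := by
    conv_lhs => enter [1, 2]; rw [← sqrtOp_mul_self (hA.trans hAB)]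
    conv_rhs => enter [1]; rw [support_eq']
    simp only [support, mul_assoc]
  rw [h2, support_mul_self]
  exact support_le_one B

lemma invSqrtOp_add_smul_one {B : Op H} (hB : 0 ≤ B) (ε : ℝ) :
    invSqrtOp (B + (ε : ℂ) • 1) = cfc (fun x : ℝ => (Real.sqrt (x + ε))⁻¹) B := by
  have h : B + (ε : ℂ) • 1 = cfc (fun x : ℝ => x + ε) B := by
    rw [cfc_add_const ε _ B (continuousOn_spectrum B _) (IsSelfAdjoint.of_nonneg hB),
      cfc_id' ℝ B (IsSelfAdjoint.of_nonneg hB)]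
    congr 1
  rw [invSqrtOp, h, ← cfc_comp' (fun x : ℝ => (Real.sqrt x)⁻¹) (fun x : ℝ => x + ε) B
    (((finite_spectrum B).image _).continuousOn _) (continuousOn_spectrum B _)
    (IsSelfAdjoint.of_nonneg hB)]

/-- Only finitely many spectral values matter, so pointwise convergence suffices. At the value 0 the
diverging factor is killed by the support projection. -/
lemma tendsto_invSqrtOp_mul_support {B : Op H} (hB : 0 ≤ B) :
    Filter.Tendsto (fun ε : ℝ => invSqrtOp (B + (ε : ℂ) • 1) * support B) (𝓝[>] 0)
      (𝓝 (invSqrtOp B)) := by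
  have h1 : ∀ ε : ℝ, invSqrtOp (B + (ε : ℂ) • 1) * support B =
      cfc (fun x : ℝ => (Real.sqrt (x + ε))⁻¹ * (Real.sqrt x * (Real.sqrt x)⁻¹)) B := by
    intro ε
    rw [invSqrtOp_add_smul_one hB, support_eq_cfc,
      ← cfc_mul _ _ B (continuousOn_spectrum B _) (continuousOn_spectrum B _)]
  simp_rw [h1]
  refine tendsto_cfc_fun ?_ (Filter.Eventually.of_forall fun ε => continuousOn_spectrum B _)
  rw [Metric.tendstoUniformlyOn_iff]
  intro δ hδ
  rw [(finite_spectrum B).eventually_all]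
  intro x hx
  have hx' := spectrum_nonneg' hB hx
  have ht : Filter.Tendsto
      (fun ε : ℝ => (Real.sqrt (x + ε))⁻¹ * (Real.sqrt x * (Real.sqrt x)⁻¹)) (𝓝[>] 0)
      (𝓝 (Real.sqrt x)⁻¹) := by
    rcases hx'.eq_or_lt with rfl | h
    · simp
    · have h0 : Real.sqrt x ≠ 0 := (Real.sqrt_pos.mpr h).ne'
      simp only [mul_inv_cancel₀ h0, mul_one]
      have hc : Filter.Tendsto (fun ε : ℝ => Real.sqrt (x + ε)) (𝓝 0) (𝓝 (Real.sqrt (x + 0))) :=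
        (Real.continuous_sqrt.comp (continuous_const.add continuous_id)).tendsto 0
      rw [add_zero] at hc
      exact (hc.inv₀ h0).mono_left nhdsWithin_le_nhds
  have := Metric.tendsto_nhds.mp ht δ hδ
  simpa [dist_comm] using this

/-- The limit that defines `mixing` exists. -/
lemma mixing_eq {G A : Op H} (hA : 0 ≤ A) (hAG : A ≤ -G - star G) :
    mixing G A = invSqrtOp (-G - star G) * A * invSqrtOp (-G - star G) := by
  set B := -G - star G
  have hB : 0 ≤ B := hA.trans hAG
  refine Filter.Tendsto.limUnder_eq ?_
  have h := tendsto_invSqrtOp_mul_support hB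
  have h' : Filter.Tendsto (fun ε : ℝ => support B * invSqrtOp (B + (ε : ℂ) • 1)) (𝓝[>] 0)
      (𝓝 (invSqrtOp B)) := by
    have := h.star
    simpa only [star_mul, star_support, star_invSqrtOp] using this
  refine ((h.mul_const A).mul h').congr fun ε => ?_
  -- The support projections can be inserted around A at no cost, since A ≤ B; they make the two
  -- outer factors converge.
  have e : invSqrtOp (B + (ε : ℂ) • 1) * support B * A * (support B * invSqrtOp (B + (ε : ℂ) • 1)) =
      invSqrtOp (B + (ε : ℂ) • 1) * (support B * A * support B) * invSqrtOp (B + (ε : ℂ) • 1) := by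
    noncomm_ring
  rw [e, support_mul_of_le hA hAG, mul_support_of_le hA hAG]

lemma sum_inner_smul_sqrtOp {B : Op H} (hB : 0 ≤ B) {ι : Type*} [Fintype ι]
    (η : OrthonormalBasis ι ℂ H) (χ : H) :
    ∑ j, ⟪sqrtOp B (η j), χ⟫_ℂ • sqrtOp B (η j) = B χ := by
  conv_rhs => rw [← sqrtOp_mul_self hB, mul_apply_eq_comp, ← η.sum_repr' (sqrtOp B χ), map_sum]
  refine Finset.sum_congr rfl fun j _ => ?_
  rw [map_smul]
  congr 1
  conv_lhs => rw [← star_sqrtOp, ContinuousLinearMap.star_eq_adjoint,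
    ContinuousLinearMap.adjoint_inner_left]

/-- The spectral decomposition of T, conjugated by (2H)^{1/2}, returns A. Any eigenbasis of T
serves. -/
lemma sum_mul_inner_smul_sqrtOp {G A : Op H} (hA : 0 ≤ A) (hAG : A ≤ -G - star G)
    {ι : Type*} [Fintype ι] {η : OrthonormalBasis ι ℂ H} {lam : ι → ℝ}
    (hη : ∀ j, mixing G A (η j) = (lam j : ℂ) • η j) (χ : H) :
    ∑ j, ((lam j : ℂ) * ⟪sqrtOp (-G - star G) (η j), χ⟫_ℂ) • sqrtOp (-G - star G) (η j) = A χ := by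
  conv_rhs => rw [← sqrtOp_mul_compress_mul_sqrtOp hA hAG, ← mixing_eq hA hAG, mul_apply_eq_comp,
    mul_apply_eq_comp, ← η.sum_repr' (sqrtOp (-G - star G) χ), map_sum, map_sum]
  refine Finset.sum_congr rfl fun j _ => ?_
  rw [map_smul, map_smul, hη, map_smul, smul_smul, mul_comm]
  congr 2
  conv_lhs => rw [← star_sqrtOp, ContinuousLinearMap.star_eq_adjoint,
    ContinuousLinearMap.adjoint_inner_left]

lemma eigenvalue_mixing_mem {G A : Op H} (hA : 0 ≤ A) (hAG : A ≤ -G - star G)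
    {ι : Type*} [Fintype ι] {η : OrthonormalBasis ι ℂ H} {lam : ι → ℝ}
    (hη : ∀ j, mixing G A (η j) = (lam j : ℂ) • η j) (j : ι) : 0 ≤ lam j ∧ lam j ≤ 1 := by
  have h0 : 0 ≤ mixing G A := mixing_eq hA hAG ▸ compress_nonneg hA _
  have h1 : mixing G A ≤ 1 := mixing_eq hA hAG ▸ compress_le_one hA hAG
  have e : ⟪η j, (lam j : ℂ) • η j⟫_ℂ = lam j := by
    rw [inner_smul_right, inner_self_eq_norm_sq_to_K, η.orthonormal.1 j]
    simp
  constructor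
  · have := ((ContinuousLinearMap.nonneg_iff_isPositive _).mp h0).re_inner_nonneg_right (η j)
    rw [hη, e] at this
    simpa using this
  · have := ((ContinuousLinearMap.le_def _ _).mp h1).re_inner_nonneg_right (η j)
    rw [sub_apply, inner_sub_right, hη, e, one_apply_eq_self, inner_self_eq_norm_sq_to_K,
      η.orthonormal.1 j] at this
    simpa using this

/-! ## Compatibility -/

lemma integralR_nonneg {G A : Op H} (hA : 0 ≤ A) {t : ℝ} (ht : 0 ≤ t) : 0 ≤ integralR G A t := by
  rw [integralR, intervalIntegral.integral_of_le ht]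
  refine MeasureTheory.integral_nonneg fun s => ?_
  change 0 ≤ NormedSpace.exp ((s : ℂ) • G) * A * NormedSpace.exp ((s : ℂ) • star G)
  rw [← star_exp_ofReal_smul]
  exact star_right_conjugate_nonneg hA _

/-- The integrands add up to e^{sG}(-G - G*)e^{sG*}, minus the derivative of e^{sG}e^{sG*}.
Positivity of the second integral then yields the upper bound on R_t. -/
lemma integralR_add_integralR (G A : Op H) (t : ℝ) :
    integralR G A t + integralR G (-G - star G - A) t =
      1 - NormedSpace.exp ((t : ℂ) • G) * star (NormedSpace.exp ((t : ℂ) • G)) := by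
  have hd : ∀ s : ℝ, HasDerivAt (fun s : ℝ => integralR G A s + integralR G (-G - star G - A) s +
      NormedSpace.exp ((s : ℂ) • G) * NormedSpace.exp ((s : ℂ) • star G)) 0 s := by
    intro s
    refine (((hasDerivAt_integralR G A s).fun_add (hasDerivAt_integralR G _ s)).fun_add
      ((hasDerivAt_exp_ofReal_smul' G s).fun_mul
        (hasDerivAt_exp_ofReal_smul (star G) s))).congr_deriv ?_
    noncomm_ring
  have h := eq_zero_of_hasDerivAt_zero hd t
  simp only [integralR_zero, exp_ofReal_zero_smul, zero_add, mul_one] at h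
  rw [star_exp_ofReal_smul, ← h]
  abel

lemma isCompatible_exp {G A : Op H} (hG : IsContractionGenerator G) (hA : 0 ≤ A)
    (hAG : A ≤ -G - star G) {t : ℝ} (ht : 0 ≤ t) :
    IsCompatible (NormedSpace.exp ((t : ℂ) • G)) (integralR G A t) := by
  refine ⟨hG t ht, integralR_nonneg hA ht, ?_⟩
  rw [← integralR_add_integralR G A]
  exact le_add_of_nonneg_right (integralR_nonneg (sub_nonneg.mpr hAG) ht)

lemma IsCompatible.nonneg_defect {S R : Op H} (h : IsCompatible S R) : 0 ≤ 1 - S * star S :=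
  h.nonneg.trans h.le

lemma ancilla_nonneg {S R : Op H} (h : IsCompatible S R) : 0 ≤ ancilla S R :=
  compress_nonneg h.nonneg _

lemma sqrtOp_mul_ancilla_mul_sqrtOp {S R : Op H} (h : IsCompatible S R) :
    sqrtOp (1 - S * star S) * ancilla S R * sqrtOp (1 - S * star S) = R :=
  sqrtOp_mul_compress_mul_sqrtOp h.nonneg h.le

lemma IsCompatible.nonneg_codefect {S R : Op H} (h : IsCompatible S R) : 0 ≤ 1 - star S * S := by
  rw [sub_nonneg]
  refine (CStarAlgebra.norm_le_one_iff_of_nonneg _ (star_mul_self_nonneg S)).mp ?_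
  rw [CStarRing.norm_star_mul_self]
  exact mul_le_one₀ h.contraction (norm_nonneg _) h.contraction

-- On the finitely many points of both spectra, f agrees with a Lagrange interpolation polynomial,
-- and for polynomials the intertwining is algebraic.
open Polynomial in
lemma mul_cfc_eq_cfc_mul {a b s : Op H} (ha : IsSelfAdjoint a) (hb : IsSelfAdjoint b)
    (h : a * s = s * b) (f : ℝ → ℝ) : cfc f a * s = s * cfc f b := by
  classical
  set F : Finset ℝ := (finite_spectrum a).toFinset ∪ (finite_spectrum b).toFinset with hF
  set p : ℝ[X] := Lagrange.interpolate F id f with hp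
  have hev : ∀ x ∈ F, p.eval x = f x := fun x hx =>
    Lagrange.eval_interpolate_at_node (v := id) f Function.injective_id.injOn hx
  have h1 : cfc f a = aeval a p := by
    rw [← cfc_polynomial p a ha]
    exact cfc_congr fun x hx => (hev x (by simp [hF, hx])).symm
  have h2 : cfc f b = aeval b p := by
    rw [← cfc_polynomial p b hb]
    exact cfc_congr fun x hx => (hev x (by simp [hF, hx])).symm
  rw [h1, h2]
  induction p using Polynomial.induction_on' with
  | add p q hp hq => simp only [map_add, add_mul, mul_add, *]
  | monomial n c =>
    have hn : a ^ n * s = s * b ^ n := by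
      induction n with
      | zero => simp
      | succ n ih => rw [pow_succ, mul_assoc, h, ← mul_assoc, ih, mul_assoc, pow_succ]
    simp [aeval_monomial, hn, Algebra.algebraMap_eq_smul_one]

/-- This makes the off-diagonal blocks of the squared dilation cancel. -/
lemma sqrtOp_defect_mul {S R : Op H} (h : IsCompatible S R) :
    sqrtOp (1 - S * star S) * S = S * sqrtOp (1 - star S * S) :=
  mul_cfc_eq_cfc_mul (IsSelfAdjoint.of_nonneg h.nonneg_defect)
    (IsSelfAdjoint.of_nonneg h.nonneg_codefect) (by noncomm_ring) _

end Calculus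

/-! ### Gaussian density matrices and their exchange relation. -/

section Gaussian

variable {H : Type*} [NormedAddCommGroup H] [InnerProductSpace ℂ H]
  [FiniteDimensional ℂ H] [CompleteSpace H]
variable {K : Type*} [NormedAddCommGroup K] [InnerProductSpace ℂ K] [CompleteSpace K]
variable {Z : H →ₗ⋆[ℂ] Op K}

/-- Scalars on both sides avoid dividing by occupation probabilities, which may be 0 or 1. -/
lemma smul_mul_prod_ofFn {n : ℕ} (f : Fin n → Op K) (a : Op K) (c d : Fin n → ℂ)
    (h : ∀ i, c i • (a * f i) = d i • (f i * a)) :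
    (∏ i, c i) • (a * (List.ofFn f).prod) = (∏ i, d i) • ((List.ofFn f).prod * a) := by
  induction n with
  | zero => simp
  | succ n ih =>
    rw [List.ofFn_succ, List.prod_cons, Fin.prod_univ_succ, Fin.prod_univ_succ, ← mul_assoc,
      mul_comm (c 0), mul_smul, ← smul_mul_assoc, h 0, smul_mul_assoc, smul_comm, mul_assoc,
      ← mul_smul_comm, ih (fun i => f i.succ) _ _ fun i => h i.succ, mul_smul_comm, smul_smul,
      mul_assoc]

lemma commute_prod_ofFn {n : ℕ} {f : Fin n → Op K} {a : Op K} (h : ∀ i, Commute a (f i)) :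
    Commute a (List.ofFn f).prod :=
  Commute.list_prod_right _ _ fun x hx => by
    obtain ⟨i, rfl⟩ := (List.mem_ofFn' _ _).mp hx
    exact h i

lemma star_prod_ofFn {n : ℕ} {f : Fin n → Op K} (hf : ∀ i, star (f i) = f i)
    (hc : ∀ i j, i ≠ j → Commute (f i) (f j)) :
    star (List.ofFn f).prod = (List.ofFn f).prod := by
  induction n with
  | zero => simp
  | succ n ih =>
    rw [List.ofFn_succ, List.prod_cons, star_mul, hf,
      ih (fun i => hf i.succ) fun i j hij => hc _ _ (by simpa using hij)]
    exact (commute_prod_ofFn fun i => hc 0 i.succ (Fin.succ_ne_zero i).symm).eq.symm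

variable (Z) in
/-- The density matrix of a single mode `ψ` with occupation probability `μ`. -/
def modeDensity (ψ : H) (μ : ℝ) : Op K :=
  (2 * (1 - μ) : ℂ) • (Z ψ * star (Z ψ)) + (2 * μ : ℂ) • (star (Z ψ) * Z ψ)

lemma modeDensity_eq (hZ : IsCARField Z) {ψ : H} (hψ : ⟪ψ, ψ⟫_ℂ = 1) (μ : ℝ) :
    modeDensity Z ψ μ =
      (2 * (1 - μ) : ℂ) • 1 + (2 * μ - 2 * (1 - μ) : ℂ) • (star (Z ψ) * Z ψ) := by
  rw [modeDensity, hZ.mul_star_eq, hψ, one_smul]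
  module

lemma commute_modeDensity (hZ : IsCARField Z) {ψ φ : H} (hψ : ⟪ψ, ψ⟫_ℂ = 1) (h : ⟪ψ, φ⟫_ℂ = 0)
    (μ : ℝ) : Commute (modeDensity Z ψ μ) (Z φ) ∧ Commute (modeDensity Z ψ μ) (star (Z φ)) := by
  rw [modeDensity_eq hZ hψ]
  have := commute_number_modes hZ h
  exact ⟨((Commute.one_left _).smul_left _).add_left (this.1.smul_left _),
    ((Commute.one_left _).smul_left _).add_left (this.2.smul_left _)⟩

lemma star_modeDensity (ψ : H) (μ : ℝ) : star (modeDensity Z ψ μ) = modeDensity Z ψ μ := by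
  simp [modeDensity]

lemma commute_parity_modeDensity (hZ : IsCARField Z) (ψ : H) (μ : ℝ) :
    Commute (parity Z) (modeDensity Z ψ μ) := by
  have h1 : Commute (parity Z) (Z ψ * star (Z ψ)) := by
    rw [Commute, SemiconjBy, ← mul_assoc, parity_mul hZ, neg_mul, mul_assoc,
      parity_mul_creation hZ, mul_neg, neg_neg, mul_assoc]
  have h2 : Commute (parity Z) (star (Z ψ) * Z ψ) := by
    rw [Commute, SemiconjBy, ← mul_assoc, parity_mul_creation hZ, neg_mul, mul_assoc,
      parity_mul hZ, mul_neg, neg_neg, mul_assoc]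
  exact (h1.smul_right _).add_right (h2.smul_right _)

lemma smul_creation_mul_modeDensity (hZ : IsCARField Z) {ψ : H} (hψ : ⟪ψ, ψ⟫_ℂ = 1) (μ : ℝ) :
    (μ : ℂ) • (star (Z ψ) * modeDensity Z ψ μ) =
      (1 - μ : ℂ) • (modeDensity Z ψ μ * star (Z ψ)) := by
  have h : star (Z ψ) * (Z ψ * star (Z ψ)) = star (Z ψ) := by
    rw [hZ.mul_star_eq, hψ, one_smul, mul_sub, ← mul_assoc, hZ.star_mul_star_self]
    simp
  have h1 : star (Z ψ) * modeDensity Z ψ μ = (2 * (1 - μ) : ℂ) • star (Z ψ) := by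
    rw [modeDensity, mul_add, mul_smul_comm, mul_smul_comm, h, ← mul_assoc, hZ.star_mul_star_self]
    simp
  have h2 : modeDensity Z ψ μ * star (Z ψ) = (2 * μ : ℂ) • star (Z ψ) := by
    rw [modeDensity, add_mul, smul_mul_assoc, smul_mul_assoc, mul_assoc, mul_assoc, h,
      hZ.star_mul_star_self]
    simp
  rw [h1, h2, smul_smul, smul_smul]
  congr 1
  ring

/-- By cyclicity both projections of the mode have the same trace against X, and they add up to 1.
Thus each carries half of τ(X), and the weights 2(1-μ) and 2μ restore τ(X). -/
lemma tau_modeDensity_mul (hZ : IsCARField Z) {ψ : H} (hψ : ⟪ψ, ψ⟫_ℂ = 1) (μ : ℝ) {X : Op K}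
    (hX : Commute X (Z ψ)) : tau (modeDensity Z ψ μ * X) = tau X := by
  have h1 : tau (Z ψ * star (Z ψ) * X) = tau (star (Z ψ) * Z ψ * X) := by
    rw [mul_assoc, tau_mul_comm, mul_assoc, mul_assoc, hX.eq]
  have h2 : tau (Z ψ * star (Z ψ) * X) + tau (star (Z ψ) * Z ψ * X) = tau X := by
    rw [← map_add, ← add_mul, hZ.anticomm_star, hψ, one_smul, one_mul]
  rw [← h1] at h2
  rw [modeDensity, add_mul, map_add, smul_mul_assoc, smul_mul_assoc, map_smul, map_smul, ← h1,
    ← h2, smul_eq_mul, smul_eq_mul]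
  ring

lemma tau_prod_modeDensity (hZ : IsCARField Z) [Nontrivial K] [FiniteDimensional ℂ K] {n : ℕ}
    {b : Fin n → H} (hb : Orthonormal ℂ b) (μ : Fin n → ℝ) :
    tau (List.ofFn fun j => modeDensity Z (b j) (μ j)).prod = 1 := by
  have hb1 : ∀ i, ⟪b i, b i⟫_ℂ = 1 := fun i => by
    rw [inner_self_eq_norm_sq_to_K, hb.1]; simp
  induction n with
  | zero => simp [tau_one]
  | succ n ih =>
    rw [List.ofFn_succ, List.prod_cons, tau_modeDensity_mul hZ (hb1 0)]
    · exact ih (hb.comp _ (Fin.succ_injective n)) _ fun i => hb1 _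
    · exact (commute_prod_ofFn fun i =>
        (commute_modeDensity hZ (hb1 _) (hb.2 (Fin.succ_ne_zero i)) _).1.symm).symm

variable {Q : Op H}

lemma gaussian_eq (hQ : (Q : H →ₗ[ℂ] H).IsSymmetric) : gaussian Z Q =
    (List.ofFn fun j => modeDensity Z (hQ.eigenvectorBasis rfl j) (hQ.eigenvalues rfl j)).prod := by
  rw [gaussian, dif_pos hQ]
  rfl

lemma inner_self_basis {ι : Type*} [Fintype ι] (b : OrthonormalBasis ι ℂ H) (i : ι) :
    ⟪b i, b i⟫_ℂ = 1 := by
  rw [inner_self_eq_norm_sq_to_K, b.orthonormal.1]; simp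

lemma commute_parity_gaussian (hZ : IsCARField Z) (hQ : (Q : H →ₗ[ℂ] H).IsSymmetric) :
    Commute (parity Z) (gaussian Z Q) := by
  rw [gaussian_eq hQ]
  exact commute_prod_ofFn fun i => commute_parity_modeDensity hZ _ _

lemma star_gaussian (hZ : IsCARField Z) (hQ : (Q : H →ₗ[ℂ] H).IsSymmetric) :
    star (gaussian Z Q) = gaussian Z Q := by
  rw [gaussian_eq hQ]
  refine star_prod_ofFn (fun i => star_modeDensity _ _) fun i j hij => ?_
  have h := commute_modeDensity hZ (inner_self_basis (hQ.eigenvectorBasis rfl) i)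
    ((hQ.eigenvectorBasis rfl).orthonormal.2 hij) (hQ.eigenvalues rfl i)
  exact ((h.1.mul_right h.2).smul_right _).add_right ((h.2.mul_right h.1).smul_right _)

lemma tau_gaussian (hZ : IsCARField Z) [Nontrivial K] [FiniteDimensional ℂ K]
    (hQ : (Q : H →ₗ[ℂ] H).IsSymmetric) : tau (gaussian Z Q) = 1 := by
  rw [gaussian_eq hQ]
  exact tau_prod_modeDensity hZ (hQ.eigenvectorBasis rfl).orthonormal _

/-- A KMS-type relation. Both sides are linear in ψ, so eigenvectors of Q suffice, and for these
only the factor of their own mode fails to commute. -/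
lemma creation_mul_gaussian (hZ : IsCARField Z) (hQ : (Q : H →ₗ[ℂ] H).IsSymmetric) (ψ : H) :
    star (Z (Q ψ)) * gaussian Z Q = gaussian Z Q * star (Z (ψ - Q ψ)) := by
  let f : H →ₗ[ℂ] Op K :=
    (LinearMap.mulRight ℂ (gaussian Z Q)) ∘ₗ creation Z ∘ₗ (Q : H →ₗ[ℂ] H)
  let g : H →ₗ[ℂ] Op K :=
    (LinearMap.mulLeft ℂ (gaussian Z Q)) ∘ₗ creation Z ∘ₗ (LinearMap.id - (Q : H →ₗ[ℂ] H))
  have h : f = g := by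
    refine (hQ.eigenvectorBasis rfl).toBasis.ext fun j => ?_
    set b := hQ.eigenvectorBasis rfl
    have hj : (Q : H →ₗ[ℂ] H) (b j) = (hQ.eigenvalues rfl j : ℂ) • b j :=
      hQ.apply_eigenvectorBasis rfl j
    have key := smul_mul_prod_ofFn
      (fun i => modeDensity Z (b i) (hQ.eigenvalues rfl i)) (star (Z (b j)))
      (fun i => if i = j then (hQ.eigenvalues rfl i : ℂ) else 1)
      (fun i => if i = j then (1 - hQ.eigenvalues rfl i : ℂ) else 1) (by
        intro i
        by_cases hij : i = j
        · subst hij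
          simpa using smul_creation_mul_modeDensity hZ (inner_self_basis b i) _
        · simp only [hij, if_false, one_smul]
          exact (commute_modeDensity hZ (inner_self_basis b i)
            (b.orthonormal.2 hij) _).2.eq.symm)
    rw [Finset.prod_ite_eq' Finset.univ, Finset.prod_ite_eq' Finset.univ, ← gaussian_eq hQ] at key
    simp only [Finset.mem_univ, if_true] at key
    simp only [f, g, LinearMap.comp_apply, OrthonormalBasis.coe_toBasis, hj, LinearMap.sub_apply,
      LinearMap.id_apply, map_smul, map_sub, LinearMap.mulRight_apply, LinearMap.mulLeft_apply,
      creation_apply]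
    rw [key, sub_smul, one_smul]
  exact LinearMap.congr_fun h ψ

/-- In the second term of the graded commutator, carrying Z*(Qψ) through the density matrix and
around the trace turns it into Z*(ψ - Qψ). With the first term this adds up to Z*(ψ). -/
lemma hasExchange_gaussian (hZ : IsCARField Z) (hQ : (Q : H →ₗ[ℂ] H).IsSymmetric) :
    HasExchange Z (gaussian Z Q) Q := by
  intro ψ X
  have hW := parity_mul_self hZ
  have hρ := (commute_parity_gaussian hZ hQ).eq
  have e : parity Z * X * parity Z * star (Z (Q ψ)) * gaussian Z Q =
      -(parity Z * (X * (gaussian Z Q * star (Z (ψ - Q ψ))) * parity Z)) := by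
    rw [← creation_mul_gaussian hZ hQ]
    simp only [mul_assoc]
    rw [← hρ, ← mul_assoc (parity Z) (star _), parity_mul_creation hZ, neg_mul, mul_neg, mul_neg,
      mul_assoc]
  rw [contract_eq, gradedComm_apply, sub_mul, map_sub, e, map_neg, sub_neg_eq_add, tau_mul_comm
    (parity Z), mul_assoc _ (parity Z), hW, mul_one, ← mul_assoc X, tau_mul_comm (X * _),
    ← mul_assoc, ← map_add, ← add_mul, ← add_mul, ← star_add, ← map_add, add_sub_cancel]

end Gaussian

/-! ## Implementing Bogoliubov reflections -/

section Implementer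

variable {H : Type*} [NormedAddCommGroup H] [InnerProductSpace ℂ H]
  [FiniteDimensional ℂ H] [CompleteSpace H]
variable {K : Type*} [NormedAddCommGroup K] [InnerProductSpace ℂ K] [CompleteSpace K]
variable {Z : H →ₗ⋆[ℂ] Op K}

/-- A self-adjoint unitary `U = 1 - 2 P` is implemented by `exp (iπ P̂)`. -/
lemma exists_implementer (hZ : IsCARField Z) {U : Op H} (hU : star U = U) (hUU : U * U = 1) :
    ∃ V ∈ unitary (Op K), ∀ ψ, V * Z ψ * star V = Z (U ψ) := by
  set P : Op H := (1 / 2 : ℂ) • (1 - U) with hP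
  have hPs : star P = P := by
    rw [hP, star_smul, star_sub, star_one, hU]
    simp
  have hUU' : ∀ χ, U (U χ) = χ := fun χ => congrArg (fun T : Op H => T χ) hUU
  have hPa : ∀ χ, P χ = (1 / 2 : ℂ) • (χ - U χ) := fun χ => rfl
  set V : Op K := NormedSpace.exp ((Real.pi * Complex.I : ℂ) • hat Z P) with hV
  have hVs : star V = NormedSpace.exp (-((Real.pi * Complex.I : ℂ) • hat Z P)) := by
    rw [hV, NormedSpace.star_exp, star_smul, star_hat, hPs, ← neg_smul]
    simp
  have h1 : star V * V = 1 := by rw [hVs, hV]; exact exp_neg_mul_exp _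
  have h2 : V * star V = 1 := by rw [hVs, hV]; exact exp_mul_exp_neg _
  -- P projects onto the eigenspace of U for -1: V gives Z*(Pχ) the phase e^{iπ} = -1 and commutes
  -- with Z*(χ - Pχ).
  have hc : ∀ χ, V * star (Z χ) = star (Z (U χ)) * V := by
    intro χ
    have e1 : P (P χ) = (1 : ℂ) • P χ := by
      simp only [hPa, map_smul, map_sub, hUU']
      module
    have e2 : P (χ - P χ) = (0 : ℂ) • (χ - P χ) := by
      simp only [hPa, map_smul, map_sub, hUU']
      module
    have f1 := exp_hat_mul_creation hZ e1 (Real.pi * Complex.I)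
    have f2 := exp_hat_mul_creation hZ e2 (Real.pi * Complex.I)
    rw [mul_one, Complex.exp_pi_mul_I, ← hV] at f1
    rw [mul_zero, Complex.exp_zero, one_smul, ← hV] at f2
    have g1 : χ = P χ + (χ - P χ) := by abel
    have g2 : U χ = -P χ + (χ - P χ) := by
      simp only [hPa]
      module
    conv_lhs => rw [g1, map_add, star_add, mul_add, f1, f2]
    rw [g2, map_add, star_add, add_mul, map_neg, star_neg]
    simp
  refine ⟨V, Unitary.mem_iff.mpr ⟨h1, h2⟩, fun ψ => ?_⟩
  have h := congrArg star (hc ψ)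
  rw [star_mul, star_mul, star_star, star_star] at h
  have h' := hc (U ψ)
  rw [hUU'] at h'
  have h3 := congrArg star h'
  rw [star_mul, star_mul, star_star, star_star] at h3
  have h4 : V * Z ψ = Z (U ψ) * V := by
    calc V * Z ψ = V * (Z ψ * star V) * V := by rw [mul_assoc, mul_assoc, h1, mul_one]
      _ = V * (star V * Z (U ψ)) * V := by rw [h]
      _ = Z (U ψ) * V := by rw [← mul_assoc, h2, one_mul]
  rw [h4, mul_assoc, h2, mul_one]

lemma implementer_spec (hZ : IsCARField Z) {U : Op H} (hU : star U = U) (hUU : U * U = 1) :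
    implementer Z U ∈ unitary (Op K) ∧
      ∀ ψ, implementer Z U * Z ψ * star (implementer Z U) = Z (U ψ) := by
  have h := exists_implementer hZ hU hUU
  rw [implementer, dif_pos h]
  exact h.choose_spec

end Implementer

/-! ### The unitary dilation is a self-adjoint involution. -/

section Dilation

variable {H : Type*} [NormedAddCommGroup H] [InnerProductSpace ℂ H] [CompleteSpace H]

variable [FiniteDimensional ℂ H] {S R : Op H}

lemma dilation_apply (ξ : WithLp 2 (H × H)) : dilation S ξ =
    WithLp.toLp 2 (-sqrtOp (1 - S * star S) ξ.fst + S ξ.snd,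
      star S ξ.fst + sqrtOp (1 - star S * S) ξ.snd) := rfl

lemma star_dilation : star (dilation S) = dilation S := by
  have h : ((dilation S : Op (WithLp 2 (H × H))) :
      WithLp 2 (H × H) →ₗ[ℂ] WithLp 2 (H × H)).IsSymmetric := by
    intro x y
    change ⟪dilation S x, y⟫_ℂ = ⟪x, dilation S y⟫_ℂ
    have h1 : ∀ u v : H, ⟪sqrtOp (1 - S * star S) u, v⟫_ℂ = ⟪u, sqrtOp (1 - S * star S) v⟫_ℂ := by
      intro u v
      conv_lhs => rw [← star_sqrtOp, ContinuousLinearMap.star_eq_adjoint,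
        ContinuousLinearMap.adjoint_inner_left]
    have h2 : ∀ u v : H, ⟪sqrtOp (1 - star S * S) u, v⟫_ℂ = ⟪u, sqrtOp (1 - star S * S) v⟫_ℂ := by
      intro u v
      conv_lhs => rw [← star_sqrtOp, ContinuousLinearMap.star_eq_adjoint,
        ContinuousLinearMap.adjoint_inner_left]
    have h3 : ∀ u v : H, ⟪star S u, v⟫_ℂ = ⟪u, S v⟫_ℂ := fun u v => by
      rw [ContinuousLinearMap.star_eq_adjoint, ContinuousLinearMap.adjoint_inner_left]
    have h4 : ∀ u v : H, ⟪S u, v⟫_ℂ = ⟪u, star S v⟫_ℂ := fun u v => by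
      rw [ContinuousLinearMap.star_eq_adjoint, ContinuousLinearMap.adjoint_inner_right]
    have h5 : ∀ z : WithLp 2 (H × H), z.fst = z.ofLp.1 := fun _ => rfl
    have h6 : ∀ z : WithLp 2 (H × H), z.snd = z.ofLp.2 := fun _ => rfl
    simp only [dilation_apply, WithLp.prod_inner_apply, h5, h6, inner_add_left, inner_add_right,
      inner_neg_left, inner_neg_right, h1, h2, h3, h4]
    ring
  exact (ContinuousLinearMap.isSelfAdjoint_iff_isSymmetric.mpr h).star_eq

lemma dilation_mul_self (h : IsCompatible S R) : dilation S * dilation S = 1 := by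
  have e1 : ∀ u, sqrtOp (1 - S * star S) (sqrtOp (1 - S * star S) u) = u - S (star S u) := fun u =>
    congrArg (fun T : Op H => T u) (sqrtOp_mul_self h.nonneg_defect)
  have e2 : ∀ u, sqrtOp (1 - star S * S) (sqrtOp (1 - star S * S) u) = u - star S (S u) := fun u =>
    congrArg (fun T : Op H => T u) (sqrtOp_mul_self h.nonneg_codefect)
  have e3 : ∀ u, sqrtOp (1 - S * star S) (S u) = S (sqrtOp (1 - star S * S) u) := fun u =>
    congrArg (fun T : Op H => T u) (sqrtOp_defect_mul h)
  have e4 : ∀ u, star S (sqrtOp (1 - S * star S) u) = sqrtOp (1 - star S * S) (star S u) := by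
    intro u
    have := congrArg star (sqrtOp_defect_mul h)
    rw [star_mul, star_mul, star_sqrtOp, star_sqrtOp] at this
    exact congrArg (fun T : Op H => T u) this
  ext1 ξ
  rw [mul_apply_eq_comp, dilation_apply (dilation S ξ), dilation_apply ξ]
  simp only [WithLp.toLp_fst, WithLp.toLp_snd, map_add, map_neg, e1, e2, e3, e4, one_apply_eq_self]
  have : ξ = WithLp.toLp 2 (ξ.fst, ξ.snd) := rfl
  conv_rhs => rw [this]
  congr 2 <;> abel

end Dilation

/-! ### Operators on the tensor square. -/

section Tensor

variable {K : Type*} [NormedAddCommGroup K] [InnerProductSpace ℂ K] [CompleteSpace K]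
  [FiniteDimensional ℂ K]

lemma star_mapL (A B : Op K) :
    star (TensorProduct.mapL A B) = TensorProduct.mapL (star A) (star B) :=
  TensorProduct.adjoint_mapL A B

lemma mapL_one_one : TensorProduct.mapL (1 : Op K) (1 : Op K) = 1 := TensorProduct.mapL_id_id

lemma mapL_neg_left (A B : Op K) : TensorProduct.mapL (-A) B = -TensorProduct.mapL A B := by
  rw [eq_neg_iff_add_eq_zero, ← TensorProduct.mapL_add_left, neg_add_cancel,
    TensorProduct.mapL_zero_left]

lemma mapL_neg_right (A B : Op K) : TensorProduct.mapL A (-B) = -TensorProduct.mapL A B := by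
  rw [eq_neg_iff_add_eq_zero, ← TensorProduct.mapL_add_right, neg_add_cancel,
    TensorProduct.mapL_zero_right]

lemma tau_mapL (A B : Op K) : tau (TensorProduct.mapL A B) = tau A * tau B := by
  simp only [tau, LinearMap.coe_mk, AddHom.coe_mk]
  rw [TensorProduct.toLinearMap_mapL, LinearMap.trace_tensorProduct', Module.finrank_tensorProduct]
  push_cast
  rw [mul_inv]
  ring

end Tensor

/-! ### The doubled field and the embedding of the first factor. -/

section Double

variable {H : Type*} [NormedAddCommGroup H] [InnerProductSpace ℂ H]
  [FiniteDimensional ℂ H] [CompleteSpace H]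
variable {K : Type*} [NormedAddCommGroup K] [InnerProductSpace ℂ K] [CompleteSpace K]
  [FiniteDimensional ℂ K]
variable {Z : H →ₗ⋆[ℂ] Op K}

open TensorProduct (mapL mapL_mul mapL_add_left mapL_add_right mapL_smul_left mapL_smul_right)

lemma double_apply (ξ : WithLp 2 (H × H)) :
    double Z ξ = mapL (Z ξ.fst) (parity Z) + mapL 1 (Z ξ.snd) := rfl

lemma star_double_apply (hZ : IsCARField Z) (ξ : WithLp 2 (H × H)) :
    star (double Z ξ) = mapL (star (Z ξ.fst)) (parity Z) + mapL 1 (star (Z ξ.snd)) := by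
  rw [double_apply, star_add, star_mapL, star_mapL, star_parity hZ, star_one]

/-- The parity in the second leg of Z(ψ) ⊗ W makes the two summands anticommute, so all cross terms
cancel. -/
lemma isCARField_double (hZ : IsCARField Z) : IsCARField (double Z) := by
  have hW := parity_mul_self hZ
  constructor
  · intro ψ φ
    rw [star_double_apply hZ, double_apply]
    simp only [mul_add, add_mul, ← mapL_mul, hW, one_mul,
      mul_one, parity_mul_creation hZ, parity_mul hZ, mapL_neg_right]
    have e1 : mapL (Z ψ.fst * star (Z φ.fst)) 1 + mapL (star (Z φ.fst) * Z ψ.fst) 1 =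
        ⟪ψ.fst, φ.fst⟫_ℂ • (1 : Op (K ⊗[ℂ] K)) := by
      rw [← mapL_add_left, hZ.anticomm_star, mapL_smul_left, mapL_one_one]
    have e2 : mapL 1 (Z ψ.snd * star (Z φ.snd)) + mapL 1 (star (Z φ.snd) * Z ψ.snd) =
        ⟪ψ.snd, φ.snd⟫_ℂ • (1 : Op (K ⊗[ℂ] K)) := by
      rw [← mapL_add_right, hZ.anticomm_star, mapL_smul_right, mapL_one_one]
    rw [WithLp.prod_inner_apply, add_smul]
    have e3 : (⟪(WithLp.ofLp ψ).1, (WithLp.ofLp φ).1⟫_ℂ) • (1 : Op (K ⊗[ℂ] K)) =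
      mapL (Z ψ.fst * star (Z φ.fst)) 1 + mapL (star (Z φ.fst) * Z ψ.fst) 1 := e1.symm
    have e4 : (⟪(WithLp.ofLp ψ).2, (WithLp.ofLp φ).2⟫_ℂ) • (1 : Op (K ⊗[ℂ] K)) =
      mapL 1 (Z ψ.snd * star (Z φ.snd)) + mapL 1 (star (Z φ.snd) * Z ψ.snd) := e2.symm
    rw [e3, e4]
    abel
  · intro ψ φ
    simp only [double_apply, mul_add, add_mul, ← mapL_mul, hW, one_mul,
      mul_one, parity_mul hZ, mapL_neg_right]
    have e1 : mapL (Z ψ.fst * Z φ.fst) 1 + mapL (Z φ.fst * Z ψ.fst) 1 =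
        (0 : Op (K ⊗[ℂ] K)) := by
      rw [← mapL_add_left, hZ.anticomm]; simp
    have e2 : mapL 1 (Z ψ.snd * Z φ.snd) + mapL 1 (Z φ.snd * Z ψ.snd) =
        (0 : Op (K ⊗[ℂ] K)) := by
      rw [← mapL_add_right, hZ.anticomm]; simp
    have e : (mapL (Z ψ.fst * Z φ.fst) 1 + mapL (Z φ.fst * Z ψ.fst) 1) +
      (mapL 1 (Z ψ.snd * Z φ.snd) + mapL 1 (Z φ.snd * Z ψ.snd)) = (0 : Op (K ⊗[ℂ] K)) := by
      rw [e1, e2, add_zero]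
    rw [← e]
    abel

lemma parity_tensor_mul_self (hZ : IsCARField Z) :
    mapL (parity Z) (parity Z) * mapL (parity Z) (parity Z) = 1 := by
  rw [← mapL_mul, parity_mul_self hZ, mapL_one_one]

lemma parity_tensor_mul_double (hZ : IsCARField Z) (ξ : WithLp 2 (H × H)) :
    mapL (parity Z) (parity Z) * double Z ξ = -(double Z ξ * mapL (parity Z) (parity Z)) := by
  simp only [double_apply, mul_add, add_mul, ← mapL_mul, parity_mul hZ, mapL_neg_left,
    mapL_neg_right, mul_one, one_mul, neg_add]

lemma parity_tensor_mul_star_double (hZ : IsCARField Z) (ξ : WithLp 2 (H × H)) :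
    mapL (parity Z) (parity Z) * star (double Z ξ) =
      -(star (double Z ξ) * mapL (parity Z) (parity Z)) := by
  simp only [star_double_apply hZ, mul_add, add_mul, ← mapL_mul, parity_mul_creation hZ,
    mapL_neg_left, mapL_neg_right, mul_one, one_mul, neg_add]

lemma embedFst_apply (X : Op K) : embedFst Z X =
    mapL ((1 / 2 : ℂ) • (X + parity Z * X * parity Z)) 1 +
      mapL ((1 / 2 : ℂ) • (X - parity Z * X * parity Z)) (parity Z) := rfl

lemma embedFst_even {X : Op K} (hZ : IsCARField Z) (hX : Commute (parity Z) X) :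
    embedFst Z X = mapL X 1 := by
  rw [embedFst_apply, hX.eq, mul_assoc, parity_mul_self hZ, mul_one, sub_self, smul_zero,
    TensorProduct.mapL_zero_left, add_zero, ← two_smul ℂ X, smul_smul]
  norm_num

lemma embedFst_one (hZ : IsCARField Z) : embedFst Z 1 = 1 := by
  rw [embedFst_even hZ (Commute.one_right _), mapL_one_one]

lemma embedFst_odd {X : Op K} (hZ : IsCARField Z) (hX : parity Z * X = -(X * parity Z)) :
    embedFst Z X = mapL X (parity Z) := by
  rw [embedFst_apply, grading_odd (parity_mul_self hZ) hX, add_neg_cancel, smul_zero,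
    TensorProduct.mapL_zero_left, zero_add, sub_neg_eq_add, ← two_smul ℂ X, smul_smul]
  norm_num

lemma embedFst_mul (hZ : IsCARField Z) (X Y : Op K) :
    embedFst Z (X * Y) = embedFst Z X * embedFst Z Y := by
  have hW := parity_mul_self hZ
  simp only [embedFst_apply, add_mul, mul_add, ← mapL_mul, one_mul, mul_one, hW]
  have e : ∀ A B C D : Op K, mapL A 1 + mapL B (parity Z) + (mapL C (parity Z) + mapL D 1) =
      mapL (A + D) 1 + mapL (B + C) (parity Z) := by
    intro A B C D
    rw [mapL_add_left, mapL_add_left]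
    abel
  rw [grading_mul hW]
  simp only [smul_mul_smul_comm]
  rw [e]
  congr 2
  · simp only [mul_add, add_mul, mul_sub, sub_mul]
    module
  · simp only [mul_add, add_mul, mul_sub, sub_mul]
    module

lemma star_embedFst (hZ : IsCARField Z) (X : Op K) :
    star (embedFst Z X) = embedFst Z (star X) := by
  have : star (1 / 2 : ℂ) = 1 / 2 := by simp
  simp only [embedFst_apply, star_add, star_mapL, star_smul, star_sub, star_mul, star_one,
    star_parity hZ, mul_assoc, this]

lemma embedSnd_apply (Y : Op K) : embedSnd Y = mapL 1 Y := rfl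

end Double

/-! ## The Evans–Hugenholtz–Kadison operation is quasi-free -/

section EHK

variable {H : Type*} [NormedAddCommGroup H] [InnerProductSpace ℂ H]
  [FiniteDimensional ℂ H] [CompleteSpace H]
variable {K : Type*} [NormedAddCommGroup K] [InnerProductSpace ℂ K] [CompleteSpace K]
  [FiniteDimensional ℂ K]
variable {Z : H →ₗ⋆[ℂ] Op K} {S R : Op H}

open TensorProduct (mapL mapL_mul mapL_add_left mapL_add_right mapL_smul_left mapL_smul_right)

variable (Z S) in
/-- The embedding `X ↦ α_U(X ⊗ 1)` of `𝓑(𝒦)` onto the algebra generated by `Z(U(ψ ⊕ 0))`, for the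
unitary dilation `U` of `S`. -/
def dilatedEmbedding (X : Op K) : Op (K ⊗[ℂ] K) :=
  implementer (double Z) (dilation S) * embedFst Z X * star (implementer (double Z) (dilation S))

lemma isCompatible_implementer (hZ : IsCARField Z) (h : IsCompatible S R) :
    implementer (double Z) (dilation S) ∈ unitary (Op (K ⊗[ℂ] K)) ∧
      ∀ ψ, implementer (double Z) (dilation S) * double Z ψ *
        star (implementer (double Z) (dilation S)) = double Z (dilation S ψ) :=
  implementer_spec (isCARField_double hZ) star_dilation (dilation_mul_self h)

lemma dilatedEmbedding_one (hZ : IsCARField Z) (h : IsCompatible S R) :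
    dilatedEmbedding Z S 1 = 1 := by
  rw [dilatedEmbedding, embedFst_one hZ, mul_one]
  exact (Unitary.mem_iff.mp (isCompatible_implementer hZ h).1).2

lemma dilatedEmbedding_mul (hZ : IsCARField Z) (h : IsCompatible S R) (X Y : Op K) :
    dilatedEmbedding Z S (X * Y) = dilatedEmbedding Z S X * dilatedEmbedding Z S Y := by
  have h1 := (Unitary.mem_iff.mp (isCompatible_implementer hZ h).1).1
  simp only [dilatedEmbedding, embedFst_mul hZ, mul_assoc]
  rw [← mul_assoc (star _) (implementer _ _), h1, one_mul]

lemma star_dilatedEmbedding (hZ : IsCARField Z) (X : Op K) :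
    star (dilatedEmbedding Z S X) = dilatedEmbedding Z S (star X) := by
  rw [dilatedEmbedding, star_mul, star_mul, star_star, star_embedFst hZ, ← mul_assoc]
  rfl

lemma dilatedEmbedding_add (X Y : Op K) :
    dilatedEmbedding Z S (X + Y) = dilatedEmbedding Z S X + dilatedEmbedding Z S Y := by
  simp only [dilatedEmbedding, map_add, mul_add, add_mul]

lemma dilatedEmbedding_smul (c : ℂ) (X : Op K) :
    dilatedEmbedding Z S (c • X) = c • dilatedEmbedding Z S X := by
  simp only [dilatedEmbedding, map_smul, mul_smul_comm, smul_mul_assoc]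

lemma dilatedEmbedding_field (hZ : IsCARField Z) (h : IsCompatible S R) (ψ : H) :
    dilatedEmbedding Z S (Z ψ) =
      double Z (WithLp.toLp 2 (-sqrtOp (1 - S * star S) ψ, star S ψ)) := by
  have e : embedFst Z (Z ψ) = double Z (WithLp.toLp 2 (ψ, 0)) := by
    rw [embedFst_odd hZ (parity_mul hZ ψ), double_apply]
    simp
  rw [dilatedEmbedding, e, (isCompatible_implementer hZ h).2, dilation_apply]
  simp

lemma dilatedEmbedding_creation (hZ : IsCARField Z) (h : IsCompatible S R) (ψ : H) :
    dilatedEmbedding Z S (star (Z ψ)) =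
      star (double Z (WithLp.toLp 2 (-sqrtOp (1 - S * star S) ψ, star S ψ))) := by
  rw [← star_dilatedEmbedding hZ, dilatedEmbedding_field hZ h]

/-- Both sides obey the same graded Leibniz rule in X, so the generators suffice, where the
anticommutator yields ⟨-(1 - SS*)^{1/2}φ, ξ⟩. The Leibniz step needs compatibility of the gradings;
hence the two claims are proved together. -/
lemma gradedComm_dilatedEmbedding (hZ : IsCARField Z) (hirr : IsIrreducible Z)
    (h : IsCompatible S R) (ξ : H) (X : Op K) :
    mapL (parity Z) (parity Z) * dilatedEmbedding Z S X * mapL (parity Z) (parity Z) =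
        dilatedEmbedding Z S (parity Z * X * parity Z) ∧
      gradedComm (mapL (parity Z) (parity Z)) (star (double Z (WithLp.toLp 2 (ξ, 0))))
          (dilatedEmbedding Z S X) =
        dilatedEmbedding Z S (contract Z (-sqrtOp (1 - S * star S) ξ) X) := by
  have hW := parity_mul_self hZ
  have hW2 := parity_tensor_mul_self hZ (K := K)
  have hd := isCARField_double hZ
  have hs : ∀ u v : H, ⟪sqrtOp (1 - S * star S) u, v⟫_ℂ = ⟪u, sqrtOp (1 - S * star S) v⟫_ℂ := by
    intro u v
    conv_lhs => rw [← star_sqrtOp, ContinuousLinearMap.star_eq_adjoint,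
      ContinuousLinearMap.adjoint_inner_left]
  have hX : X ∈ fieldAlgebra Z := by rw [fieldAlgebra_eq_top hirr]; trivial
  induction hX using Algebra.adjoin_induction with
  | mem X hX =>
    rcases hX with ⟨φ, rfl⟩ | ⟨φ, rfl⟩
    · rw [dilatedEmbedding_field hZ h, grading_odd hW2 (parity_tensor_mul_double hZ _),
        grading_odd hW (parity_mul hZ _),
        gradedComm_odd hW2 (parity_tensor_mul_double hZ _), add_comm, hd.anticomm_star,
        contract_field hZ, dilatedEmbedding_smul, dilatedEmbedding_one hZ h,
        ← neg_one_smul ℂ (Z φ), dilatedEmbedding_smul, dilatedEmbedding_field hZ h]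
      refine ⟨by simp, ?_⟩
      simp [WithLp.prod_inner_apply, hs]
    · have e1 : contract Z (-sqrtOp (1 - S * star S) ξ) (star (Z φ)) = 0 := by
        have := contract_creation_mul hZ (-sqrtOp (1 - S * star S) ξ) φ 1
        rwa [mul_one, contract_one hZ, mul_zero, neg_zero] at this
      rw [dilatedEmbedding_creation hZ h, grading_odd hW2 (parity_tensor_mul_star_double hZ _),
        grading_odd hW (parity_mul_creation hZ _),
        gradedComm_odd hW2 (parity_tensor_mul_star_double hZ _), e1,
        ← neg_one_smul ℂ (star (Z φ)), dilatedEmbedding_smul, dilatedEmbedding_creation hZ h,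
        hd.star_mul_star_eq_neg, neg_add_cancel]
      refine ⟨by simp, ?_⟩
      -- The embedding is a plain function, so its value at 0 is read off from homogeneity.
      rw [← zero_smul ℂ (0 : Op K), dilatedEmbedding_smul, zero_smul]
  | algebraMap c =>
    rw [Algebra.algebraMap_eq_smul_one, mul_smul_comm, mul_one, smul_mul_assoc, hW, map_smul,
      contract_one hZ, smul_zero, dilatedEmbedding_smul, dilatedEmbedding_one hZ h,
      mul_smul_comm, smul_mul_assoc, mul_one, hW2, map_smul, gradedComm_apply, mul_one, mul_one,
      hW2, one_mul, sub_self, smul_zero]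
    refine ⟨rfl, ?_⟩
    rw [← zero_smul ℂ (0 : Op K), dilatedEmbedding_smul, zero_smul]
  | add X Y _ _ hX hY =>
    simp only [mul_add, add_mul, map_add, dilatedEmbedding_add, hX.1, hX.2, hY.1, hY.2, and_self]
  | mul X Y _ _ hX hY =>
    constructor
    · rw [dilatedEmbedding_mul hZ h, grading_mul hW2, hX.1, hY.1, grading_mul hW,
        ← dilatedEmbedding_mul hZ h]
    · rw [dilatedEmbedding_mul hZ h, gradedComm_mul hW2, hX.1, hX.2, hY.2, contract_eq,
        gradedComm_mul hW, dilatedEmbedding_add, ← contract_eq,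
        ← dilatedEmbedding_mul hZ h, ← dilatedEmbedding_mul hZ h]

/-- The exchange relation of a gauge invariant Gaussian state on the first tensor factor. -/
lemma tau_mapL_gaussian_exchange (hZ : IsCARField Z) {T : Op H}
    (hT : (T : H →ₗ[ℂ] H).IsSymmetric) (χ : H) (M : Op (K ⊗[ℂ] K)) (Y : Op K) :
    tau (mapL (star (Z χ)) (parity Z) * M * mapL (gaussian Z T) Y) =
      tau (gradedComm (mapL (parity Z) (parity Z)) (mapL (star (Z (T χ))) (parity Z)) M *
        mapL (gaussian Z T) Y) := by
  have hW := parity_mul_self hZ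
  set W2 : Op (K ⊗[ℂ] K) := mapL (parity Z) (parity Z)
  set B : Op (K ⊗[ℂ] K) := mapL (star (Z (T χ))) (parity Z) with hB
  set C : Op (K ⊗[ℂ] K) := mapL (star (Z χ)) (parity Z) with hC
  set r : Op (K ⊗[ℂ] K) := mapL (gaussian Z T) Y with hr
  -- The first leg is the exchange for ρ_T. In the second, W·W·Y·W = Y·W, so Y is never crossed and
  -- its parity does not matter.
  have e : W2 * B * r * W2 = -(r * (C - B)) := by
    have e1 : C - B = mapL (star (Z (χ - T χ))) (parity Z) := by
      rw [hC, hB, map_sub, star_sub, sub_eq_add_neg (star (Z χ)), mapL_add_left, mapL_neg_left,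
        sub_eq_add_neg]
    have e2 : parity Z * star (Z (T χ)) * gaussian Z T * parity Z =
        -(gaussian Z T * star (Z (χ - T χ))) := by
      rw [mul_assoc (parity Z), creation_mul_gaussian hZ hT, ← mul_assoc,
        (commute_parity_gaussian hZ hT).eq, mul_assoc (gaussian Z T), parity_mul_creation hZ,
        mul_neg, neg_mul, mul_assoc, mul_assoc, hW, mul_one]
    rw [e1, hB, hr, ← mapL_mul, ← mapL_mul, ← mapL_mul, ← mapL_mul, e2, hW, one_mul, mapL_neg_left]
  have e3 : tau (W2 * M * W2 * B * r) = -tau (M * r * (C - B)) := by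
    have : W2 * M * W2 * B * r = W2 * (M * (W2 * B * r)) := by simp only [mul_assoc]
    rw [this, tau_mul_comm, mul_assoc M, e, mul_neg, map_neg, mul_assoc]
  have e4 : tau (M * r * (C - B)) = tau (C * M * r) - tau (B * M * r) := by
    rw [tau_mul_comm, sub_mul, map_sub, mul_assoc, mul_assoc]
  rw [gradedComm_apply, sub_mul, map_sub, e3, e4]
  ring

/-- Cyclicity moves the implementer onto X, and ρ_T, being even, sits in the first leg as ρ_T ⊗ 1.
The dual operation is thus read off by pairing the dilated X with ρ_T ⊗ Y. -/
lemma tau_star_dagger_ehk_mul (hZ : IsCARField Z)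
    (hT : (ancilla S R : H →ₗ[ℂ] H).IsSymmetric) (X Y : Op K) :
    tau (star (dagger (ehk Z S R) X) * Y) =
      tau (dilatedEmbedding Z S (star X) * mapL (gaussian Z (ancilla S R)) Y) := by
  rw [tau_star_dagger_mul]
  have e : ehk Z S R Y = traceAdjoint (embedFst Z)
      (star (implementer (double Z) (dilation S)) *
        (embedFst Z (gaussian Z (ancilla S R)) * embedSnd Y) *
        implementer (double Z) (dilation S)) := rfl
  rw [e, tau_star_mul_traceAdjoint, star_embedFst hZ,
    embedFst_even hZ (commute_parity_gaussian hZ hT), embedSnd_apply, ← mapL_mul, mul_one, one_mul,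
    dilatedEmbedding, ← mul_assoc, tau_mul_comm]
  simp only [mul_assoc]

lemma tau_dagger_ehk_mul (hZ : IsCARField Z)
    (hT : (ancilla S R : H →ₗ[ℂ] H).IsSymmetric) (X Y : Op K) :
    tau (dagger (ehk Z S R) X * Y) =
      tau (dilatedEmbedding Z S X * mapL (gaussian Z (ancilla S R)) Y) := by
  have h := congrArg star (tau_star_dagger_ehk_mul hZ hT X (star Y))
  rw [← tau_star, ← tau_star, star_mul, star_mul, star_star, star_star, star_mapL,
    star_dilatedEmbedding hZ, star_star, star_star, star_gaussian hZ hT] at h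
  rw [tau_mul_comm, h, tau_mul_comm]

/-- The dual of the Evans–Hugenholtz–Kadison operation `Φ_{S,R}` is quasi-free with data `S, R`. -/
theorem isQuasiFree_dagger_ehk (hZ : IsCARField Z) (hirr : IsIrreducible Z)
    (h : IsCompatible S R) : IsQuasiFree Z (dagger (ehk Z S R)) S R := by
  have := hirr.nontrivial
  have hT : (ancilla S R : H →ₗ[ℂ] H).IsSymmetric :=
    ContinuousLinearMap.isSelfAdjoint_iff_isSymmetric.mp (IsSelfAdjoint.of_nonneg (ancilla_nonneg h))
  have key := tau_dagger_ehk_mul hZ hT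
  refine ⟨ext_mul_tau fun Y => ?_, fun X => ext_mul_tau fun Y => ?_, fun ψ X =>
    ext_mul_tau fun Y => ?_⟩
  · rw [key, dilatedEmbedding_one hZ h, one_mul, one_mul, tau_mapL, tau_gaussian hZ hT, one_mul]
  · rw [key, tau_star_dagger_ehk_mul hZ hT]
  · set D := sqrtOp (1 - S * star S)
    set r := mapL (gaussian Z (ancilla S R)) Y with hr
    have e1 : dilatedEmbedding Z S (star (Z ψ)) =
        -mapL (star (Z (D ψ))) (parity Z) + mapL 1 (star (Z (star S ψ))) := by
      rw [dilatedEmbedding_creation hZ h, star_double_apply hZ]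
      simp only [WithLp.toLp_fst, WithLp.toLp_snd, map_neg, star_neg, mapL_neg_left]
      rfl
    have e2 : tau (mapL 1 (star (Z (star S ψ))) * dilatedEmbedding Z S X * r) =
        tau (star (Z (star S ψ)) * dagger (ehk Z S R) X * Y) := by
      rw [mul_assoc, tau_mul_comm, mul_assoc, hr, ← mapL_mul, mul_one, ← key, ← mul_assoc,
        tau_mul_comm, mul_assoc]
    have e3 : mapL (star (Z (ancilla S R (D ψ)))) (parity Z) =
        star (double Z (WithLp.toLp 2 (ancilla S R (D ψ), 0))) := by
      rw [star_double_apply hZ]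
      simp
    have e4 : D (ancilla S R (D ψ)) = R ψ :=
      congrArg (fun T : Op H => T ψ) (sqrtOp_mul_ancilla_mul_sqrtOp h)
    -- Exchange replaces Dψ by TDψ; pulling the graded commutator back through the embedding applies
    -- -D, and DTD = R. This sign cancels the one in front of the first block of the dilation.
    have e5 : tau (mapL (star (Z (D ψ))) (parity Z) * dilatedEmbedding Z S X * r) =
        -tau (dagger (ehk Z S R) (contract Z (R ψ) X) * Y) := by
      rw [hr, tau_mapL_gaussian_exchange hZ hT, e3, (gradedComm_dilatedEmbedding hZ hirr h _ X).2,
        ← key, e4, map_neg]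
      simp
    rw [key, dilatedEmbedding_mul hZ h, e1, add_mul, add_mul, map_add, e2, neg_mul, neg_mul,
      map_neg, e5, neg_neg, add_mul, map_add, add_comm]

end EHK

/-! ## Complete positivity of the semigroup -/

section Trotter

variable {𝔸 : Type*} [NormedRing 𝔸] [NormOneClass 𝔸] [NormedAlgebra ℂ 𝔸] [CompleteSpace 𝔸]

lemma norm_pow_sub_pow_le {x y : 𝔸} {M : ℝ} (hM : 1 ≤ M) (hx : ‖x‖ ≤ M) (hy : ‖y‖ ≤ M) (n : ℕ) :
    ‖x ^ n - y ^ n‖ ≤ n * M ^ n * ‖x - y‖ := by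
  have hM0 : 0 ≤ M := by linarith
  induction n with
  | zero => simp
  | succ n ih =>
    have e : x ^ (n + 1) - y ^ (n + 1) = x ^ n * (x - y) + (x ^ n - y ^ n) * y := by
      rw [pow_succ, pow_succ]; noncomm_ring
    have h1 : ‖x ^ n * (x - y)‖ ≤ M ^ n * ‖x - y‖ :=
      (norm_mul_le _ _).trans (by gcongr; exact (norm_pow_le _ _).trans (by gcongr))
    have h2 : ‖(x ^ n - y ^ n) * y‖ ≤ n * M ^ n * ‖x - y‖ * M :=
      (norm_mul_le _ _).trans (by gcongr)
    have h3 : M ^ n * ‖x - y‖ ≤ M ^ (n + 1) * ‖x - y‖ :=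
      mul_le_mul_of_nonneg_right (pow_le_pow_right₀ hM n.le_succ) (norm_nonneg _)
    calc _ ≤ M ^ n * ‖x - y‖ + n * M ^ n * ‖x - y‖ * M := by
          rw [e]; exact (norm_add_le _ _).trans (add_le_add h1 h2)
      _ ≤ _ := by
          push_cast
          rw [pow_succ] at h3 ⊢
          linarith

/-- If `F 0 = 1` and `F' 0 = L`, then `F (1 / n) ^ n` converges to `exp L`. -/
lemma tendsto_pow_exp_of_hasDerivAt {F : ℝ → 𝔸} {L : 𝔸} (h0 : F 0 = 1) (hF : HasDerivAt F L 0) :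
    Filter.Tendsto (fun n : ℕ => F ((n : ℝ)⁻¹) ^ n) Filter.atTop (𝓝 (NormedSpace.exp L)) := by
  have hE : HasDerivAt (fun s : ℝ => NormedSpace.exp ((s : ℂ) • L)) L 0 := by
    simpa using hasDerivAt_exp_ofReal_smul L 0
  have hn : Filter.Tendsto (fun n : ℕ => (n : ℝ)⁻¹) Filter.atTop (𝓝 0) :=
    tendsto_inv_atTop_nhds_zero_nat
  -- Growth by at most e^{C/n} per step keeps n-fold products below e^C, uniformly in n.
  have bound : ∀ g : ℝ → 𝔸, g 0 = 1 → HasDerivAt g L 0 →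
      ∃ C, ∀ᶠ n : ℕ in Filter.atTop, ‖g (n : ℝ)⁻¹‖ ≤ Real.exp (C * (n : ℝ)⁻¹) := by
    intro g hg0 hg
    obtain ⟨C, hC⟩ := hg.differentiableAt.isBigO_sub.bound
    refine ⟨C, (hn.eventually hC).mono fun n hn => ?_⟩
    rw [hg0, sub_zero, Real.norm_of_nonneg (by positivity)] at hn
    have := norm_add_le (g (n : ℝ)⁻¹ - 1) 1
    rw [sub_add_cancel, norm_one] at this
    linarith [Real.add_one_le_exp (C * (n : ℝ)⁻¹)]
  obtain ⟨C₁, h1⟩ := bound F h0 hF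
  obtain ⟨C₂, h2⟩ := bound _ (by simp) hE
  -- Both curves have the same value and derivative at 0, so they differ by o(1/n), which absorbs
  -- the factor n from telescoping.
  have hD : Filter.Tendsto
      (fun n : ℕ => (n : ℝ) * ‖F (n : ℝ)⁻¹ - NormedSpace.exp ((((n : ℝ)⁻¹ : ℝ) : ℂ) • L)‖)
      Filter.atTop (𝓝 0) := by
    have h := (hF.sub hE)
    rw [sub_self] at h
    have h' := h.isLittleO.norm_left.comp_tendsto hn
    refine (h'.tendsto_div_nhds_zero).congr fun n => ?_
    simp [h0, mul_comm, -Complex.ofReal_inv, -Complex.coe_smul]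
  rw [tendsto_iff_norm_sub_tendsto_zero]
  set C := max (max C₁ C₂) 0
  have hlim : Filter.Tendsto (fun n : ℕ => Real.exp C *
      ((n : ℝ) * ‖F (n : ℝ)⁻¹ - NormedSpace.exp ((((n : ℝ)⁻¹ : ℝ) : ℂ) • L)‖))
      Filter.atTop (𝓝 0) := by simpa using hD.const_mul (Real.exp C)
  refine squeeze_zero' (Filter.Eventually.of_forall fun n => norm_nonneg _) ?_ hlim
  filter_upwards [h1, h2, Filter.eventually_gt_atTop 0] with n h1 h2 hpos
  have hn0 : (n : ℝ) ≠ 0 := by exact_mod_cast hpos.ne'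
  have hM : Real.exp (C * (n : ℝ)⁻¹) ^ n = Real.exp C := by
    rw [← Real.exp_nat_mul]
    congr 1
    field_simp
  have hexp : NormedSpace.exp L = NormedSpace.exp ((((n : ℝ)⁻¹ : ℝ) : ℂ) • L) ^ n := by
    let := NormedAlgebra.restrictScalars ℚ ℂ 𝔸
    rw [← NormedSpace.exp_nsmul, ← Nat.cast_smul_eq_nsmul ℂ, smul_smul]
    push_cast
    rw [mul_inv_cancel₀ (by exact_mod_cast hn0), one_smul]
  have hle : ∀ c, c ≤ C → Real.exp (c * (n : ℝ)⁻¹) ≤ Real.exp (C * (n : ℝ)⁻¹) := fun c hc =>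
    Real.exp_le_exp.mpr (by gcongr)
  have := norm_pow_sub_pow_le (Real.one_le_exp (by positivity))
    (h1.trans (hle C₁ (by simp [C]))) (h2.trans (hle C₂ (by simp [C]))) n
  rw [hM] at this
  rw [hexp]
  linarith

end Trotter

/-! ### Completely positive maps and exponentials of Lindblad generators. -/

section CompletelyPositive

variable {K : Type*} [NormedAddCommGroup K] [InnerProductSpace ℂ K] [CompleteSpace K]

/-- Complete positivity of a super-operator. -/
def IsCompletelyPositive (Φ : SuperOp K) : Prop :=
  ∀ (k : ℕ) (M : CStarMatrix (Fin k) (Fin k) (Op K)), 0 ≤ M → 0 ≤ M.map Φ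

lemma isCompletelyPositive_one : IsCompletelyPositive (1 : SuperOp K) := fun _ _ hM => hM

lemma IsCompletelyPositive.mul {Φ Ψ : SuperOp K} (hΦ : IsCompletelyPositive Φ)
    (hΨ : IsCompletelyPositive Ψ) : IsCompletelyPositive (Φ * Ψ) :=
  fun k _ hM => hΦ k _ (hΨ k _ hM)

lemma IsCompletelyPositive.pow {Φ : SuperOp K} (hΦ : IsCompletelyPositive Φ) (n : ℕ) :
    IsCompletelyPositive (Φ ^ n) := by
  induction n with
  | zero => exact isCompletelyPositive_one
  | succ n ih => rw [pow_succ]; exact ih.mul hΦ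

lemma IsCompletelyPositive.add {Φ Ψ : SuperOp K} (hΦ : IsCompletelyPositive Φ)
    (hΨ : IsCompletelyPositive Ψ) : IsCompletelyPositive (Φ + Ψ) :=
  fun k M hM => (add_nonneg (hΦ k M hM) (hΨ k M hM) : 0 ≤ M.map Φ + M.map Ψ)

/-- The matrix amplification is conjugation by the diagonal matrix with entries B. -/
lemma isCompletelyPositive_conj (B : Op K) :
    IsCompletelyPositive (ContinuousLinearMap.mulLeftRight ℂ (Op K) B (star B)) := by
  intro k M hM
  have h := star_right_conjugate_nonneg hM
    (CStarMatrix.ofMatrix (Matrix.diagonal fun _ : Fin k => B))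
  convert h using 1
  ext1 i j
  have e : ∀ x : Fin k, star (if j = x then B else 0) = if j = x then star B else 0 := fun x => by
    split_ifs <;> simp
  simp [CStarMatrix.mul_apply, CStarMatrix.star_apply, Matrix.diagonal_apply,
    ContinuousLinearMap.mulLeftRight_apply, e]

lemma isCompletelyPositive_zero : IsCompletelyPositive (0 : SuperOp K) := fun _ _ _ => le_rfl

lemma isCompletelyPositive_sum {ι : Type*} (s : Finset ι) {Φ : ι → SuperOp K}
    (h : ∀ i, IsCompletelyPositive (Φ i)) : IsCompletelyPositive (∑ i ∈ s, Φ i) := by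
  classical
  induction s using Finset.induction_on with
  | empty => exact isCompletelyPositive_zero
  | insert i s hi ih => rw [Finset.sum_insert hi]; exact (h i).add ih

lemma isCompletelyPositive_of_tendsto {Φ : ℕ → SuperOp K} {Ψ : SuperOp K}
    (h : ∀ n, IsCompletelyPositive (Φ n)) (hΨ : Filter.Tendsto Φ Filter.atTop (𝓝 Ψ)) :
    IsCompletelyPositive Ψ := by
  intro k M hM
  have ht : Filter.Tendsto (fun n => M.map (Φ n)) Filter.atTop (𝓝 (M.map Ψ)) := by
    refine tendsto_pi_nhds.mpr fun i => tendsto_pi_nhds.mpr fun j => ?_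
    exact ((ContinuousLinearMap.apply ℂ (Op K) (M i j)).continuous.tendsto Ψ).comp hΨ
  exact CStarAlgebra.isClosed_nonneg.mem_of_tendsto ht (Filter.Eventually.of_forall fun n => h n k M hM)

lemma IsCompletelyPositive.exists_map {Φ : SuperOp K} (h : IsCompletelyPositive Φ) :
    ∃ F : CompletelyPositiveMap (Op K) (Op K), ∀ X, F.toLinearMap X = Φ X :=
  ⟨⟨Φ.toLinearMap, h⟩, fun _ => rfl⟩

lemma IsCompletelyPositive.map_nonneg {Φ : SuperOp K} (h : IsCompletelyPositive Φ) {X : Op K}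
    (hX : 0 ≤ X) : 0 ≤ Φ X := by
  obtain ⟨F, hF⟩ := h.exists_map
  rw [← hF]
  exact _root_.map_nonneg F hX

/-- A Lindblad generator exponentiates to completely positive maps. -/
lemma isCompletelyPositive_exp [Nontrivial K] {ι : Type*} [Fintype ι] {L : SuperOp K} (V : ι → Op K)
    (κ : Op K) (hL : ∀ X, L X = ∑ i, V i * X * star (V i) + κ * X + X * star κ) {t : ℝ}
    (ht : 0 ≤ t) : IsCompletelyPositive (NormedSpace.exp ((t : ℂ) • L)) := by
  let conj (B : Op K) : SuperOp K := ContinuousLinearMap.mulLeftRight ℂ (Op K) B (star B)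
  have hconj : ∀ B X, conj B X = B * X * star B := fun B X => rfl
  -- A map in Kraus form that agrees with 1 + stL to first order: conjugation by 1 + stκ gives the κ
  -- terms and the error (st)² κXκ*, while the square roots make the jump terms linear in s.
  let F (s : ℝ) : SuperOp K := conj (1 + ((s * t : ℝ) : ℂ) • κ) +
    ∑ i, conj (((√(s * t) : ℝ) : ℂ) • V i)
  have hF : ∀ s, 0 ≤ s → F s = 1 + s • ((t : ℂ) • L) + s ^ 2 • ((t ^ 2 : ℂ) • conj κ) := by
    intro s hs
    ext1 X
    have hsq : (((√(s * t) : ℝ) : ℂ)) * ((√(s * t) : ℝ) : ℂ) = (s : ℂ) * t := by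
      rw [← Complex.ofReal_mul, Real.mul_self_sqrt (by positivity), Complex.ofReal_mul]
    simp only [F, add_apply, sum_apply, smul_apply, hconj, hL, one_apply_eq_self, star_add,
      star_smul, star_one, smul_mul_assoc, mul_smul_comm, Complex.star_def, Complex.conj_ofReal,
      smul_smul, hsq, ← Complex.coe_smul, ← Finset.smul_sum]
    simp only [mul_add, add_mul, one_mul, mul_one, smul_mul_assoc, mul_smul_comm]
    push_cast
    module
  -- The two-sided derivative is taken of the polynomial, which equals F only for s ≥ 0: real square
  -- roots of negative numbers are 0.
  have hD : HasDerivAt (fun s : ℝ => 1 + s • ((t : ℂ) • L) + s ^ 2 • ((t ^ 2 : ℂ) • conj κ))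
      ((t : ℂ) • L) 0 := by
    have h1 := (hasDerivAt_id (0 : ℝ)).smul_const ((t : ℂ) • L)
    have h2 := ((hasDerivAt_id (0 : ℝ)).pow 2).smul_const ((t ^ 2 : ℂ) • conj κ)
    exact ((h1.const_add 1).add h2).congr_deriv (by simp)
  refine isCompletelyPositive_of_tendsto (fun n => ?_)
    (tendsto_pow_exp_of_hasDerivAt (by ext1 X; simp) hD)
  rw [← hF _ (by positivity)]
  exact ((isCompletelyPositive_conj _).add
    (isCompletelyPositive_sum _ fun i => isCompletelyPositive_conj _)).pow n

end CompletelyPositive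

/-! ## The dual semigroup -/

section Dual

variable {H : Type*} [NormedAddCommGroup H] [InnerProductSpace ℂ H]
  [FiniteDimensional ℂ H] [CompleteSpace H]
variable {K : Type*} [NormedAddCommGroup K] [InnerProductSpace ℂ K] [CompleteSpace K]
  [FiniteDimensional ℂ K]
variable {Z : H →ₗ⋆[ℂ] Op K} {G A : Op H}
  {η : OrthonormalBasis (Fin (Module.finrank ℂ H)) ℂ H} {lam : Fin (Module.finrank ℂ H) → ℝ}

lemma dagger_lindbladTerm_apply {W : Op K} (hW : star W = W) (B X : Op K) :
    dagger (lindbladTerm W B) X = W * B * X * star (W * B) - (1 / 2 : ℂ) • (star B * B * X)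
      - (1 / 2 : ℂ) • (X * (star B * B)) := by
  have h : star (1 / 2 : ℂ) = 1 / 2 := by simp
  simp [lindbladTerm, dagger_sub, dagger_smul, dagger_mulLeftRight, hW]

lemma dagger_lindbladGenerator_apply (X : Op K) :
    dagger (lindbladGenerator Z G η lam) X =
      (∑ j, ((1 - lam j : ℝ) : ℂ) •
        dagger (lindbladTerm (parity Z) (Z (sqrtOp (-G - star G) (η j)))) X)
      + (∑ j, (lam j : ℂ) •
        dagger (lindbladTerm (parity Z) (star (Z (sqrtOp (-G - star G) (η j))))) X)
      + Complex.I • (hat Z (hamiltonian G) * X - X * hat Z (hamiltonian G)) := by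
  simp only [lindbladGenerator, dagger_sub, dagger_add, dagger_sum, dagger_smul,
    dagger_mulLeftRight, Complex.star_def, Complex.conj_ofReal, Complex.conj_I, star_hat,
    star_hamiltonian, star_one, add_apply, sub_apply, sum_apply, smul_apply,
    ContinuousLinearMap.mulLeftRight_apply, one_mul, mul_one]
  module

/-- The jump operators are √(1-λ_j) WZ(φ_j) and √λ_j WZ*(φ_j); the bounds on λ make their squared
coefficients the weights in the generator. The Hamiltonian and the anticommutator terms go into κ.
-/
lemma isCompletelyPositive_exp_dagger [Nontrivial K] (hZ : IsCARField Z)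
    (hlam : ∀ j, 0 ≤ lam j ∧ lam j ≤ 1) {t : ℝ} (ht : 0 ≤ t) :
    IsCompletelyPositive
      (NormedSpace.exp ((t : ℂ) • dagger (lindbladGenerator Z G η lam))) := by
  set φ : Fin (Module.finrank ℂ H) → Op K := fun j => Z (sqrtOp (-G - star G) (η j)) with hφ
  refine isCompletelyPositive_exp
    (Sum.elim (fun j => ((√(1 - lam j) : ℝ) : ℂ) • (parity Z * φ j))
      (fun j => ((√(lam j) : ℝ) : ℂ) • (parity Z * star (φ j))))
    (Complex.I • hat Z (hamiltonian G)
      - ∑ j, ((1 - lam j : ℝ) : ℂ) • ((1 / 2 : ℂ) • (star (φ j) * φ j))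
      - ∑ j, (lam j : ℂ) • ((1 / 2 : ℂ) • (φ j * star (φ j)))) (fun X => ?_) ht
  have h : star (1 / 2 : ℂ) = 1 / 2 := by simp
  have hs : ∀ c : ℝ, 0 ≤ c → ((√c : ℝ) : ℂ) * ((√c : ℝ) : ℂ) = c := fun c hc => by
    rw [← Complex.ofReal_mul, Real.mul_self_sqrt hc]
  have h1 : ∀ j, ((√(1 - lam j) : ℝ) : ℂ) * ((√(1 - lam j) : ℝ) : ℂ) = ((1 - lam j : ℝ) : ℂ) :=
    fun j => hs _ (by linarith [(hlam j).2])
  have h2 : ∀ j, ((√(lam j) : ℝ) : ℂ) * ((√(lam j) : ℝ) : ℂ) = lam j := fun j => hs _ (hlam j).1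
  rw [dagger_lindbladGenerator_apply, Fintype.sum_sum_type]
  simp only [dagger_lindbladTerm_apply (star_parity hZ), Sum.elim_inl, Sum.elim_inr, star_smul,
    smul_mul_assoc, mul_smul_comm, smul_smul, Complex.star_def, Complex.conj_ofReal,
    Complex.conj_I, h1, h2, star_sub, star_sum, star_mul, star_star, star_hat, star_hamiltonian,
    smul_sub, Finset.sum_sub_distrib, sub_mul, mul_sub, Finset.sum_mul, Finset.mul_sum]
  rw [← Complex.star_def, h]
  simp only [hφ, mul_comm (1 / 2 : ℂ)]
  module

/-! ### Gauge covariance -/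

lemma gaugeDual_apply (s : ℝ) (X : Op K) : gaugeDual Z s X =
    NormedSpace.exp ((-(s * Complex.I) : ℂ) • number Z) * X *
      NormedSpace.exp ((s * Complex.I : ℂ) • number Z) := rfl

lemma exp_number_mul_exp_number (s : ℝ) :
    NormedSpace.exp ((-(s * Complex.I) : ℂ) • number Z) *
      NormedSpace.exp ((s * Complex.I : ℂ) • number Z) = 1 := by
  rw [neg_smul, exp_neg_mul_exp]

lemma exp_number_mul_exp_number' (s : ℝ) :
    NormedSpace.exp ((s * Complex.I : ℂ) • number Z) *
      NormedSpace.exp ((-(s * Complex.I) : ℂ) • number Z) = 1 := by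
  rw [neg_smul, exp_mul_exp_neg]

lemma gaugeDual_mul (s : ℝ) (X Y : Op K) :
    gaugeDual Z s (X * Y) = gaugeDual Z s X * gaugeDual Z s Y := by
  have h := exp_number_mul_exp_number' (Z := Z) s
  simp only [gaugeDual_apply, mul_assoc]
  rw [← mul_assoc (NormedSpace.exp ((s * Complex.I : ℂ) • number Z)), h, one_mul]

lemma gaugeDual_of_commute {s : ℝ} {X : Op K}
    (h : Commute X (NormedSpace.exp ((s * Complex.I : ℂ) • number Z))) : gaugeDual Z s X = X := by
  rw [gaugeDual_apply, mul_assoc, h.eq, ← mul_assoc, exp_number_mul_exp_number, one_mul]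

lemma gaugeDual_creation (hZ : IsCARField Z) (s : ℝ) (ψ : H) : gaugeDual Z s (star (Z ψ)) =
    Complex.exp (-(s * Complex.I)) • star (Z ψ) := by
  rw [gaugeDual_apply, exp_number_mul_creation hZ, smul_mul_assoc, mul_assoc,
    exp_number_mul_exp_number, mul_one]

lemma gaugeDual_field (hZ : IsCARField Z) (s : ℝ) (ψ : H) : gaugeDual Z s (Z ψ) =
    Complex.exp (s * Complex.I) • Z ψ := by
  rw [gaugeDual_apply, exp_number_mul hZ, smul_mul_assoc, mul_assoc,
    exp_number_mul_exp_number, mul_one, neg_neg]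

lemma exp_mul_exp_neg_phase (s : ℝ) :
    Complex.exp (s * Complex.I) * Complex.exp (-(s * Complex.I)) = 1 := by
  rw [← Complex.exp_add, add_neg_cancel, Complex.exp_zero]

lemma gaugeDual_creation_mul_field (hZ : IsCARField Z) (s : ℝ) (ψ φ : H) :
    gaugeDual Z s (star (Z ψ) * Z φ) = star (Z ψ) * Z φ := by
  rw [gaugeDual_mul, gaugeDual_creation hZ, gaugeDual_field hZ, smul_mul_smul_comm, mul_comm,
    exp_mul_exp_neg_phase, one_smul]

lemma gaugeDual_hat (hZ : IsCARField Z) (s : ℝ) (Y : Op H) :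
    gaugeDual Z s (hat Z Y) = hat Z Y := by
  rw [hat, map_sum]
  exact Finset.sum_congr rfl fun j _ => gaugeDual_creation_mul_field hZ s _ _

lemma gaugeDual_parity (s : ℝ) : gaugeDual Z s (parity Z) = parity Z :=
  gaugeDual_of_commute
    (((((Commute.refl (number Z)).smul_left _).smul_right _).exp_left).exp_right)

/-- Every summand contains B and its adjoint once each, so the phases cancel. -/
lemma gaugeDual_lindbladTerm {s : ℝ} {B : Op K} {c d : ℂ} (hcd : c * d = 1)
    (hB : gaugeDual Z s B = c • B) (hB' : gaugeDual Z s (star B) = d • star B) (X : Op K) :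
    gaugeDual Z s (lindbladTerm (parity Z) B X) =
      lindbladTerm (parity Z) B (gaugeDual Z s X) := by
  simp only [lindbladTerm_apply, map_sub, map_smul, gaugeDual_mul, hB, hB', gaugeDual_parity,
    smul_mul_assoc, mul_smul_comm, smul_smul, hcd, one_smul]

lemma gaugeDual_lindbladGenerator (hZ : IsCARField Z) (s : ℝ) (X : Op K) :
    gaugeDual Z s (lindbladGenerator Z G η lam X) =
      lindbladGenerator Z G η lam (gaugeDual Z s X) := by
  have h1 : ∀ φ, gaugeDual Z s (lindbladTerm (parity Z) (Z φ) X) =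
      lindbladTerm (parity Z) (Z φ) (gaugeDual Z s X) := fun φ =>
    gaugeDual_lindbladTerm (exp_mul_exp_neg_phase s) (gaugeDual_field hZ s φ)
      (gaugeDual_creation hZ s φ) X
  have h2 : ∀ φ, gaugeDual Z s (lindbladTerm (parity Z) (star (Z φ)) X) =
      lindbladTerm (parity Z) (star (Z φ)) (gaugeDual Z s X) := fun φ =>
    gaugeDual_lindbladTerm ((mul_comm _ _).trans (exp_mul_exp_neg_phase s))
      (gaugeDual_creation hZ s φ) (by rw [star_star]; exact gaugeDual_field hZ s φ) X
  simp only [lindbladGenerator_apply, map_sub, map_add, map_sum, map_smul, gaugeDual_mul,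
    gaugeDual_hat hZ, h1, h2]

lemma dagger_gaugeDual (s : ℝ) : dagger (gaugeDual Z s) = gaugeDual Z (-s) := by
  rw [gaugeDual, dagger_mulLeftRight, star_exp_smul_number, star_exp_smul_number, gaugeDual]
  simp

lemma commute_dagger_lindbladGenerator_gaugeDual (hZ : IsCARField Z) (s : ℝ) :
    Commute (dagger (lindbladGenerator Z G η lam)) (gaugeDual Z s) := by
  have h : lindbladGenerator Z G η lam * gaugeDual Z (-s) =
      gaugeDual Z (-s) * lindbladGenerator Z G η lam := by
    ext1 X
    rw [mul_apply_eq_comp, mul_apply_eq_comp, gaugeDual_lindbladGenerator hZ]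
  have h' := congrArg dagger h
  rw [dagger_mul, dagger_mul, dagger_gaugeDual, neg_neg] at h'
  exact h'.symm

lemma commute_exp_smul {𝔸 : Type*} [NormedRing 𝔸] [NormedAlgebra ℂ 𝔸] [CompleteSpace 𝔸] {a b : 𝔸}
    (h : Commute a b) (t : ℂ) : Commute (NormedSpace.exp (t • a)) b :=
  (h.smul_left t).exp_left

lemma isGaugeCovariant_exp_dagger (hZ : IsCARField Z) (t : ℂ) :
    IsGaugeCovariant Z (NormedSpace.exp (t • dagger (lindbladGenerator Z G η lam))) := by
  intro s
  have h := commute_exp_smul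
    (commute_dagger_lindbladGenerator_gaugeDual (G := G) (η := η) (lam := lam) hZ s) t
  exact h.eq.symm

/-- For the converse, invariance means that X commutes with e^{is𝒩} for all s; the derivative at s =
0 gives commutation with 𝒩. -/
lemma mem_arakiWyss_iff {X : Op K} : X ∈ arakiWyss Z ↔ ∀ s : ℝ, gaugeDual Z s X = X := by
  rw [arakiWyss, Subalgebra.mem_centralizer_iff]
  simp only [Set.mem_singleton_iff, forall_eq]
  constructor
  · intro h s
    exact gaugeDual_of_commute ((Commute.smul_right (show Commute X (number Z) from h.symm) _).exp_right)
  · intro h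
    have h1 : ∀ s : ℝ, NormedSpace.exp ((s : ℂ) • (Complex.I • number Z)) * X -
        X * NormedSpace.exp ((s : ℂ) • (Complex.I • number Z)) = 0 := by
      intro s
      conv_lhs => rw [← h s]
      rw [gaugeDual_apply, smul_smul]
      have h2 := exp_number_mul_exp_number' (Z := Z) s
      have h3 := h s
      rw [gaugeDual_apply] at h3
      rw [← mul_assoc, ← mul_assoc, h2, one_mul, h3, sub_self]
    have h2 := ((hasDerivAt_exp_ofReal_smul (Complex.I • number Z) 0).mul_const X).sub
      ((hasDerivAt_exp_ofReal_smul (Complex.I • number Z) 0).const_mul X)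
    have h3 := h2.unique ((hasDerivAt_const (0 : ℝ) (0 : Op K)).congr_of_eventuallyEq
      (Filter.Eventually.of_forall h1))
    rw [exp_ofReal_zero_smul, mul_one, smul_mul_assoc, mul_smul_comm, ← smul_sub] at h3
    exact sub_eq_zero.mp ((smul_eq_zero.mp h3).resolve_left Complex.I_ne_zero)

lemma IsGaugeCovariant.map_mem_arakiWyss {Φ : SuperOp K} (h : IsGaugeCovariant Z Φ) {X : Op K}
    (hX : X ∈ arakiWyss Z) : Φ X ∈ arakiWyss Z := by
  rw [mem_arakiWyss_iff] at hX ⊢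
  intro s
  have := congrArg (fun Ψ : SuperOp K => Ψ X) (h s)
  simpa [hX s] using this

/-! ### The semigroup as adjoint of quasi-free maps -/

lemma isQuasiFree_exp_lindbladGenerator (hZ : IsCARField Z) (hA : 0 ≤ A)
    (hAG : A ≤ -G - star G) (hη : ∀ j, mixing G A (η j) = (lam j : ℂ) • η j) (t : ℝ) :
    IsQuasiFree Z (NormedSpace.exp ((t : ℂ) • lindbladGenerator Z G η lam))
      (NormedSpace.exp ((t : ℂ) • G)) (integralR G A t) :=
  isQuasiFree_exp (lindbladGenerator_one hZ) (lindbladGenerator_star hZ)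
    (lindbladGenerator_contract hZ (sum_inner_smul_sqrtOp (hA.trans hAG) η))
    (lindbladGenerator_creation_mul hZ (sum_inner_smul_sqrtOp (hA.trans hAG) η)
      (sum_mul_inner_smul_sqrtOp hA hAG hη)) t

lemma contract_exp {L : SuperOp K}
    (hLD : ∀ χ X, L (contract Z χ X) = contract Z χ (L X) - contract Z (G χ) X) (χ : H) (X : Op K)
    (t : ℝ) : contract Z χ (NormedSpace.exp ((t : ℂ) • L) X) =
      NormedSpace.exp ((t : ℂ) • L) (contract Z (NormedSpace.exp ((t : ℂ) • G) χ) X) := by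
  have h := antiderivation_mul_exp (D := contract Z) (L := L) (G := G)
    (fun χ => ContinuousLinearMap.ext fun X => hLD χ X) χ t
  exact congrArg (fun Φ : SuperOp K => Φ X) h

lemma contract_exp_lindbladGenerator (hZ : IsCARField Z) (hG : 0 ≤ -G - star G) (t : ℝ) (χ : H)
    (X : Op K) :
    contract Z χ (NormedSpace.exp ((t : ℂ) • lindbladGenerator Z G η lam) X) =
      NormedSpace.exp ((t : ℂ) • lindbladGenerator Z G η lam)
        (contract Z (NormedSpace.exp ((t : ℂ) • G) χ) X) := by
  exact contract_exp (lindbladGenerator_contract hZ (sum_inner_smul_sqrtOp hG η)) χ X t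

lemma dagger_exp_ofReal_smul (Φ : SuperOp K) (t : ℝ) :
    dagger (NormedSpace.exp ((t : ℂ) • Φ)) = NormedSpace.exp ((t : ℂ) • dagger Φ) := by
  rw [dagger_exp, dagger_smul, Complex.star_def, Complex.conj_ofReal]

lemma tau_dagger {Φ : SuperOp K} (h : Φ 1 = 1) (X : Op K) : tau (dagger Φ X) = tau X := by
  have := tau_star_mul_traceAdjoint Φ.toLinearMap X 1
  rw [star_one, one_mul, show Φ.toLinearMap 1 = 1 from h, star_one, one_mul] at this
  exact this

/-- The dual of `Φ_{e^{tG}, R_t}` is the exponential of the Lindblad generator. -/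
theorem dagger_ehk_exp (hZ : IsCARField Z) (hirr : IsIrreducible Z)
    (hG : IsContractionGenerator G) (hA : 0 ≤ A) (hAG : A ≤ -G - star G)
    (hη : ∀ j, mixing G A (η j) = (lam j : ℂ) • η j) {t : ℝ} (ht : 0 ≤ t) :
    dagger (ehk Z (NormedSpace.exp ((t : ℂ) • G)) (integralR G A t)) =
      NormedSpace.exp ((t : ℂ) • lindbladGenerator Z G η lam) :=
  (isQuasiFree_dagger_ehk hZ hirr (isCompatible_exp hG hA hAG ht)).eq
    (isQuasiFree_exp_lindbladGenerator hZ hA hAG hη t) hZ hirr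

theorem ehk_exp (hZ : IsCARField Z) (hirr : IsIrreducible Z)
    (hG : IsContractionGenerator G) (hA : 0 ≤ A) (hAG : A ≤ -G - star G)
    (hη : ∀ j, mixing G A (η j) = (lam j : ℂ) • η j) {t : ℝ} (ht : 0 ≤ t) :
    ehk Z (NormedSpace.exp ((t : ℂ) • G)) (integralR G A t) =
      NormedSpace.exp ((t : ℂ) • dagger (lindbladGenerator Z G η lam)) := by
  rw [← dagger_exp_ofReal_smul, ← dagger_ehk_exp hZ hirr hG hA hAG hη ht, dagger_dagger]

lemma HasExchange.exp_dagger (hZ : IsCARField Z) (hA : 0 ≤ A)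
    (hAG : A ≤ -G - star G) (hη : ∀ j, mixing G A (η j) = (lam j : ℂ) • η j) {ρ : Op K} {Q : Op H}
    (h : HasExchange Z ρ Q) (t : ℝ) :
    HasExchange Z (NormedSpace.exp ((t : ℂ) • dagger (lindbladGenerator Z G η lam)) ρ)
      (integralR G A t + NormedSpace.exp ((t : ℂ) • G) * Q * NormedSpace.exp ((t : ℂ) • star G)) := by
  rw [← dagger_exp_ofReal_smul, ← star_exp_ofReal_smul]
  exact h.map (isQuasiFree_exp_lindbladGenerator hZ hA hAG hη t)
    (contract_exp_lindbladGenerator hZ (hA.trans hAG) t)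

lemma tau_exp_dagger (hZ : IsCARField Z) (t : ℝ) (X : Op K) :
    tau (NormedSpace.exp ((t : ℂ) • dagger (lindbladGenerator Z G η lam)) X) = tau X := by
  rw [← dagger_exp_ofReal_smul]
  exact tau_dagger (exp_apply_one (lindbladGenerator_one hZ) t) X

/-- The transported exchange relation supplies the Gaussian moments of the image, while complete
positivity and trace preservation make it a density matrix. -/
lemma isGIGOperation_exp_dagger (hZ : IsCARField Z) (hirr : IsIrreducible Z) (hA : 0 ≤ A)
    (hAG : A ≤ -G - star G) (hη : ∀ j, mixing G A (η j) = (lam j : ℂ) • η j) {t : ℝ}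
    (ht : 0 ≤ t) :
    IsGIGOperation Z (NormedSpace.exp ((t : ℂ) • dagger (lindbladGenerator Z G η lam))) := by
  have := hirr.nontrivial
  have hcp := isCompletelyPositive_exp_dagger (Z := Z) (G := G) (η := η) hZ
    (eigenvalue_mixing_mem hA hAG hη) ht
  refine ⟨⟨hcp.exists_map, tau_exp_dagger hZ t⟩, isGaugeCovariant_exp_dagger hZ _, fun ρ hρ => ?_⟩
  obtain ⟨Q, hQ⟩ := hρ.hasExchange hZ hirr
  exact (hQ.exp_dagger hZ hA hAG hη t).isGIG hZ
    ⟨hcp.map_nonneg hρ.density.nonneg, (tau_exp_dagger hZ t ρ).trans hρ.density.tau_eq_one⟩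

lemma isGIGSemigroup_exp_dagger (hZ : IsCARField Z) (hirr : IsIrreducible Z) (hA : 0 ≤ A)
    (hAG : A ≤ -G - star G) (hη : ∀ j, mixing G A (η j) = (lam j : ℂ) • η j) :
    IsGIGSemigroup Z
      (fun t => NormedSpace.exp ((t : ℂ) • dagger (lindbladGenerator Z G η lam))) := by
  set L := dagger (lindbladGenerator Z G η lam) with hL
  have h0 : NormedSpace.exp (((0 : ℝ) : ℂ) • L) = 1 := exp_ofReal_zero_smul L
  have h1 : ∀ s t : ℝ, NormedSpace.exp (((s + t : ℝ) : ℂ) • L) =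
    NormedSpace.exp ((s : ℂ) • L) * NormedSpace.exp ((t : ℂ) • L) := exp_ofReal_add_smul L
  have h2 : Continuous fun t : ℝ => NormedSpace.exp ((t : ℂ) • L) := continuous_exp_ofReal_smul L
  exact ⟨h0, fun s t _ _ => h1 s t, h2.continuousOn,
    fun t ht => isGIGOperation_exp_dagger hZ hirr hA hAG hη ht⟩

lemma tendsto_inv_smul_exp_sub_one {𝔸 : Type*} [NormedRing 𝔸] [NormedAlgebra ℂ 𝔸]
    [CompleteSpace 𝔸] (L : 𝔸) :
    Filter.Tendsto (fun t : ℝ => ((t⁻¹ : ℝ) : ℂ) • (NormedSpace.exp ((t : ℂ) • L) - 1))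
      (𝓝[>] 0) (𝓝 L) := by
  have h := (hasDerivAt_exp_ofReal_smul L 0).tendsto_slope_zero_right
  rw [exp_ofReal_zero_smul, mul_one] at h
  refine h.congr fun t => ?_
  rw [zero_add]
  exact (Complex.coe_smul _ _).symm

end Dual

end CAR

end

/-! ### The main theorem. -/

theorem corollary4p5
    {H : Type*} [NormedAddCommGroup H] [InnerProductSpace ℂ H] [CompleteSpace H]
    [FiniteDimensional ℂ H]
    {K : Type*} [NormedAddCommGroup K] [InnerProductSpace ℂ K] [CompleteSpace K]
    [FiniteDimensional ℂ K]
    (Z : H →ₗ⋆[ℂ] CAR.Op K) (hZ : CAR.IsCARField Z) (hirr : CAR.IsIrreducible Z)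
    (G A : CAR.Op H) (hG : CAR.IsContractionGenerator G) (hA : 0 ≤ A) (hAG : A ≤ -G - star G)
    (η : OrthonormalBasis (Fin (Module.finrank ℂ H)) ℂ H)
    (lam : Fin (Module.finrank ℂ H) → ℝ)
    (hη : ∀ j, CAR.mixing G A (η j) = (lam j : ℂ) • η j)
    (L : CAR.SuperOp K) (hL : L = CAR.dagger (CAR.lindbladGenerator Z G η lam)) :
    -- `L† = lim_{t ↓ 0} t⁻¹ (Φ†_{e^{tG}, R_t} - 1)`
    Filter.Tendsto (fun t : ℝ => ((t⁻¹ : ℝ) : ℂ) •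
        (CAR.dagger (CAR.ehk Z (NormedSpace.exp ((t : ℂ) • G)) (CAR.integralR G A t)) - 1))
      (𝓝[>] 0) (𝓝 (CAR.lindbladGenerator Z G η lam)) ∧
    -- the dual semigroup is a GIG quantum semigroup
    CAR.IsGIGSemigroup Z (fun t => NormedSpace.exp ((t : ℂ) • L)) ∧
    ∀ t : ℝ, 0 ≤ t →
      CAR.IsCompatible (NormedSpace.exp ((t : ℂ) • G)) (CAR.integralR G A t) ∧
      -- it extends the restriction of `Φ_{e^{tG}, R_t}` to the Araki–Wyss algebra
      (∀ X ∈ CAR.arakiWyss Z,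
        NormedSpace.exp ((t : ℂ) • L) X ∈ CAR.arakiWyss Z ∧
        NormedSpace.exp ((t : ℂ) • L) X =
          CAR.ehk Z (NormedSpace.exp ((t : ℂ) • G)) (CAR.integralR G A t) X) ∧
      -- its symbol map is `Q ↦ R_t + e^{tG} Q e^{tG*}`
      (∀ Q : CAR.Op H, 0 ≤ Q → Q ≤ 1 →
        CAR.IsSymbol Z (NormedSpace.exp ((t : ℂ) • L) (CAR.gaussian Z Q))
          (CAR.integralR G A t +
            NormedSpace.exp ((t : ℂ) • G) * Q * NormedSpace.exp ((t : ℂ) • star G))) ∧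
      -- the Chernoff product formula
      Filter.Tendsto
        (fun n : ℕ =>
          (CAR.ehk Z (NormedSpace.exp (((t / n : ℝ) : ℂ) • G)) (CAR.integralR G A (t / n))) ^ n)
        Filter.atTop (𝓝 (NormedSpace.exp ((t : ℂ) • L))) := by
  subst hL
  have := hirr.nontrivial
  refine ⟨?_, CAR.isGIGSemigroup_exp_dagger hZ hirr hA hAG hη, fun t ht =>
    ⟨CAR.isCompatible_exp hG hA hAG ht, fun X hX =>
      ⟨(CAR.isGaugeCovariant_exp_dagger hZ _).map_mem_arakiWyss hX, ?_⟩, fun Q hQ _ => ?_, ?_⟩⟩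
  · refine (CAR.tendsto_inv_smul_exp_sub_one _).congr' ?_
    filter_upwards [self_mem_nhdsWithin] with t ht
    rw [CAR.dagger_ehk_exp hZ hirr hG hA hAG hη (le_of_lt ht)]
  · rw [CAR.ehk_exp hZ hirr hG hA hAG hη ht]
  · have hs : (Q : H →ₗ[ℂ] H).IsSymmetric :=
      ContinuousLinearMap.isSelfAdjoint_iff_isSymmetric.mp (IsSelfAdjoint.of_nonneg hQ)
    exact ((CAR.hasExchange_gaussian hZ hs).exp_dagger hZ hA hAG hη t).isSymbol hZ
      ((CAR.tau_exp_dagger hZ t _).trans (CAR.tau_gaussian hZ hs))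
  -- For n ≥ 1 the n-th power equals the exponential exactly, by `ehk_exp` at time t/n. Only n = 0
  -- is excluded, where the power is 1.
  · refine tendsto_const_nhds.congr' ?_
    filter_upwards [Filter.eventually_gt_atTop 0] with n hn
    have hn0 : (n : ℂ) ≠ 0 := by exact_mod_cast hn.ne'
    let := NormedAlgebra.restrictScalars ℚ ℂ (CAR.SuperOp K)
    rw [CAR.ehk_exp hZ hirr hG hA hAG hη (by positivity), ← NormedSpace.exp_nsmul,
      ← Nat.cast_smul_eq_nsmul ℂ, smul_smul]
    congr 2
    push_cast
    field_simp
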